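/- **Setting.** Manifolds are smooth, without boundary, modelled on Banach spaces; forms are complex-valued. For a smooth surjection $\pi\colon X\to M$ admitting local sections (every point of $M$ has a neighbourhood with a smooth section), $X^{[q]}$ is the $q$-fold fibre product of $X$ over $M$, $\pi_i\colon X^{[q+1]}\to X^{[q]}$ omits the $i$-th factor, and $\delta=\sum_{i=1}^{q+1}(-1)^i\pi_i^*\colon\Omega^k(X^{[q]})\to\Omega^k(X^{[q+1]})$. A *bundle gerbe* $(Q,Y,B)$ is a smooth surjection $\pi_Y\colon Y\to B$ admitting local sections and a smooth principal $\mathbb C^\times$-bundle $Q\to Y^{[2]}$ with a smooth associative product $Q_{(y_2,y_3)}\otimes Q_{(y_1,y_2)}\to Q_{(y_1,y_3)}$. A *bundle gerbe connection* is a connection $\nabla$ on $Q$ compatible with the product; a *curving* for it is $f\in\Omega^2(Y)$ with $\delta(f)=F_\nabla$, the curvature of $\nabla$; the *3-curvature* of $(\nabla,f)$ is the $\omega\in\Omega^3(B)$ with $\pi_Y^*\omega=df$. A *bundle 2-gerbe* $(Q,Y,X,M)$ consists of a smooth surjection $X\to M$ admitting local sections; a bundle gerbe $(Q,Y,X^{[2]})$;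 a bundle gerbe morphism $m\colon\pi_1^{-1}Q\otimes\pi_3^{-1}Q\to\pi_2^{-1}Q$ over $X^{[3]}$, that is, smooth maps $Y_{(x_2,x_3)}\times Y_{(x_1,x_2)}\to Y_{(x_1,x_3)}$ and, covering them, $\mathbb C^\times$-bundle maps $Q_{(y_{23},y_{23}')}\otimes Q_{(y_{12},y_{12}')}\to Q_{(m(y_{23},y_{12}),m(y_{23}',y_{12}'))}$ commuting with the bundle gerbe products; and a transformation $a$ over $X^{[4]}$ between the two induced morphisms $m(m\otimes1)\Rightarrow m(1\otimes m)$, that is, a smooth section of the bundle with fibre $Q_{(m(m(y_{34},y_{23}),y_{12}),\,m(y_{34},m(y_{23},y_{12})))}$, natural with respect to $Q$, satisfying the pentagon identity over $X^{[5]}$. A *bundle 2-gerbe connection* is a pair $(\nabla,f_1)$ of a bundle gerbe connection $\nabla$ on $(Q,Y,X^{[2]})$ and a curving $f_1$ for $\nabla$ whose 3-curvature $\omega\in\Omega^3(X^{[2]})$ satisfies $\delta(\omega)=0$ in $\Omega^3(X^{[3]})$. **Theorem.** Let $(Q,Y,X,M)$ be a bundle 2-gerbe such that $M$, $X^{[2]}$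 and $Y^{[2]}$ support smooth partitions of unity (which is automatic if $M,X,Y$ are finite-dimensional, Hausdorff and second countable). Then it admits a bundle 2-gerbe connection. Moreover, for every bundle gerbe connection $\nabla$ on $(Q,Y,X^{[2]})$ and every curving $f$ for $\nabla$ there is a two-form $\beta\in\Omega^2(X^{[2]})$ such that $(\nabla, f+\pi_Y^*\beta)$ is a bundle 2-gerbe connection. -/

import Mathlib

open Diffeology
open scoped Manifold ContDiff Topology

noncomputable section

/-- The Cartesian space `ℝⁿ`, the domain of the test maps ("plots") below. -/
abbrev Euc (n : ℕ) : Type := EuclideanSpace ℝ (Fin n)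

/-! ## Smooth structures

Smoothness on manifolds, on their fibre products and on principal bundles over them is expressed
through smooth maps from Cartesian spaces, with the help of Mathlib's `DiffeologicalSpace`. A map
between manifolds is smooth iff it is `DSmooth`, and a smooth map into a fibre product (a subspace
of a product) is a family of smooth maps into the factors with values in the fibre product. -/

/-- The diffeology of a smooth manifold: the plots are the smooth maps `ℝⁿ → M`. -/
@[reducible] def manifoldDiffeology {E H : Type*} [NormedAddCommGroup E] [NormedSpace ℝ E]
    [TopologicalSpace H] (I : ModelWithCorners ℝ E H) (M : Type*) [TopologicalSpace M]
    [ChartedSpace H M] : DiffeologicalSpace M :=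
  .ofCorePlotsOn {
    isPlotOn := fun {n u} _ p => ContMDiffOn 𝓘(ℝ, Euc n) I ∞ p u
    isPlotOn_congr := fun _ _ _ h => contMDiffOn_congr h
    isPlot := fun {n} p => ContMDiff 𝓘(ℝ, Euc n) I ∞ p
    isPlotOn_univ := contMDiffOn_univ
    isPlot_const := fun _ => contMDiff_const
    isPlotOn_reparam := fun _ _ _ h hp hf => hp.comp hf.contMDiffOn h
    locality := fun _ _ h => fun x hxu => by
      obtain ⟨v, hv, hxv, hv'⟩ := h x hxu
      exact ((hv' x hxv).contMDiffAt (hv.mem_nhds hxv)).contMDiffWithinAt }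

/-- Product diffeology on a power. -/
instance piDiffeology {ι X : Type*} [DiffeologicalSpace X] : DiffeologicalSpace (ι → X) where
  plots n := {p | ∀ i, IsPlot fun u : Euc n => p u i}
  constant_plots _ := fun _ => isPlot_const
  plot_reparam hp hf := fun i => isPlot_reparam (hp i) hf
  locality h := fun i => DiffeologicalSpace.locality fun x => by
    obtain ⟨u, hu, hx, h'⟩ := h x
    exact ⟨u, hu, hx, fun hfu hf => h' hfu hf i⟩

/-- Product diffeology on a binary product. -/
instance prodDiffeology {X Y : Type*} [DiffeologicalSpace X] [DiffeologicalSpace Y] :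
    DiffeologicalSpace (X × Y) where
  plots n := {p | IsPlot (fun u : Euc n => (p u).1) ∧ IsPlot fun u : Euc n => (p u).2}
  constant_plots _ := ⟨isPlot_const, isPlot_const⟩
  plot_reparam hp hf := ⟨isPlot_reparam hp.1 hf, isPlot_reparam hp.2 hf⟩
  locality h := ⟨DiffeologicalSpace.locality fun x => by
      obtain ⟨u, hu, hx, h'⟩ := h x
      exact ⟨u, hu, hx, fun hfu hf => (h' hfu hf).1⟩,
    DiffeologicalSpace.locality fun x => by
      obtain ⟨u, hu, hx, h'⟩ := h x
      exact ⟨u, hu, hx, fun hfu hf => (h' hfu hf).2⟩⟩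

/-- Subspace diffeology. -/
instance subtypeDiffeology {X : Type*} [DiffeologicalSpace X] (S : X → Prop) :
    DiffeologicalSpace {x // S x} where
  plots n := {p | IsPlot fun u : Euc n => (p u : X)}
  constant_plots _ := isPlot_const
  plot_reparam hp hf := isPlot_reparam hp hf
  locality h := DiffeologicalSpace.locality fun x => by
    obtain ⟨u, hu, hx, h'⟩ := h x
    exact ⟨u, hu, hx, fun hfu hf => h' hfu hf⟩

theorem dSmooth_fst {X Y : Type*} [DiffeologicalSpace X] [DiffeologicalSpace Y] :
    DSmooth (Prod.fst : X × Y → X) := fun _ _ hp => hp.1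

theorem dSmooth_snd {X Y : Type*} [DiffeologicalSpace X] [DiffeologicalSpace Y] :
    DSmooth (Prod.snd : X × Y → Y) := fun _ _ hp => hp.2

theorem dSmooth_val {X : Type*} [DiffeologicalSpace X] (S : X → Prop) :
    DSmooth (Subtype.val : {x // S x} → X) := fun _ _ hp => hp

/-- The Lie group `ℂˣ` as an (open) subspace of `ℂ`. -/
instance unitsDiffeology : DiffeologicalSpace ℂˣ where
  plots n := {p | ContDiff ℝ ∞ fun u : Euc n => (p u : ℂ)}
  constant_plots {n} x := contDiff_const (𝕜 := ℝ) (n := ∞) (E := Euc n) (c := (x : ℂ))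
  plot_reparam {n m p f} hp hf :=
    have hp' : ContDiff ℝ ∞ fun u : Euc m => (p u : ℂ) := hp
    hp'.comp hf
  locality {n p} h := by
    let _ : DiffeologicalSpace ℂ := NormedSpace.toDiffeology ℂ
    exact DiffeologicalSpace.locality (X := ℂ) (p := fun u : Euc n => (p u : ℂ)) fun x => by
      obtain ⟨u, hu, hx, h'⟩ := h x
      exact ⟨u, hu, hx, fun hfu hf => h' hfu hf⟩

/-! ## Complex-valued differential forms -/

/-- A smooth complex-valued differential `k`-form on `X`: a smooth `k`-form `ω_p` on `ℝⁿ` for every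
smooth map `p : ℝⁿ → X` (to be thought of as `p^* ω`), such that `ω_{p ∘ h} = h^* ω_p` for every
smooth `h : ℝᵐ → ℝⁿ`. On a manifold these are the usual differential forms. -/
@[ext] structure DForm (X : Type*) [DiffeologicalSpace X] (k : ℕ) where
  toFun : ∀ (n : ℕ) (p : Euc n → X), IsPlot p → Euc n → Euc n [⋀^Fin k]→L[ℝ] ℂ
  smooth : ∀ (n : ℕ) (p : Euc n → X) (hp : IsPlot p), ContDiff ℝ ∞ (toFun n p hp)
  natural : ∀ (n m : ℕ) (p : Euc n → X) (hp : IsPlot p) (h : Euc m → Euc n)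
    (hh : ContDiff ℝ ∞ h) (u : Euc m),
    toFun m (p ∘ h) (isPlot_reparam hp hh) u =
      (toFun n p hp (h u)).compContinuousLinearMap (fderiv ℝ h u)

namespace DForm

variable {X Y : Type*} [DiffeologicalSpace X] [DiffeologicalSpace Y] {k : ℕ}

instance : Zero (DForm X k) :=
  ⟨⟨fun _ _ _ _ => 0, fun _ _ _ => contDiff_const, fun _ _ _ _ _ _ _ => by ext; simp⟩⟩

instance : Add (DForm X k) :=
  ⟨fun a b => ⟨fun n p hp u => a.toFun n p hp u + b.toFun n p hp u,
    fun n p hp => (a.smooth n p hp).add (b.smooth n p hp),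
    fun n m p hp h hh u => by ext; simp [a.natural n m p hp h hh, b.natural n m p hp h hh]⟩⟩

instance : Neg (DForm X k) :=
  ⟨fun a => ⟨fun n p hp u => -a.toFun n p hp u, fun n p hp => (a.smooth n p hp).neg,
    fun n m p hp h hh u => by ext; simp [a.natural n m p hp h hh]⟩⟩

instance : AddCommGroup (DForm X k) where
  add_assoc a b c := by ext : 5; exact add_assoc _ _ _
  zero_add a := by ext : 5; exact zero_add _
  add_zero a := by ext : 5; exact add_zero _
  add_comm a b := by ext : 5; exact add_comm _ _
  neg_add_cancel a := by ext : 5; exact neg_add_cancel _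
  nsmul := nsmulRec
  zsmul := zsmulRec

/-- Pullback `f^* η` of a form along a smooth map. -/
def pullback (f : X → Y) (hf : DSmooth f) (η : DForm Y k) : DForm X k where
  toFun n p hp := η.toFun n (f ∘ p) (hf n p hp)
  smooth n p hp := η.smooth n (f ∘ p) (hf n p hp)
  natural n m p hp h hh u := η.natural n m (f ∘ p) (hf n p hp) h hh u

/-- The exterior derivative `d`. -/
def d (η : DForm X k) : DForm X (k + 1) where
  toFun n p hp := extDeriv (η.toFun n p hp)
  smooth n p hp := by
    have h := (η.smooth n p hp).fderiv_right (m := ∞) (by simp)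
    exact (ContinuousAlternatingMap.alternatizeUncurryFinCLM ℝ (Euc n) ℂ).contDiff.comp h
  natural n m p hp h hh u := by
    rw [← extDeriv_pullback (r := ∞)
      ((η.smooth n p hp).contDiffAt.differentiableAt (by simp)) hh.contDiffAt
      (by rw [minSmoothness_of_isRCLikeNormedField]; exact ENat.LEInfty.out)]
    congr 1
    funext v
    exact η.natural n m p hp h hh v

/-- The invariant form `z⁻¹ dz` on `ℂˣ`. -/
def maurerCartan : DForm ℂˣ 1 where
  toFun n g _ u := ContinuousAlternatingMap.ofSubsingleton ℝ (Euc n) ℂ (0 : Fin 1)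
    (((g u : ℂ)⁻¹) • fderiv ℝ (fun v => (g v : ℂ)) u)
  smooth n g hg := by
    have hg' : ContDiff ℝ ∞ fun v => (g v : ℂ) := hg
    have h : ContDiff ℝ ∞ fun u => ((g u : ℂ)⁻¹) • fderiv ℝ (fun v => (g v : ℂ)) u :=
      (hg'.inv fun v => (g v).ne_zero).smul (hg'.fderiv_right (m := ∞) (by simp))
    exact (ContinuousAlternatingMap.ofSubsingletonLIE (𝕜 := ℝ) (E := Euc n) (F := ℂ)
      (0 : Fin 1)).contDiff.comp h
  natural n m g hg h hh u := by
    have hg' : ContDiff ℝ ∞ fun v => (g v : ℂ) := hg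
    have h1 : fderiv ℝ (fun v => (g (h v) : ℂ)) u =
        (fderiv ℝ (fun v => (g v : ℂ)) (h u)).comp (fderiv ℝ h u) :=
      fderiv_comp (g := fun v => (g v : ℂ)) u
        (hg'.contDiffAt.differentiableAt (by simp)) (hh.contDiffAt.differentiableAt (by simp))
    ext v
    simp [h1]

end DForm

/-! ## Fibre products and the complex of forms -/

/-- The `q`-fold fibre product `X^[q]` of `X` with itself over `M`, as a subspace of `X^q`. -/
abbrev FiberPower {X M : Type*} (π : X → M) (q : ℕ) : Type _ :=
  {x : Fin q → X // ∀ i j, π (x i) = π (x j)}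

namespace FiberPower

variable {X M : Type*} (π : X → M)

/-- The face map `X^[q+1] → X^[q]` omitting one factor. -/
def face (q : ℕ) (i : Fin (q + 1)) (x : FiberPower π (q + 1)) : FiberPower π q :=
  ⟨fun j => x.1 (i.succAbove j), fun j l => x.2 (i.succAbove j) (i.succAbove l)⟩

/-- The identification `X^[1] = X`. -/
def ofOne (x : FiberPower π 1) : X := x.1 0

theorem face_smooth [DiffeologicalSpace X] (q : ℕ) (i : Fin (q + 1)) : DSmooth (face π q i) :=
  fun _ _ hp j => hp (i.succAbove j)

theorem ofOne_smooth [DiffeologicalSpace X] : DSmooth (ofOne π) :=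
  fun _ _ hp => hp 0

/-- The map `δ = ∑ᵢ (-1)ⁱ πᵢ^* : Ωᵏ(X^[q]) → Ωᵏ(X^[q+1])`, where `πᵢ`, `1 ≤ i ≤ q + 1`, omits the
`i`-th factor. -/
def delta [DiffeologicalSpace X] {q k : ℕ} (η : DForm (FiberPower π q) k) :
    DForm (FiberPower π (q + 1)) k :=
  ∑ i : Fin (q + 1), ((-1 : ℤ) ^ ((i : ℕ) + 1)) • η.pullback (face π q i) (face_smooth π q i)

/-- The map `δ : Ωᵏ(X) → Ωᵏ(X^[2])`, using `X = X^[1]`. -/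
def deltaOne [DiffeologicalSpace X] {k : ℕ} (η : DForm X k) : DForm (FiberPower π 2) k :=
  delta π (η.pullback (ofOne π) (ofOne_smooth π))

end FiberPower

/-- A smooth surjection `X → M` admitting local sections. -/
structure LocallySplit (X M : Type*) [TopologicalSpace X] [DiffeologicalSpace X]
    [TopologicalSpace M] [DiffeologicalSpace M] where
  toFun : X → M
  continuous : Continuous toFun
  smooth : DSmooth toFun
  surjective : Function.Surjective toFun
  exists_section : ∀ b : M, ∃ U : Set M, IsOpen U ∧ b ∈ U ∧
    ∃ s : {c // c ∈ U} → X, DSmooth s ∧ ∀ c, toFun (s c) = c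

/-! ## Principal `ℂˣ`-bundles and bundle gerbes -/

/-- A smooth principal `ℂˣ`-bundle `P → B`: locally on `B` there are a section `s` and a map `t`
such that `(b, z) ↦ z • s b` and `u ↦ (proj u, t u)` are mutually inverse smooth maps
between `U × ℂˣ` and `proj ⁻¹ U`. -/
structure PrincipalBundle (B P : Type*) [TopologicalSpace B] [DiffeologicalSpace B]
    [DiffeologicalSpace P] [MulAction ℂˣ P] where
  proj : P → B
  proj_smooth : DSmooth proj
  smul_smooth : DSmooth fun w : ℂˣ × P => w.1 • w.2
  proj_smul : ∀ (z : ℂˣ) (u : P), proj (z • u) = proj u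
  locally_trivial : ∀ b : B, ∃ U : Set B, IsOpen U ∧ b ∈ U ∧
    ∃ (s : {c // c ∈ U} → P) (t : {u : P // proj u ∈ U} → ℂˣ), DSmooth s ∧ DSmooth t ∧
      (∀ c, proj (s c) = c) ∧ (∀ u, t u • s ⟨proj u.1, u.2⟩ = u.1) ∧
      ∀ (c : {c // c ∈ U}) (z : ℂˣ) (h : proj (z • s c) ∈ U), t ⟨z • s c, h⟩ = z

/-- A surjection `Y → B` admitting local sections with a principal `ℂˣ`-bundle on `Y^[2]`. -/
structure PreBundleGerbe (B Y Q : Type*) [TopologicalSpace B] [DiffeologicalSpace B]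
    [TopologicalSpace Y] [DiffeologicalSpace Y] [DiffeologicalSpace Q] [MulAction ℂˣ Q] where
  base : LocallySplit Y B
  bundle : PrincipalBundle (FiberPower base.toFun 2) Q

namespace PreBundleGerbe

variable {B Y Q : Type*} [TopologicalSpace B] [DiffeologicalSpace B]
  [TopologicalSpace Y] [DiffeologicalSpace Y] [DiffeologicalSpace Q] [MulAction ℂˣ Q]
  (G : PreBundleGerbe B Y Q)

/-- `src u = y₁` for `u` in the fibre `Q_(y₁, y₂)`. -/
def src (u : Q) : Y := (G.bundle.proj u).1 0

/-- `tgt u = y₂` for `u` in the fibre `Q_(y₁, y₂)`. -/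
def tgt (u : Q) : Y := (G.bundle.proj u).1 1

end PreBundleGerbe

/-- A bundle gerbe `(Q, Y, B)`. The product of `u ∈ Q_(y₂, y₃)` and `v ∈ Q_(y₁, y₂)` is
`mul u v ∈ Q_(y₁, y₃)`; the values of `mul` on other pairs are irrelevant. That `mul` is a map of
`ℂˣ`-bundles from the contracted product is its equivariance in each variable. -/
structure BundleGerbe (B Y Q : Type*) [TopologicalSpace B] [DiffeologicalSpace B]
    [TopologicalSpace Y] [DiffeologicalSpace Y] [DiffeologicalSpace Q] [MulAction ℂˣ Q]
    extends PreBundleGerbe B Y Q where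
  mul : Q → Q → Q
  mul_smooth : DSmooth fun w : {w : Q × Q //
    toPreBundleGerbe.src w.1 = toPreBundleGerbe.tgt w.2} => mul w.1.1 w.1.2
  src_mul : ∀ u v, toPreBundleGerbe.src u = toPreBundleGerbe.tgt v →
    toPreBundleGerbe.src (mul u v) = toPreBundleGerbe.src v
  tgt_mul : ∀ u v, toPreBundleGerbe.src u = toPreBundleGerbe.tgt v →
    toPreBundleGerbe.tgt (mul u v) = toPreBundleGerbe.tgt u
  smul_mul : ∀ (z : ℂˣ) (u v : Q), toPreBundleGerbe.src u = toPreBundleGerbe.tgt v →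
    mul (z • u) v = z • mul u v
  mul_smul : ∀ (z : ℂˣ) (u v : Q), toPreBundleGerbe.src u = toPreBundleGerbe.tgt v →
    mul u (z • v) = z • mul u v
  mul_assoc : ∀ u v w, toPreBundleGerbe.src u = toPreBundleGerbe.tgt v →
    toPreBundleGerbe.src v = toPreBundleGerbe.tgt w → mul (mul u v) w = mul u (mul v w)

namespace BundleGerbe

variable {B Y Q : Type*} [TopologicalSpace B] [DiffeologicalSpace B]
  [TopologicalSpace Y] [DiffeologicalSpace Y] [DiffeologicalSpace Q] [MulAction ℂˣ Q]
  (G : BundleGerbe B Y Q)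

/-- `e = e(y)`, the value at `y` of the identity section: the unit of the group `Q_(y, y)`. -/
def IsIdentity (e : Q) (y : Y) : Prop := G.src e = y ∧ G.tgt e = y ∧ G.mul e e = e

/-- A connection on the principal bundle `Q → Y^[2]`, given by its connection form
`A ∈ Ω¹(Q; ℂ)`: the pullback of `A` along the action `ℂˣ × Q → Q` is `z⁻¹ dz + A`, i.e. `A` is
invariant and restricts to `z⁻¹ dz` on the fibres. -/
def IsConnection (A : DForm Q 1) : Prop :=
  A.pullback (fun w : ℂˣ × Q => w.1 • w.2) G.bundle.smul_smooth =
    DForm.maurerCartan.pullback Prod.fst dSmooth_fst +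
      A.pullback Prod.snd dSmooth_snd

/-- A bundle gerbe connection: a connection compatible with the bundle gerbe product. -/
def IsGerbeConnection (A : DForm Q 1) : Prop :=
  G.IsConnection A ∧
    A.pullback (fun w : {w : Q × Q // G.src w.1 = G.tgt w.2} => G.mul w.1.1 w.1.2) G.mul_smooth =
      A.pullback (fun w : {w : Q × Q // G.src w.1 = G.tgt w.2} => w.1.1) 
        (dSmooth_fst.comp (dSmooth_val _)) +
      A.pullback (fun w : {w : Q × Q // G.src w.1 = G.tgt w.2} => w.1.2) 
        (dSmooth_snd.comp (dSmooth_val _))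

/-- `F ∈ Ω²(Y^[2])` is the curvature of the connection `A`. -/
def IsCurvature (A : DForm Q 1) (F : DForm (FiberPower G.base.toFun 2) 2) : Prop :=
  F.pullback G.bundle.proj G.bundle.proj_smooth = A.d

/-- A curving `f ∈ Ω²(Y)` for `A`: the curvature of `A` is `δ f`. -/
def IsCurving (A : DForm Q 1) (f : DForm Y 2) : Prop :=
  G.IsCurvature A (FiberPower.deltaOne G.base.toFun f)

/-- `w ∈ Ω³(B)` is the 3-curvature of a connection with curving `f`: its pullback to `Y` is
`d f`. -/
def IsThreeCurvature (f : DForm Y 2) (w : DForm B 3) : Prop :=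
  w.pullback G.base.toFun G.base.smooth = f.d

end BundleGerbe

/-! ## Bundle 2-gerbes -/

/-- A surjection `X → M` admitting local sections and a bundle gerbe `(Q, Y, X^[2])`. -/
structure PreBundleTwoGerbe (M X Y Q : Type*) [TopologicalSpace M] [DiffeologicalSpace M]
    [TopologicalSpace X] [DiffeologicalSpace X] [TopologicalSpace Y] [DiffeologicalSpace Y]
    [DiffeologicalSpace Q] [MulAction ℂˣ Q] where
  base : LocallySplit X M
  gerbe : BundleGerbe (FiberPower base.toFun 2) Y Q

namespace PreBundleTwoGerbe

variable {M X Y Q : Type*} [TopologicalSpace M] [DiffeologicalSpace M]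
  [TopologicalSpace X] [DiffeologicalSpace X] [TopologicalSpace Y] [DiffeologicalSpace Y]
  [DiffeologicalSpace Q] [MulAction ℂˣ Q] (G : PreBundleTwoGerbe M X Y Q)

/-- `left y = x₁` for `y ∈ Y_(x₁, x₂)`. -/
def left (y : Y) : X := (G.gerbe.base.toFun y).1 0

/-- `right y = x₂` for `y ∈ Y_(x₁, x₂)`. -/
def right (y : Y) : X := (G.gerbe.base.toFun y).1 1

/-- `(y, y') ∈ Y ∘ Y`, i.e. `y ∈ Y_(x₂, x₃)` and `y' ∈ Y_(x₁, x₂)` for some `x₁, x₂, x₃`. -/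
def Comp (y y' : Y) : Prop := G.left y = G.right y'

/-- `(u, v) ∈ Q ∘ Q`, i.e. `u ∈ Q_(y₂₃, y₂₃')` and `v ∈ Q_(y₁₂, y₁₂')` with
`(y₂₃, y₁₂), (y₂₃', y₁₂') ∈ Y ∘ Y` over the same point of `X^[3]`. -/
def HComp (u v : Q) : Prop := G.Comp (G.gerbe.src u) (G.gerbe.src v)

end PreBundleTwoGerbe

/-- A surjection `X → M` admitting local sections, a bundle gerbe `(Q, Y, X^[2])` and a bundle gerbe
morphism `π₁⁻¹ Q ⊗ π₃⁻¹ Q → π₂⁻¹ Q` over `X^[3]`, given by maps `m : Y ∘ Y → Y` and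
`hm : Q ∘ Q → Q` (whose values elsewhere are irrelevant). -/
structure MultBundleGerbe (M X Y Q : Type*) [TopologicalSpace M] [DiffeologicalSpace M]
    [TopologicalSpace X] [DiffeologicalSpace X] [TopologicalSpace Y] [DiffeologicalSpace Y]
    [DiffeologicalSpace Q] [MulAction ℂˣ Q] extends PreBundleTwoGerbe M X Y Q where
  m : Y → Y → Y
  m_smooth : DSmooth fun w : {w : Y × Y // toPreBundleTwoGerbe.Comp w.1 w.2} => m w.1.1 w.1.2
  left_m : ∀ y y', toPreBundleTwoGerbe.Comp y y' →
    toPreBundleTwoGerbe.left (m y y') = toPreBundleTwoGerbe.left y'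
  right_m : ∀ y y', toPreBundleTwoGerbe.Comp y y' →
    toPreBundleTwoGerbe.right (m y y') = toPreBundleTwoGerbe.right y
  hm : Q → Q → Q
  hm_smooth : DSmooth fun w : {w : Q × Q // toPreBundleTwoGerbe.HComp w.1 w.2} => hm w.1.1 w.1.2
  src_hm : ∀ u v, toPreBundleTwoGerbe.HComp u v →
    gerbe.src (hm u v) = m (gerbe.src u) (gerbe.src v)
  tgt_hm : ∀ u v, toPreBundleTwoGerbe.HComp u v →
    gerbe.tgt (hm u v) = m (gerbe.tgt u) (gerbe.tgt v)
  smul_hm : ∀ (z : ℂˣ) (u v : Q), toPreBundleTwoGerbe.HComp u v → hm (z • u) v = z • hm u v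
  hm_smul : ∀ (z : ℂˣ) (u v : Q), toPreBundleTwoGerbe.HComp u v → hm u (z • v) = z • hm u v
  hm_mul : ∀ u' u v' v, gerbe.src u' = gerbe.tgt u → gerbe.src v' = gerbe.tgt v →
    toPreBundleTwoGerbe.HComp u v →
    hm (gerbe.mul u' u) (gerbe.mul v' v) = gerbe.mul (hm u' v') (hm u v)

/-- A bundle 2-gerbe `(Q, Y, X, M)`. The associator, a transformation between the two induced bundle
gerbe morphisms `Q ∘ Q ∘ Q → Q` over `X^[4]`, is given by its lift to `Y ∘ Y ∘ Y`: a section `a` of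
the bundle with fibres `Q_((y₃₄ y₂₃) y₁₂, y₃₄ (y₂₃ y₁₂))` that descends to `X^[4]`, which is the
condition `a_natural`. The coherency condition over `X^[5]` is the pentagon identity between the
five induced morphisms `Q ∘ Q ∘ Q ∘ Q → Q`. -/
structure BundleTwoGerbe (M X Y Q : Type*) [TopologicalSpace M] [DiffeologicalSpace M]
    [TopologicalSpace X] [DiffeologicalSpace X] [TopologicalSpace Y] [DiffeologicalSpace Y]
    [DiffeologicalSpace Q] [MulAction ℂˣ Q] extends MultBundleGerbe M X Y Q where
  a : Y → Y → Y → Q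
  a_smooth : DSmooth fun w : {w : Y × Y × Y // toPreBundleTwoGerbe.Comp w.1 w.2.1 ∧
    toPreBundleTwoGerbe.Comp w.2.1 w.2.2} => a w.1.1 w.1.2.1 w.1.2.2
  src_a : ∀ y₃₄ y₂₃ y₁₂, toPreBundleTwoGerbe.Comp y₃₄ y₂₃ → toPreBundleTwoGerbe.Comp y₂₃ y₁₂ →
    gerbe.src (a y₃₄ y₂₃ y₁₂) = m (m y₃₄ y₂₃) y₁₂
  tgt_a : ∀ y₃₄ y₂₃ y₁₂, toPreBundleTwoGerbe.Comp y₃₄ y₂₃ → toPreBundleTwoGerbe.Comp y₂₃ y₁₂ →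
    gerbe.tgt (a y₃₄ y₂₃ y₁₂) = m y₃₄ (m y₂₃ y₁₂)
  a_natural : ∀ u₃₄ u₂₃ u₁₂, toPreBundleTwoGerbe.HComp u₃₄ u₂₃ →
    toPreBundleTwoGerbe.HComp u₂₃ u₁₂ →
    gerbe.mul (hm u₃₄ (hm u₂₃ u₁₂)) (a (gerbe.src u₃₄) (gerbe.src u₂₃) (gerbe.src u₁₂)) =
      gerbe.mul (a (gerbe.tgt u₃₄) (gerbe.tgt u₂₃) (gerbe.tgt u₁₂)) (hm (hm u₃₄ u₂₃) u₁₂)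
  pentagon : ∀ y₄₅ y₃₄ y₂₃ y₁₂ e₄₅ e₁₂, toPreBundleTwoGerbe.Comp y₄₅ y₃₄ →
    toPreBundleTwoGerbe.Comp y₃₄ y₂₃ → toPreBundleTwoGerbe.Comp y₂₃ y₁₂ →
    gerbe.IsIdentity e₄₅ y₄₅ → gerbe.IsIdentity e₁₂ y₁₂ →
    gerbe.mul (hm e₄₅ (a y₃₄ y₂₃ y₁₂))
        (gerbe.mul (a y₄₅ (m y₃₄ y₂₃) y₁₂) (hm (a y₄₅ y₃₄ y₂₃) e₁₂)) =
      gerbe.mul (a y₄₅ y₃₄ (m y₂₃ y₁₂)) (a (m y₄₅ y₃₄) y₂₃ y₁₂)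

/-- The pair `(A, f)` is a bundle 2-gerbe connection: `A` is a bundle gerbe connection on
`(Q, Y, X^[2])` and `f` a curving for `A` such that the 3-curvature `w ∈ Ω³(X^[2])` satisfies
`δ w = 0`. -/
def BundleTwoGerbe.IsTwoGerbeConnection {M X Y Q : Type*} [TopologicalSpace M]
    [DiffeologicalSpace M] [TopologicalSpace X] [DiffeologicalSpace X] [TopologicalSpace Y]
    [DiffeologicalSpace Y] [DiffeologicalSpace Q] [MulAction ℂˣ Q] (G : BundleTwoGerbe M X Y Q)
    (A : DForm Q 1) (f : DForm Y 2) : Prop :=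
  G.gerbe.IsGerbeConnection A ∧ G.gerbe.IsCurving A f ∧
    ∃ w : DForm (FiberPower G.base.toFun 2) 3, G.gerbe.IsThreeCurvature f w ∧
      FiberPower.delta G.base.toFun w = 0

/-! ## Partitions of unity -/

/-- Every open cover of `B` has a subordinate smooth partition of unity. -/
def SupportsPartitionsOfUnity (B : Type*) [TopologicalSpace B] [DiffeologicalSpace B] : Prop :=
  ∀ U : B → Set B, (∀ b, IsOpen (U b)) → (∀ b, b ∈ U b) →
    ∃ ρ : B → B → ℝ, (∀ b, DSmooth (ρ b)) ∧ (∀ b c, 0 ≤ ρ b c) ∧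
      LocallyFinite (fun b => Function.support (ρ b)) ∧ (∀ b, tsupport (ρ b) ⊆ U b) ∧
      ∀ c, ∑ᶠ b, ρ b c = 1

/-- Finite-dimensional, Hausdorff, σ-compact manifolds support partitions of unity. -/
theorem supportsPartitionsOfUnity_manifold {E H M : Type*} [NormedAddCommGroup E]
    [NormedSpace ℝ E] [FiniteDimensional ℝ E] [TopologicalSpace H] (I : ModelWithCorners ℝ E H)
    [TopologicalSpace M] [ChartedSpace H M] [IsManifold I ∞ M] [T2Space M] [SigmaCompactSpace M] :
    letI := manifoldDiffeology I M
    SupportsPartitionsOfUnity M := by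
  intro U hU hmem
  obtain ⟨f, hf⟩ := SmoothPartitionOfUnity.exists_isSubordinate I isClosed_univ U hU
    (fun b _ => Set.mem_iUnion.2 ⟨b, hmem b⟩)
  refine ⟨fun b c => f b c, fun b n p hp => ?_, fun b c => f.nonneg b c, f.locallyFinite, hf,
    fun c => f.sum_eq_one (Set.mem_univ c)⟩
  have hp' : ContMDiff 𝓘(ℝ, Euc n) I ∞ p := hp
  exact contMDiff_iff_contDiff.1 ((f b).contMDiff.comp hp')

/-- For a continuous map from a finite-dimensional, Hausdorff, σ-compact manifold to a Hausdorff
space, the fibre product `X^[2]` supports partitions of unity. -/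
theorem supportsPartitionsOfUnity_fiberPower {E H X B : Type*} [NormedAddCommGroup E]
    [NormedSpace ℝ E] [FiniteDimensional ℝ E] [TopologicalSpace H] (I : ModelWithCorners ℝ E H)
    [TopologicalSpace X] [ChartedSpace H X] [IsManifold I ∞ X] [T2Space X] [SigmaCompactSpace X]
    [TopologicalSpace B] [T2Space B] (π : X → B) (hπ : Continuous π) :
    letI := manifoldDiffeology I X
    SupportsPartitionsOfUnity (FiberPower π 2) := by
  intro U hU hmem
  have hcont : Continuous fun c : FiberPower π 2 => (c.1 0, c.1 1) :=
    ((continuous_apply 0).comp continuous_subtype_val).prodMk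
      ((continuous_apply 1).comp continuous_subtype_val)
  let S : Set (X × X) := {q | π q.1 = π q.2}
  have hS : IsClosed S := isClosed_eq (hπ.comp continuous_fst) (hπ.comp continuous_snd)
  let toS : S → FiberPower π 2 := fun q => ⟨![q.1.1, q.1.2], by
    have h : π q.1.1 = π q.1.2 := q.2
    intro i j
    fin_cases i <;> fin_cases j <;> simp [h]⟩
  have htoS : Continuous toS := by
    refine Continuous.subtype_mk (continuous_pi fun i => ?_) _
    fin_cases i
    · exact continuous_fst.comp continuous_subtype_val
    · exact continuous_snd.comp continuous_subtype_val
  have hinv : ∀ c : FiberPower π 2, toS ⟨(c.1 0, c.1 1), c.2 0 1⟩ = c := by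
    intro c
    apply Subtype.ext
    funext i
    fin_cases i <;> rfl
  choose V hVo hV using fun b => isOpen_induced_iff.1 ((hU b).preimage htoS)
  have hVU : ∀ b (c : FiberPower π 2), (c.1 0, c.1 1) ∈ V b → c ∈ U b := by
    intro b c hc
    have h : (⟨(c.1 0, c.1 1), c.2 0 1⟩ : S) ∈ Subtype.val ⁻¹' V b := hc
    rw [hV b] at h
    have h' : toS ⟨(c.1 0, c.1 1), c.2 0 1⟩ ∈ U b := h
    rwa [hinv] at h'
  have hcov : S ⊆ ⋃ b, V b := by
    intro q hq
    refine Set.mem_iUnion.2 ⟨toS ⟨q, hq⟩, ?_⟩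
    have h : (⟨q, hq⟩ : S) ∈ toS ⁻¹' U (toS ⟨q, hq⟩) := hmem _
    rw [← hV] at h
    exact h
  obtain ⟨f, hf⟩ := SmoothPartitionOfUnity.exists_isSubordinate (I.prod I) hS V hVo hcov
  refine ⟨fun b c => f b (c.1 0, c.1 1), fun b n p hp => ?_, fun b c => f.nonneg b _,
    f.locallyFinite.preimage_continuous hcont, fun b c hc => ?_,
    fun c => f.sum_eq_one (c.2 0 1)⟩
  · have h0 : ContMDiff 𝓘(ℝ, Euc n) I ∞ fun u => (p u).1 0 := hp 0
    have h1 : ContMDiff 𝓘(ℝ, Euc n) I ∞ fun u => (p u).1 1 := hp 1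
    exact contMDiff_iff_contDiff.1 ((f b).contMDiff.comp (h0.prodMk h1))
  · exact hVU b c (hf b (tsupport_comp_subset_preimage (f b) hcont hc))

/-- For a bundle 2-gerbe of finite-dimensional, Hausdorff, σ-compact manifolds, the spaces `M`,
`X^[2]` and `Y^[2]` support partitions of unity. -/
theorem supportsPartitionsOfUnity_of_finiteDimensional
    {EM HM M EX HX X EY HY Y Q : Type*}
    [NormedAddCommGroup EM] [NormedSpace ℝ EM] [FiniteDimensional ℝ EM] [TopologicalSpace HM]
    (IM : ModelWithCorners ℝ EM HM) [TopologicalSpace M] [ChartedSpace HM M]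
    [IsManifold IM ∞ M] [T2Space M] [SigmaCompactSpace M]
    [NormedAddCommGroup EX] [NormedSpace ℝ EX] [FiniteDimensional ℝ EX] [TopologicalSpace HX]
    (IX : ModelWithCorners ℝ EX HX) [TopologicalSpace X] [ChartedSpace HX X]
    [IsManifold IX ∞ X] [T2Space X] [SigmaCompactSpace X]
    [NormedAddCommGroup EY] [NormedSpace ℝ EY] [FiniteDimensional ℝ EY] [TopologicalSpace HY]
    (IY : ModelWithCorners ℝ EY HY) [TopologicalSpace Y] [ChartedSpace HY Y]
    [IsManifold IY ∞ Y] [T2Space Y] [SigmaCompactSpace Y]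
    [DiffeologicalSpace Q] [MulAction ℂˣ Q] :
    letI := manifoldDiffeology IM M
    letI := manifoldDiffeology IX X
    letI := manifoldDiffeology IY Y
    ∀ G : BundleTwoGerbe M X Y Q,
      SupportsPartitionsOfUnity M ∧
      SupportsPartitionsOfUnity (FiberPower G.base.toFun 2) ∧
      SupportsPartitionsOfUnity (FiberPower G.gerbe.base.toFun 2) := by
  let _ := manifoldDiffeology IM M
  let _ := manifoldDiffeology IX X
  let _ := manifoldDiffeology IY Y
  intro G
  exact ⟨supportsPartitionsOfUnity_manifold IM,
    supportsPartitionsOfUnity_fiberPower IX _ G.base.continuous,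
    supportsPartitionsOfUnity_fiberPower IY _ G.gerbe.base.continuous⟩

end

/-! Every construction obeys two principles. Descent: along a subduction, a form that takes the same
values on any two lifts of a plot comes from the base (`IsSubduction.exists_pullback_eq`).
Exactness: if `X → M` has local sections and `M` has partitions of unity, a `δ`-closed form on
`X^[q]`, `q ≥ 2`, is `δ` of a form on `X^[q-1]` (`FiberPower.exists_delta_eq`); the contracting
homotopy inserts a local section as an extra factor and averages. Each structure map of the 2-gerbe
fails to preserve the chosen data by some form. That form descends, the next coherence law makes it
closed, and exactness lets it be absorbed.

For a bundle gerbe, any connection on `Q` fails to respect the product by a one-form on `Y^[3]`.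
Associativity makes this form closed, so the connection can be corrected. The curvature is then
closed as well, and a curving exists.

Now fix a gerbe connection `A` with curving `f` and 3-curvature `ω`. The horizontal product
preserves `A` up to `δα`, with `α` a one-form on `Y ∘ Y` (`exists_isMultiplicative`). The form `m^*f
- f - f - dα` descends to a two-form `φ` on `X^[3]` with `δω = dφ` (`exists_pullback_toThree`,
`delta_threeCurvature`). The connection evaluated on the associator, corrected by `α`, descends to a
one-form `l` on `X^[4]` by naturality (`exists_pullback_toFour`). Moreover `δφ = dl` (`delta_eq_d`),
and the pentagon identity says `δl = 0` (`delta_eq_zero`).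

This is a zigzag in the double complex `Ω^k(X^[q])`. Solve `l = δμ`; then `φ - dμ` is closed, hence
equal to `δb`. Replacing `f` by `f - π_Y^*b` changes `ω` to `ω - db`, and `δ(ω - db) = dφ - d(φ -
dμ) = 0`.

Partitions of unity on `Y^[2]` give the initial connection on `Q`. Those on `X^[2]` give the gerbe
connection, the curving and `α`. Those on `M` give `μ` and `b`. -/

noncomputable section

/-! ## Localization of plots -/

/-- A smooth map `h` which is the identity near `u`, used to shrink the domain of a plot to a
neighbourhood of `u`. -/
structure IsLocalizer {n : ℕ} (h : Euc n → Euc n) (u : Euc n) : Prop where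
  contDiff : ContDiff ℝ ∞ h
  eventuallyEq : h =ᶠ[𝓝 u] id

namespace IsLocalizer

variable {n : ℕ} {h h' : Euc n → Euc n} {u : Euc n}

theorem apply_self (hh : IsLocalizer h u) : h u = u := hh.eventuallyEq.eq_of_nhds

theorem id (u : Euc n) : IsLocalizer (id : Euc n → Euc n) u := ⟨contDiff_id, .rfl⟩

theorem comp (hh : IsLocalizer h u) (hh' : IsLocalizer h' u) : IsLocalizer (h ∘ h') u :=
  ⟨hh.contDiff.comp hh'.contDiff, by
    filter_upwards [hh.eventuallyEq, hh'.eventuallyEq] with v hv hv'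
    simp [hv', hv]⟩

theorem comp_eventuallyEq {α : Type*} (hh : IsLocalizer h u) (p : Euc n → α) :
    p ∘ h =ᶠ[𝓝 u] p := hh.eventuallyEq.fun_comp p

theorem fderiv_eq (hh : IsLocalizer h u) : fderiv ℝ h u = ContinuousLinearMap.id ℝ (Euc n) := by
  rw [hh.eventuallyEq.fderiv_eq, fderiv_id]

theorem eventually (hh : IsLocalizer h u) : ∀ᶠ v in 𝓝 u, IsLocalizer h v :=
  hh.eventuallyEq.eventually_nhds.mono fun _ hv => ⟨hh.contDiff, hv⟩

end IsLocalizer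

/-- Plots here are defined on all of `ℝⁿ`, so a plot cannot simply be restricted to a neighbourhood.
Precomposing with such an `h` takes the place of restriction: it keeps the germ at `u` and moves
every point into the region where `P` holds. -/
theorem exists_isLocalizer {n : ℕ} {u : Euc n} {P : Euc n → Prop} (hP : ∀ᶠ v in 𝓝 u, P v) :
    ∃ h : Euc n → Euc n, IsLocalizer h u ∧ ∀ v, P (h v) := by
  obtain ⟨ε, hε, hball⟩ := Metric.eventually_nhds_iff.1 hP
  -- The map is `v ↦ u + χ(v - u)(v - u)`: it is the identity on the ball of radius `ε / 4`, and `χ`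
  -- vanishes off the ball of radius `ε / 2`, so the displacement from `u` always stays below `ε`.
  let χ : ContDiffBump (0 : Euc n) := ⟨ε / 4, ε / 2, by positivity, by linarith⟩
  refine ⟨fun v => u + χ (v - u) • (v - u), ⟨?_, ?_⟩, fun v => hball ?_⟩
  · have h1 : ContDiff ℝ ∞ fun v : Euc n => v - u := contDiff_id.sub contDiff_const
    exact contDiff_const.add ((χ.contDiff.comp h1).smul h1)
  · filter_upwards [Metric.ball_mem_nhds u (show 0 < ε / 4 by positivity)] with v hv
    have : χ (v - u) = 1 := χ.one_of_mem_closedBall (by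
      rw [mem_closedBall_zero_iff, ← dist_eq_norm]; exact (Metric.mem_ball.1 hv).le)
    simp [this]
  · rw [dist_eq_norm, add_sub_cancel_left, norm_smul, Real.norm_of_nonneg χ.nonneg]
    by_cases hv : v - u ∈ Metric.ball (0 : Euc n) (ε / 2)
    · have h1 := mem_ball_zero_iff.1 hv
      have h2 : χ (v - u) ≤ 1 := χ.le_one
      nlinarith [norm_nonneg (v - u)]
    · have : χ (v - u) = 0 := by
        by_contra hne
        have : v - u ∈ Function.support χ := hne
        rw [χ.support_eq] at this
        exact hv this
      simp [this, hε]

/-- `p` agrees near `u` with a plot. -/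
def IsPlotAt {X : Type*} [DiffeologicalSpace X] {n : ℕ} (p : Euc n → X) (u : Euc n) : Prop :=
  ∃ h, IsLocalizer h u ∧ IsPlot (p ∘ h)

section IsPlotAt

variable {X Y : Type*} [DiffeologicalSpace X] [DiffeologicalSpace Y] {n m : ℕ}
  {p q : Euc n → X} {u : Euc n}

theorem _root_.Diffeology.IsPlot.isPlotAt (hp : IsPlot p) (u : Euc n) : IsPlotAt p u :=
  ⟨id, .id u, hp⟩

namespace IsPlotAt

theorem congr (hp : IsPlotAt p u) (hpq : q =ᶠ[𝓝 u] p) : IsPlotAt q u := by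
  obtain ⟨h, hh, hph⟩ := hp
  obtain ⟨k, hk, hkv⟩ := exists_isLocalizer (hh.eventually.and hpq.eventually_nhds)
  refine ⟨k, hk, ?_⟩
  have : q ∘ k = (p ∘ h) ∘ k := funext fun v => by
    simp [(hkv v).1.apply_self, (hkv v).2.self_of_nhds]
  rw [this]
  exact isPlot_reparam hph hk.contDiff

/-- Allows localizers to be chosen one after the other: once one map has been shrunk by `h`, the
next is shrunk in the already shrunken domain, and a composite localizer serves both. -/
theorem localize (hp : IsPlotAt p u) {h : Euc n → Euc n} (hh : IsLocalizer h u) :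
    IsPlotAt (p ∘ h) u :=
  hp.congr (hh.comp_eventuallyEq p)

theorem prodMk {q : Euc n → Y} (hp : IsPlotAt p u) (hq : IsPlotAt q u) :
    IsPlotAt (fun v => (p v, q v)) u := by
  obtain ⟨h, hh, hph⟩ := hp
  obtain ⟨k, hk, hqk⟩ := hq.localize hh
  exact ⟨h ∘ k, hh.comp hk, isPlot_reparam (p := p ∘ h) hph hk.contDiff, hqk⟩

theorem subtype {S : X → Prop} {p : Euc n → {x // S x}}
    (hp : IsPlotAt (fun v => (p v : X)) u) : IsPlotAt p u := hp

theorem finCons {q : ℕ} {p : Euc n → X} {x : Euc n → Fin q → X} (hp : IsPlotAt p u)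
    (hx : IsPlotAt x u) : IsPlotAt (fun v => (Fin.cons (p v) (x v) : Fin (q + 1) → X)) u := by
  obtain ⟨h, hh, hph⟩ := hp
  obtain ⟨k, hk, hxk⟩ := hx.localize hh
  refine ⟨h ∘ k, hh.comp hk, fun i => ?_⟩
  induction i using Fin.cases with
  | zero => exact isPlot_reparam (p := p ∘ h) hph hk.contDiff
  | succ i => exact hxk i

end IsPlotAt

end IsPlotAt

/-! ### Evaluation of forms on maps that are plots only locally -/

namespace DForm

variable {X Y : Type*} [DiffeologicalSpace X] [DiffeologicalSpace Y] {k n m : ℕ}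

open Classical in
/-- The pullback `p^* η` along a map that is not required to be a plot, at those points near which
`p` agrees with a plot. -/
def ev (η : DForm X k) (p : Euc n → X) (u : Euc n) : Euc n [⋀^Fin k]→L[ℝ] ℂ :=
  if h : IsPlotAt p u then η.toFun n (p ∘ h.choose) h.choose_spec.2 u else 0

variable (η η' : DForm X k)

/-- A localizer fixes `u` and has identity derivative there, so naturality shows that precomposing
with it does not change the value at `u`. A localizer into the region where `p = q` makes the two
plots literally equal. -/
theorem toFun_congr {p q : Euc n → X} (hp : IsPlot p) (hq : IsPlot q) {u : Euc n}
    (h : p =ᶠ[𝓝 u] q) : η.toFun n p hp u = η.toFun n q hq u := by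
  have key : ∀ {p : Euc n → X} (hp : IsPlot p) {h : Euc n → Euc n} (hh : IsLocalizer h u),
      η.toFun n (p ∘ h) (isPlot_reparam hp hh.contDiff) u = η.toFun n p hp u := by
    intro p hp h hh
    rw [η.natural n n p hp h hh.contDiff u, hh.fderiv_eq, hh.apply_self]
    ext; simp
  obtain ⟨k, hk, hkv⟩ := exists_isLocalizer h
  rw [← key hp hk, ← key hq hk]
  congr 1
  exact funext hkv

theorem ev_of_isPlot {p : Euc n → X} (hp : IsPlot p) : η.ev p = η.toFun n p hp := by
  funext u
  have h := hp.isPlotAt u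
  rw [ev, dif_pos h]
  exact η.toFun_congr _ _ (h.choose_spec.1.comp_eventuallyEq p)

theorem ev_congr {p q : Euc n → X} {u : Euc n} (h : p =ᶠ[𝓝 u] q) : η.ev p u = η.ev q u := by
  by_cases hp : IsPlotAt p u
  · have hq : IsPlotAt q u := hp.congr h.symm
    rw [ev, ev, dif_pos hp, dif_pos hq]
    exact η.toFun_congr _ _ ((hp.choose_spec.1.comp_eventuallyEq p).trans
      (h.trans (hq.choose_spec.1.comp_eventuallyEq q).symm))
  · have hq : ¬ IsPlotAt q u := fun hq => hp (hq.congr h)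
    rw [ev, ev, dif_neg hp, dif_neg hq]

theorem ev_localize {p : Euc n → X} {u : Euc n} {h : Euc n → Euc n} (hh : IsLocalizer h u) :
    η.ev (p ∘ h) u = η.ev p u :=
  η.ev_congr (hh.comp_eventuallyEq p)

theorem ev_comp {p : Euc n → X} {h : Euc m → Euc n} {u : Euc m} (hp : IsPlotAt p (h u))
    (hh : ContDiff ℝ ∞ h) :
    η.ev (p ∘ h) u = (η.ev p (h u)).compContinuousLinearMap (fderiv ℝ h u) := by
  obtain ⟨k, hk, hpk⟩ := hp
  have h1 : p ∘ h =ᶠ[𝓝 u] (p ∘ k) ∘ h :=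
    ((hk.comp_eventuallyEq p).comp_tendsto hh.continuous.continuousAt).symm
  rw [η.ev_congr h1, ev_of_isPlot η (isPlot_reparam hpk hh), η.natural n m _ hpk h hh,
    ← ev_of_isPlot η hpk, η.ev_localize hk]

theorem contDiffAt_ev {p : Euc n → X} {u : Euc n} (hp : IsPlotAt p u) :
    ContDiffAt ℝ ∞ (η.ev p) u := by
  obtain ⟨h, hh, hph⟩ := hp
  refine (η.smooth n _ hph).contDiffAt.congr_of_eventuallyEq ?_
  rw [← ev_of_isPlot η hph]
  filter_upwards [hh.eventually] with v hv
  exact (η.ev_localize hv).symm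

theorem contDiff_ev {p : Euc n → X} (hp : IsPlot p) : ContDiff ℝ ∞ (η.ev p) := by
  rw [ev_of_isPlot η hp]
  exact η.smooth n p hp

theorem differentiableAt_ev {p : Euc n → X} (hp : IsPlot p) (u : Euc n) :
    DifferentiableAt ℝ (η.ev p) u :=
  (η.contDiff_ev hp).contDiffAt.differentiableAt (by simp)

variable {η η'}

theorem ext_ev (h : ∀ (n : ℕ) (p : Euc n → X), IsPlot p → η.ev p = η'.ev p) : η = η' := by
  ext n p hp : 4
  rw [← ev_of_isPlot, ← ev_of_isPlot, h n p hp]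

variable (η η')

theorem ev_add (p : Euc n → X) : (η + η').ev p = η.ev p + η'.ev p := by
  funext u
  by_cases h : IsPlotAt p u
  · simp only [ev, dif_pos h, Pi.add_apply]; rfl
  · simp [ev, dif_neg h]

theorem ev_zero (p : Euc n → X) : (0 : DForm X k).ev p = 0 := by
  funext u
  by_cases h : IsPlotAt p u
  · simp only [ev, dif_pos h]; rfl
  · simp [ev, dif_neg h]

/-- Evaluation of forms on a fixed map, as a homomorphism. -/
def evHom (p : Euc n → X) : DForm X k →+ (Euc n → Euc n [⋀^Fin k]→L[ℝ] ℂ) where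
  toFun η := η.ev p
  map_zero' := ev_zero p
  map_add' η η' := ev_add η η' p

theorem ev_neg (p : Euc n → X) : (-η).ev p = -η.ev p := map_neg (evHom p) η

theorem ev_sub (p : Euc n → X) : (η - η').ev p = η.ev p - η'.ev p := map_sub (evHom p) η η'

theorem ev_zsmul (z : ℤ) (p : Euc n → X) : (z • η).ev p = z • η.ev p := map_zsmul (evHom p) z η

theorem ev_sum {ι : Type*} (s : Finset ι) (η : ι → DForm X k) (p : Euc n → X) :
    (∑ i ∈ s, η i).ev p = ∑ i ∈ s, (η i).ev p := map_sum (evHom p) η s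

theorem ev_pullback {f : X → Y} (hf : DSmooth f) (η : DForm Y k) {p : Euc n → X}
    (hp : IsPlot p) : (η.pullback f hf).ev p = η.ev (f ∘ p) := by
  rw [ev_of_isPlot _ hp, ev_of_isPlot _ (hf n p hp)]
  rfl

theorem ev_d {p : Euc n → X} (hp : IsPlot p) : η.d.ev p = extDeriv (η.ev p) := by
  rw [ev_of_isPlot _ hp, ev_of_isPlot _ hp]
  rfl

theorem d_add : (η + η').d = η.d + η'.d := by
  refine ext_ev fun n p hp => ?_
  rw [ev_d _ hp, ev_add, ev_add, ev_d _ hp, ev_d _ hp]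
  funext u
  exact extDeriv_add (η.differentiableAt_ev hp u) (η'.differentiableAt_ev hp u)

/-- The exterior derivative as a homomorphism. -/
def dHom : DForm X k →+ DForm X (k + 1) := AddMonoidHom.mk' d d_add

theorem d_neg : (-η).d = -η.d := map_neg dHom η

theorem d_sub : (η - η').d = η.d - η'.d := map_sub dHom η η'

theorem d_d : η.d.d = 0 := by
  refine ext_ev fun n p hp => ?_
  rw [ev_d _ hp, ev_d _ hp, ev_zero]
  exact extDeriv_extDeriv (r := ∞) (η.contDiff_ev hp)
    (by rw [minSmoothness_of_isRCLikeNormedField]; exact ENat.LEInfty.out)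

theorem d_pullback {f : X → Y} (hf : DSmooth f) (η : DForm Y k) :
    (η.pullback f hf).d = η.d.pullback f hf := rfl

theorem pullback_add {f : X → Y} (hf : DSmooth f) (η η' : DForm Y k) :
    (η + η').pullback f hf = η.pullback f hf + η'.pullback f hf := rfl

/-- Forms may be compared locally. -/
theorem ev_eq_ev_of_local (η : DForm X k) (η' : DForm Y k) {p : Euc n → X} {q : Euc n → Y}
    (H : ∀ u, ∃ h, IsLocalizer h u ∧ η.ev (p ∘ h) = η'.ev (q ∘ h)) : η.ev p = η'.ev q := by
  funext u
  obtain ⟨h, hh, heq⟩ := H u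
  rw [← η.ev_localize hh, heq, η'.ev_localize hh]

end DForm

/-! ## Descent along subductions -/

/-- A smooth map along which plots can be lifted locally. -/
structure IsSubduction {X Y : Type*} [DiffeologicalSpace X] [DiffeologicalSpace Y]
    (π : X → Y) : Prop where
  smooth : DSmooth π
  exists_lift : ∀ (n : ℕ) (p : Euc n → Y), IsPlot p → ∀ u, ∃ h, IsLocalizer h u ∧
    ∃ q : Euc n → X, IsPlot q ∧ π ∘ q = p ∘ h

namespace IsSubduction

variable {X Y Z : Type*} [DiffeologicalSpace X] [DiffeologicalSpace Y] [DiffeologicalSpace Z]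
  {π : X → Y} {k : ℕ}

theorem ext (hπ : IsSubduction π) {η η' : DForm Y k}
    (H : ∀ (n : ℕ) (q : Euc n → X), IsPlot q → η.ev (π ∘ q) = η'.ev (π ∘ q)) : η = η' := by
  refine DForm.ext_ev fun n p hp => DForm.ev_eq_ev_of_local _ _ fun u => ?_
  obtain ⟨h, hh, q, hq, hqp⟩ := hπ.exists_lift n p hp u
  exact ⟨h, hh, by rw [← hqp, H n q hq]⟩

/-- A form descends along a subduction if it takes the same values on any two lifts of a plot. -/
theorem exists_pullback_eq (hπ : IsSubduction π) (η : DForm X k)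
    (H : ∀ (n : ℕ) (q q' : Euc n → X), IsPlot q → IsPlot q' → π ∘ q = π ∘ q' → η.ev q = η.ev q') :
    ∃ η' : DForm Y k, η'.pullback π hπ.smooth = η := by
  -- The hypothesis compares global plots with equal projections; this is its version for germs.
  have H' : ∀ {n : ℕ} {q q' : Euc n → X} {u : Euc n}, IsPlotAt q u → IsPlotAt q' u →
      π ∘ q =ᶠ[𝓝 u] π ∘ q' → η.ev q u = η.ev q' u := by
    rintro n q q' u ⟨h, hh, hqh⟩ hq' he
    obtain ⟨h', hh', hqh'⟩ := hq'.localize hh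
    -- `l` takes values where `h ∘ h'` is the identity and the projections agree, so after composing
    -- with it the projections are equal everywhere.
    obtain ⟨l, hl, hlv⟩ := exists_isLocalizer
      (((hh.comp hh').eventually.and he.eventually_nhds))
    have h1 := hh.comp hh'
    have h2 := h1.comp hl
    rw [← η.ev_localize h2, ← η.ev_localize (p := q') h2]
    refine congrFun (H n _ _ (isPlot_reparam hqh (hh'.comp hl).contDiff)
      (isPlot_reparam hqh' hl.contDiff) (funext fun v => ?_)) u
    have h3 : (h ∘ h') (l v) = l v := (hlv v).1.apply_self
    have h4 := (hlv v).2.self_of_nhds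
    simp only [Function.comp_apply] at h3 h4 ⊢
    rw [h3, h4]
  choose h hh q hq hqp using hπ.exists_lift
  have key : ∀ {n : ℕ} {p : Euc n → Y} (hp : IsPlot p) (u v : Euc n) {r : Euc n → X},
      IsPlotAt r v → π ∘ r =ᶠ[𝓝 v] p → IsLocalizer (h n p hp u) v →
      η.ev (q n p hp u) v = η.ev r v := by
    intro n p hp u v r hr hrp hl
    refine H' ((hq n p hp u).isPlotAt v) hr ?_
    rw [hqp]
    exact (hl.comp_eventuallyEq p).trans hrp.symm
  have lift : ∀ {n : ℕ} {p : Euc n → Y} (hp : IsPlot p) (u v : Euc n),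
      IsLocalizer (h n p hp u) v → π ∘ (q n p hp u) =ᶠ[𝓝 v] p := by
    intro n p hp u v hl
    rw [hqp]
    exact hl.comp_eventuallyEq p
  -- The value at `u` is read off a lift chosen for that `u`. By `key`, this one lift also computes
  -- the values at all nearby points, which gives smoothness.
  refine ⟨⟨fun n p hp u => η.ev (q n p hp u) u, fun n p hp => ?_,
    fun n m p hp g hg u => ?_⟩, ?_⟩
  · refine contDiff_iff_contDiffAt.2 fun u => ?_
    refine (η.contDiff_ev (hq n p hp u)).contDiffAt.congr_of_eventuallyEq ?_
    filter_upwards [(hh n p hp u).eventually] with v hv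
    exact key hp v v ((hq n p hp u).isPlotAt v) (lift hp u v hv) (hh n p hp v)
  · rw [← η.ev_comp ((hq n p hp (g u)).isPlotAt _) hg]
    refine key _ u u ((isPlot_reparam (hq n p hp (g u)) hg).isPlotAt u) ?_ (hh _ _ _ u)
    exact (lift hp (g u) (g u) (hh n p hp (g u))).comp_tendsto hg.continuous.continuousAt
  · refine DForm.ext_ev fun n p hp => ?_
    rw [DForm.ev_of_isPlot _ hp]
    funext u
    exact key _ u u (hp.isPlotAt u) .rfl (hh _ _ _ u)

end IsSubduction

/-! ## Averaging of forms -/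

/-- A smooth partition of unity `ρ` on `W` and maps `F i : W → Z` which are smooth near the support
of `ρ i`, all tested on plots. -/
structure IsAveraging {ι W Z : Type*} [DiffeologicalSpace W] [DiffeologicalSpace Z]
    (ρ : ι → W → ℝ) (F : ι → W → Z) : Prop where
  contDiff : ∀ (i : ι) (n : ℕ) (p : Euc n → W), IsPlot p → ContDiff ℝ ∞ (ρ i ∘ p)
  isPlotAt : ∀ (i : ι) (n : ℕ) (p : Euc n → W), IsPlot p → ∀ u,
    (∀ᶠ v in 𝓝 u, ρ i (p v) = 0) ∨ IsPlotAt (F i ∘ p) u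
  finite : ∀ (n : ℕ) (p : Euc n → W), IsPlot p → ∀ u, ∃ s : Finset ι,
    ∀ᶠ v in 𝓝 u, ∀ i ∉ s, ρ i (p v) = 0
  sum_eq_one : ∀ w, ∑ᶠ i, ρ i w = 1

namespace IsAveraging

variable {ι ι' W W' Z Z' : Type*} [DiffeologicalSpace W] [DiffeologicalSpace Z]
  [DiffeologicalSpace W'] [DiffeologicalSpace Z']
  {ρ : ι → W → ℝ} {F : ι → W → Z} {ρ' : ι' → W' → ℝ} {F' : ι' → W' → Z'} {k : ℕ}

theorem exists_finset (h : IsAveraging ρ F) (w : W) : ∃ s : Finset ι, ∀ i ∉ s, ρ i w = 0 := by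
  obtain ⟨s, hs⟩ := h.finite 0 (fun _ => w) isPlot_const 0
  exact ⟨s, hs.self_of_nhds⟩

theorem isPlotAt_of_ne_zero (h : IsAveraging ρ F) {i : ι} {n : ℕ} {p : Euc n → W} (hp : IsPlot p)
    {u : Euc n} (hi : ρ i (p u) ≠ 0) : IsPlotAt (F i ∘ p) u :=
  (h.isPlotAt i n p hp u).resolve_left fun h0 => hi h0.self_of_nhds

theorem sum_eq (h : IsAveraging ρ F) {w : W} {s : Finset ι} (hs : ∀ i ∉ s, ρ i w = 0) :
    ∑ i ∈ s, ρ i w = 1 := by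
  rw [← h.sum_eq_one w, finsum_eq_sum_of_support_subset]
  intro i hi
  by_contra hne
  exact hi (hs i hne)

theorem comp (h : IsAveraging ρ F) {g : W' → W} (hg : DSmooth g) :
    IsAveraging (fun i => ρ i ∘ g) (fun i => F i ∘ g) where
  contDiff i n p hp := h.contDiff i n _ (hg n p hp)
  isPlotAt i n p hp u := h.isPlotAt i n _ (hg n p hp) u
  finite n p hp u := h.finite n _ (hg n p hp) u
  sum_eq_one w := h.sum_eq_one (g w)

theorem of_isPlotAt (h : IsAveraging ρ F) {F₁ : ι → W → Z'}
    (H : ∀ (i : ι) (n : ℕ) (p : Euc n → W), IsPlot p → ∀ u, IsPlotAt (F i ∘ p) u →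
      IsPlotAt (F₁ i ∘ p) u) : IsAveraging ρ F₁ where
  contDiff := h.contDiff
  isPlotAt i n p hp u := (h.isPlotAt i n p hp u).imp_right (H i n p hp u)
  finite := h.finite
  sum_eq_one := h.sum_eq_one

/-- Product weights make it possible to average over composable pairs in `X^[2]` with a partition of
unity on `X^[2]` alone. -/
theorem prod (h : IsAveraging ρ F) (h' : IsAveraging ρ' F') :
    IsAveraging (fun (i : ι × ι') (w : W × W') => ρ i.1 w.1 * ρ' i.2 w.2)
      (fun i w => (F i.1 w.1, F' i.2 w.2)) where
  contDiff i n p hp := (h.contDiff i.1 n _ hp.1).mul (h'.contDiff i.2 n _ hp.2)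
  isPlotAt i n p hp u := by
    rcases h.isPlotAt i.1 n _ hp.1 u with h1 | h1
    · exact .inl (h1.mono fun v hv => by rw [hv, zero_mul])
    rcases h'.isPlotAt i.2 n _ hp.2 u with h2 | h2
    · exact .inl (h2.mono fun v hv => by rw [hv, mul_zero])
    exact .inr (h1.prodMk h2)
  finite n p hp u := by
    obtain ⟨s, hs⟩ := h.finite n _ hp.1 u
    obtain ⟨s', hs'⟩ := h'.finite n _ hp.2 u
    refine ⟨s ×ˢ s', ?_⟩
    filter_upwards [hs, hs'] with v hv hv' i hi
    by_cases h1 : i.1 ∈ s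
    · rw [hv' i.2 fun h2 => hi (Finset.mem_product.2 ⟨h1, h2⟩), mul_zero]
    · rw [hv i.1 h1, zero_mul]
  sum_eq_one w := by
    obtain ⟨s, hs⟩ := h.exists_finset w.1
    obtain ⟨s', hs'⟩ := h'.exists_finset w.2
    rw [finsum_eq_sum_of_support_subset (s := s ×ˢ s'), Finset.sum_product,
      ← Finset.sum_mul_sum (f := fun i => ρ i w.1) (g := fun j => ρ' j w.2), h.sum_eq hs,
      h'.sum_eq hs', one_mul]
    intro i hi
    rw [Finset.mem_coe, Finset.mem_product]
    by_contra hne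
    rw [not_and_or] at hne
    rcases hne with h1 | h1
    · exact hi (by simp [hs _ h1])
    · exact hi (by simp [hs' _ h1])

theorem zero_smul_alternating {n : ℕ} (a : Euc n [⋀^Fin k]→L[ℝ] ℂ) : (0 : ℝ) • a = 0 :=
  zero_smul ℝ a

/-- The average `∑ᵢ ρᵢ Fᵢ^* η`. -/
def avg (h : IsAveraging ρ F) (η : DForm Z k) : DForm W k where
  toFun n p _ u := ∑ᶠ i, ρ i (p u) • η.ev (F i ∘ p) u
  smooth n p hp := contDiff_iff_contDiffAt.2 fun u => by
    obtain ⟨s, hs⟩ := h.finite n p hp u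
    have h1 : (fun v => ∑ᶠ i, ρ i (p v) • η.ev (F i ∘ p) v) =ᶠ[𝓝 u]
        fun v => ∑ i ∈ s, ρ i (p v) • η.ev (F i ∘ p) v := by
      filter_upwards [hs] with v hv
      refine finsum_eq_sum_of_support_subset _ fun i hi => ?_
      by_contra hne
      exact hi (by simp only [hv i hne, zero_smul_alternating])
    refine ContDiffAt.congr_of_eventuallyEq (ContDiffAt.sum fun i _ => ?_) h1
    rcases h.isPlotAt i n p hp u with h0 | h0
    · refine (contDiffAt_const (c := 0)).congr_of_eventuallyEq ?_
      filter_upwards [h0] with v hv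
      rw [hv, zero_smul_alternating]
    · exact (h.contDiff i n p hp).contDiffAt.smul (η.contDiffAt_ev h0)
  natural n m p hp g hg u := by
    obtain ⟨s, hs⟩ := h.exists_finset (p (g u))
    have h1 : ∀ i ∉ s, ρ i ((p ∘ g) u) = 0 := hs
    rw [finsum_eq_sum_of_support_subset (s := s), finsum_eq_sum_of_support_subset (s := s)]
    · ext v
      simp only [ContinuousAlternatingMap.compContinuousLinearMap_apply,
        ContinuousAlternatingMap.sum_apply, ContinuousAlternatingMap.smul_apply]
      refine Finset.sum_congr rfl fun i _ => ?_
      -- Where the weight vanishes, `F i ∘ p` need not be a plot and `ev_comp` is not available, but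
      -- the term is zero on both sides.
      by_cases hi : ρ i (p (g u)) = 0
      · simp [hi]
      · rw [← Function.comp_assoc, η.ev_comp (h.isPlotAt_of_ne_zero hp hi) hg]
        rfl
    · intro i hi
      by_contra hne
      exact hi (by simp only [hs i hne, zero_smul_alternating])
    · intro i hi
      by_contra hne
      exact hi (by simp only [h1 i hne, zero_smul_alternating])

theorem avg_ev (h : IsAveraging ρ F) (η : DForm Z k) {n : ℕ} {p : Euc n → W} (hp : IsPlot p)
    (u : Euc n) {s : Finset ι} (hs : ∀ i ∉ s, ρ i (p u) = 0) :
    (h.avg η).ev p u = ∑ i ∈ s, ρ i (p u) • η.ev (F i ∘ p) u := by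
  rw [DForm.ev_of_isPlot _ hp]
  refine finsum_eq_sum_of_support_subset _ fun i hi => ?_
  by_contra hne
  exact hi (by simp only [hs i hne, zero_smul_alternating])

end IsAveraging

/-! ## Averaging over local sections -/

/-- Plots are continuous. -/
def HasContinuousPlots (X : Type*) [TopologicalSpace X] [DiffeologicalSpace X] : Prop :=
  ∀ (n : ℕ) (p : Euc n → X), IsPlot p → Continuous p

theorem hasContinuousPlots_manifold {E H M : Type*} [NormedAddCommGroup E] [NormedSpace ℝ E]
    [TopologicalSpace H] (I : ModelWithCorners ℝ E H) [TopologicalSpace M] [ChartedSpace H M] :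
    letI := manifoldDiffeology I M
    HasContinuousPlots M := by
  intro n p hp
  have hp' : ContMDiff 𝓘(ℝ, Euc n) I ∞ p := hp
  exact hp'.continuous

theorem HasContinuousPlots.fiberPower {X M : Type*} [TopologicalSpace X] [DiffeologicalSpace X]
    (hX : HasContinuousPlots X) (π : X → M) (q : ℕ) : HasContinuousPlots (FiberPower π q) :=
  fun n _ hp => Continuous.subtype_mk (continuous_pi fun i => hX n _ (hp i)) _

/-- A map smooth on a subspace is extended arbitrarily to a total function `F`. Near points whose
neighbours land in the subspace, the junk values do not matter. -/
theorem isPlotAt_of_extends {W Z : Type*} [DiffeologicalSpace W] [DiffeologicalSpace Z]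
    {S : W → Prop} {f : {w // S w} → Z} (hf : DSmooth f) {F : W → Z} (hF : ∀ w, F w.1 = f w)
    {n : ℕ} {p : Euc n → W} (hp : IsPlot p) {u : Euc n} (hu : ∀ᶠ v in 𝓝 u, S (p v)) :
    IsPlotAt (F ∘ p) u := by
  obtain ⟨h, hh, hS⟩ := exists_isLocalizer hu
  have h1 : IsPlot fun v => (⟨p (h v), hS v⟩ : {w // S w}) := isPlot_reparam hp hh.contDiff
  have h2 := hf n _ h1
  refine ⟨h, hh, ?_⟩
  convert h2 using 1
  exact funext fun v => hF ⟨p (h v), hS v⟩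

/-- Maps which are smooth over the members of an open cover can be averaged. -/
theorem exists_isAveraging {B W Z : Type*} [TopologicalSpace B] [DiffeologicalSpace B]
    [DiffeologicalSpace W] [DiffeologicalSpace Z] (hB : HasContinuousPlots B)
    (hpu : SupportsPartitionsOfUnity B) {g : W → B} (hg : DSmooth g) {U : B → Set B}
    (hU : ∀ b, IsOpen (U b)) (hmem : ∀ b, b ∈ U b)
    {f : ∀ b, {w // g w ∈ U b} → Z} (hf : ∀ b, DSmooth (f b)) {F : B → W → Z}
    (hF : ∀ b w, F b w.1 = f b w) :
    ∃ ρ : B → B → ℝ, IsAveraging (fun b => ρ b ∘ g) F ∧ ∀ b c, ρ b c ≠ 0 → c ∈ U b := by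
  obtain ⟨ρ, hρ, -, hfin, hsupp, hsum⟩ := hpu U hU hmem
  refine ⟨ρ, ⟨fun b n p hp => hρ b n _ (hg n p hp), fun b n p hp u => ?_, fun n p hp u => ?_,
    fun w => hsum (g w)⟩, fun b c hc => hsupp b (subset_tsupport _ hc)⟩
  · have hc : Continuous (g ∘ p) := hB n _ (hg n p hp)
    -- On the closed support the point lies in the open set `U b`, where `F b` is smooth; off it, `ρ
    -- b` vanishes on a whole neighbourhood.
    by_cases h : g (p u) ∈ tsupport (ρ b)
    · exact .inr (isPlotAt_of_extends (hf b) (hF b) hp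
        (hc.continuousAt.eventually ((hU b).mem_nhds (hsupp b h))))
    · left
      have h1 := hc.continuousAt.eventually
        ((isClosed_tsupport (ρ b)).isOpen_compl.mem_nhds (x := (g ∘ p) u) h)
      filter_upwards [h1] with v hv
      exact image_eq_zero_of_notMem_tsupport (f := ρ b) hv
  · have hc : Continuous (g ∘ p) := hB n _ (hg n p hp)
    obtain ⟨t, ht, hft⟩ := hfin (g (p u))
    refine ⟨hft.toFinset, ?_⟩
    filter_upwards [hc.continuousAt.eventually ht] with v hv i hi
    by_contra hne
    exact hi (hft.mem_toFinset.2 ⟨_, hne, hv⟩)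

namespace LocallySplit

variable {X M : Type*} [TopologicalSpace X] [DiffeologicalSpace X]
    [TopologicalSpace M] [DiffeologicalSpace M] (π : LocallySplit X M)

/-- Outside `U b` the local section is extended by an arbitrary set-theoretic section, so that `π (s
i c) = c` holds everywhere. The homotopy on fibre powers needs this in order to be defined on all
points. -/
theorem exists_isAveraging (hM : HasContinuousPlots M) (hpu : SupportsPartitionsOfUnity M) :
    ∃ (ρ : M → M → ℝ) (s : M → M → X), IsAveraging ρ s ∧ ∀ i c, π.toFun (s i c) = c := by
  choose U hU hmem s hs hπs using π.exists_section
  classical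
  let S : M → M → X := fun b c => if h : c ∈ U b then s b ⟨c, h⟩ else Function.surjInv π.surjective c
  have hS : ∀ b (c : {c // c ∈ U b}), S b c.1 = s b c := fun b c => dif_pos c.2
  obtain ⟨ρ, hρ, -⟩ := _root_.exists_isAveraging hM hpu (g := id) dSmooth_id hU hmem hs hS
  refine ⟨ρ, S, hρ, fun i c => ?_⟩
  by_cases h : c ∈ U i
  · simp only [S, dif_pos h, hπs]
  · simp only [S, dif_neg h, Function.surjInv_eq]

theorem isSubduction (hM : HasContinuousPlots M) : IsSubduction π.toFun where
  smooth := π.smooth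
  exists_lift n p hp u := by
    obtain ⟨U, hU, hu, s, hs, hπs⟩ := π.exists_section (p u)
    obtain ⟨h, hh, hhU⟩ := exists_isLocalizer
      ((hM n p hp).continuousAt.eventually (hU.mem_nhds hu))
    exact ⟨h, hh, fun v => s ⟨p (h v), hhU v⟩, hs n (fun v => ⟨p (h v), hhU v⟩)
      (isPlot_reparam hp hh.contDiff), funext fun v => hπs _⟩

end LocallySplit

/-- Several plots are lifted with one common localizer, so that relations among them, such as
composability, are inherited by the lifts. -/
theorem IsSubduction.exists_lifts {X Y : Type*} [DiffeologicalSpace X] [DiffeologicalSpace Y]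
    {π : X → Y} (hπ : IsSubduction π) {n r : ℕ} {p : Fin r → Euc n → Y}
    (hp : ∀ i, IsPlot (p i)) (u : Euc n) :
    ∃ h, IsLocalizer h u ∧ ∃ q : Fin r → Euc n → X,
      (∀ i, IsPlot (q i)) ∧ ∀ i v, π (q i v) = p i (h v) := by
  induction r with
  | zero => exact ⟨id, .id u, fun i => i.elim0, fun i => i.elim0, fun i => i.elim0⟩
  | succ r ih =>
    obtain ⟨h, hh, q, hq, hqp⟩ := ih fun i : Fin r => hp i.succ
    obtain ⟨h', hh', q', hq', hqp'⟩ :=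
      hπ.exists_lift n _ (isPlot_reparam (hp 0) hh.contDiff) u
    refine ⟨h ∘ h', hh.comp hh', Fin.cons q' fun i => q i ∘ h', fun i => ?_, fun i v => ?_⟩
    · induction i using Fin.cases with
      | zero => exact hq'
      | succ i => exact isPlot_reparam (p := q i) (hq i) hh'.contDiff
    · induction i using Fin.cases with
      | zero => exact congrFun hqp' v
      | succ i => exact hqp i (h' v)

/-! ### The complex of forms on fibre powers and its exactness -/

namespace FiberPower

variable {X M : Type*} [DiffeologicalSpace X] (π : X → M) {n k q : ℕ}

theorem delta_ev (η : DForm (FiberPower π q) k) {p : Euc n → FiberPower π (q + 1)}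
    (hp : IsPlot p) : (delta π η).ev p =
      ∑ i : Fin (q + 1), ((-1 : ℤ) ^ ((i : ℕ) + 1)) • η.ev (face π q i ∘ p) := by
  rw [delta, DForm.ev_sum]
  refine Finset.sum_congr rfl fun i _ => ?_
  rw [DForm.ev_zsmul, DForm.ev_pullback _ _ hp]

theorem delta_add (η η' : DForm (FiberPower π q) k) :
    delta π (η + η') = delta π η + delta π η' := by
  simp only [delta, DForm.pullback_add, smul_add, Finset.sum_add_distrib]

/-- The map `δ` as a homomorphism. -/
def deltaHom : DForm (FiberPower π q) k →+ DForm (FiberPower π (q + 1)) k :=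
  AddMonoidHom.mk' (delta π) (delta_add π)

theorem delta_neg (η : DForm (FiberPower π q) k) : delta π (-η) = -delta π η :=
  map_neg (deltaHom π) η

theorem delta_sub (η η' : DForm (FiberPower π q) k) :
    delta π (η - η') = delta π η - delta π η' :=
  map_sub (deltaHom π) η η'

theorem d_delta (η : DForm (FiberPower π q) k) : (delta π η).d = delta π η.d := by
  simp only [delta]
  change DForm.dHom _ = _
  rw [map_sum]
  refine Finset.sum_congr rfl fun i _ => ?_
  rw [map_zsmul]
  rfl

theorem deltaOne_ev (η : DForm X k) {p : Euc n → FiberPower π 2} (hp : IsPlot p) :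
    (deltaOne π η).ev p = η.ev (fun v => (p v).1 0) - η.ev (fun v => (p v).1 1) := by
  have h (i : Fin 2) : IsPlot (face π 1 i ∘ p) := face_smooth π 1 i n p hp
  rw [deltaOne, delta_ev π _ hp, Fin.sum_univ_two, DForm.ev_pullback _ _ (h 0),
    DForm.ev_pullback _ _ (h 1)]
  have h0 : ofOne π ∘ face π 1 0 ∘ p = fun v => (p v).1 1 := rfl
  have h1 : ofOne π ∘ face π 1 1 ∘ p = fun v => (p v).1 0 := rfl
  rw [h0, h1]
  simp
  abel

theorem delta_ev_three (η : DForm (FiberPower π 2) k) {p : Euc n → FiberPower π 3}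
    (hp : IsPlot p) : (delta π η).ev p =
      -η.ev (face π 2 0 ∘ p) + η.ev (face π 2 1 ∘ p) - η.ev (face π 2 2 ∘ p) := by
  rw [delta_ev π _ hp, Fin.sum_univ_three]
  norm_num
  abel

theorem delta_ev_four (η : DForm (FiberPower π 3) k) {p : Euc n → FiberPower π 4}
    (hp : IsPlot p) : (delta π η).ev p =
      -η.ev (face π 3 0 ∘ p) + η.ev (face π 3 1 ∘ p) - η.ev (face π 3 2 ∘ p)
        + η.ev (face π 3 3 ∘ p) := by
  rw [delta_ev π _ hp, Fin.sum_univ_four]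
  norm_num
  abel

theorem delta_ev_five (η : DForm (FiberPower π 4) k) {p : Euc n → FiberPower π 5}
    (hp : IsPlot p) : (delta π η).ev p =
      -η.ev (face π 4 0 ∘ p) + η.ev (face π 4 1 ∘ p) - η.ev (face π 4 2 ∘ p)
        + η.ev (face π 4 3 ∘ p) - η.ev (face π 4 4 ∘ p) := by
  rw [delta_ev π _ hp, Fin.sum_univ_five]
  norm_num
  abel

variable {π}

/-- Exactness of the complex of forms on the fibre powers. -/
theorem exists_delta_eq [DiffeologicalSpace M] (hπ : DSmooth π) {ι : Type*} {ρ : ι → M → ℝ}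
    {s : ι → M → X} (hρ : IsAveraging ρ s) (hs : ∀ i c, π (s i c) = c)
    (η : DForm (FiberPower π (q + 2)) k) (hη : delta π η = 0) :
    ∃ ξ : DForm (FiberPower π (q + 1)) k, delta π ξ = η := by
  -- The section enters as a new zeroth factor. The index `r` is left free because the same map is
  -- needed on both `X^[q+1]` and `X^[q+2]`.
  let F : ∀ {r : ℕ}, ι → FiberPower π (r + 1) → FiberPower π (r + 2) := fun i x =>
    ⟨Fin.cons (s i (π (x.1 0))) x.1, fun j l => by
      induction j using Fin.cases <;> induction l using Fin.cases <;> simp [hs, x.2 _ 0]⟩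
  have hbase : ∀ r, DSmooth fun x : FiberPower π (r + 1) => π (x.1 0) := fun r n p hp =>
    hπ n _ (hp 0)
  have hF : ∀ (i : ι) (r n : ℕ) (p : Euc n → FiberPower π (r + 1)), IsPlot p → ∀ u,
      IsPlotAt (s i ∘ fun v => π ((p v).1 0)) u → IsPlotAt (F i ∘ p) u :=
    fun i r n p hp u hu => (hu.finCons ((dSmooth_val _ n p hp).isPlotAt u)).subtype
  have hav : IsAveraging (fun i => ρ i ∘ fun x : FiberPower π (q + 1) => π (x.1 0)) F :=
    (hρ.comp (hbase q)).of_isPlotAt fun i n p hp u => hF i q n p hp u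
  -- The minus sign is there because the face omitting the zeroth factor, which recovers `p` from `F
  -- i ∘ p`, enters `δ` with sign `-1`.
  refine ⟨-hav.avg η, DForm.ext_ev fun n p hp => funext fun u => ?_⟩
  obtain ⟨S, hS⟩ := hρ.exists_finset (π ((p u).1 0))
  have hface : ∀ j : Fin (q + 2), π ((face π (q + 1) j (p u)).1 0) = π ((p u).1 0) :=
    fun j => (p u).2 _ _
  -- This is `δ η = 0` evaluated on `F i ∘ p`: face zero returns `p`, and the face `j + 1` of the
  -- extended tuple is the extension of face `j`. The weights depend only on the base point, so they
  -- agree on all faces and the identity can be averaged.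
  have hterm : ∀ i, ρ i (π ((p u).1 0)) ≠ 0 → η.ev p u =
      ∑ j : Fin (q + 2), ((-1 : ℤ) ^ (j : ℕ)) • η.ev (F i ∘ face π (q + 1) j ∘ p) u := by
    intro i hi
    obtain ⟨h, hh, hFh⟩ := hF i _ n p hp u ((hρ.comp (hbase (q + 1))).isPlotAt_of_ne_zero hp hi)
    have h1 := congrFun (delta_ev π η hFh) u
    rw [hη, DForm.ev_zero, Fin.sum_univ_succ] at h1
    have h2 : face π (q + 2) 0 ∘ (F i ∘ p) ∘ h = p ∘ h := rfl
    have h3 : ∀ j : Fin (q + 2), face π (q + 2) j.succ ∘ (F i ∘ p) ∘ h =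
        (F i ∘ face π (q + 1) j ∘ p) ∘ h := by
      intro j
      funext v
      apply Subtype.ext
      funext l
      induction l using Fin.cases with
      | zero => simp [face, F, (p (h v)).2 (j.succAbove 0) 0]
      | succ l => simp [face, F]
    simp only [h2, h3, Pi.add_apply, Pi.smul_apply, Finset.sum_apply, η.ev_localize hh,
      Pi.zero_apply] at h1
    have h4 : η.ev p u = ∑ j : Fin (q + 2), ((-1 : ℤ) ^ ((j.succ : ℕ) + 1)) •
        η.ev (F i ∘ face π (q + 1) j ∘ p) u := by
      simp only [Fin.val_zero, zero_add, pow_one, neg_smul, one_smul] at h1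
      exact (neg_add_eq_zero.1 h1.symm)
    rw [h4]
    refine Finset.sum_congr rfl fun j _ => ?_
    rw [Fin.val_succ, pow_succ, pow_succ]
    simp
  rw [delta_ev π _ hp, Finset.sum_apply]
  have h5 : ∀ j : Fin (q + 2), (((-1 : ℤ) ^ ((j : ℕ) + 1)) •
      (-hav.avg η).ev (face π (q + 1) j ∘ p)) u =
      ∑ i ∈ S, ρ i (π ((p u).1 0)) •
        (((-1 : ℤ) ^ (j : ℕ)) • η.ev (F i ∘ face π (q + 1) j ∘ p) u) := by
    intro j
    rw [Pi.smul_apply, DForm.ev_neg, Pi.neg_apply,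
      hav.avg_ev η (face_smooth π (q + 1) j n p hp) u (s := S) (by
        intro i hi
        simp only [Function.comp_apply, hface]
        exact hS i hi), pow_succ]
    simp only [mul_neg, mul_one, neg_smul, smul_neg, neg_neg, Function.comp_apply, hface,
      Finset.smul_sum, Finset.sum_neg_distrib]
    refine Finset.sum_congr rfl fun i _ => ?_
    rw [smul_comm]
  simp only [h5]
  rw [Finset.sum_comm]
  have h6 : ∀ i ∈ S, (∑ j : Fin (q + 2), ρ i (π ((p u).1 0)) •
      (((-1 : ℤ) ^ (j : ℕ)) • η.ev (F i ∘ face π (q + 1) j ∘ p) u)) =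
      ρ i (π ((p u).1 0)) • η.ev p u := by
    intro i _
    by_cases hi : ρ i (π ((p u).1 0)) = 0
    · simp only [hi, IsAveraging.zero_smul_alternating, Finset.sum_const_zero]
    · rw [hterm i hi, Finset.smul_sum]
  rw [Finset.sum_congr rfl h6, ← Finset.sum_smul, hρ.sum_eq hS, one_smul]

/-- Exactness at `Ωᵏ(X^[2])`, in terms of forms on `X`. -/
theorem exists_deltaOne_eq [DiffeologicalSpace M] (hπ : DSmooth π) {ι : Type*} {ρ : ι → M → ℝ}
    {s : ι → M → X} (hρ : IsAveraging ρ s) (hs : ∀ i c, π (s i c) = c)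
    (η : DForm (FiberPower π 2) k) (hη : delta π η = 0) :
    ∃ ξ : DForm X k, deltaOne π ξ = η := by
  obtain ⟨ξ, hξ⟩ := exists_delta_eq hπ hρ hs η hη
  have hone : DSmooth fun x : X => (⟨fun _ => x, fun _ _ => rfl⟩ : FiberPower π 1) :=
    fun n p hp _ => hp
  refine ⟨ξ.pullback _ hone, ?_⟩
  rw [deltaOne, ← hξ]
  congr 1
  refine DForm.ext_ev fun n p hp => ?_
  have h1 := ofOne_smooth π n p hp
  rw [DForm.ev_pullback _ _ hp, DForm.ev_pullback _ _ h1]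
  congr 1
  funext v
  apply Subtype.ext
  funext i
  rw [Subsingleton.elim i 0]
  rfl

end FiberPower

/-! ## The invariant form on `ℂˣ` -/

section Units

variable {n : ℕ} {z w : Euc n → ℂˣ}

theorem isPlot_units_iff : IsPlot z ↔ ContDiff ℝ ∞ fun v => (z v : ℂ) := Iff.rfl

theorem isPlot_units_mul (hz : IsPlot z) (hw : IsPlot w) : IsPlot fun v => z v * w v := by
  have hz' : ContDiff ℝ ∞ fun v => (z v : ℂ) := hz
  have hw' : ContDiff ℝ ∞ fun v => (w v : ℂ) := hw
  simpa [isPlot_units_iff] using hz'.mul hw'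

theorem isPlot_units_inv (hz : IsPlot z) : IsPlot fun v => (z v)⁻¹ := by
  have hz' : ContDiff ℝ ∞ fun v => (z v : ℂ) := hz
  simp only [isPlot_units_iff, Units.val_inv_eq_inv_val]
  exact hz'.inv fun v => (z v).ne_zero

namespace DForm

theorem maurerCartan_ev (hz : IsPlot z) (u : Euc n) :
    maurerCartan.ev z u = ContinuousAlternatingMap.ofSubsingleton ℝ (Euc n) ℂ (0 : Fin 1)
      (((z u : ℂ)⁻¹) • fderiv ℝ (fun v => (z v : ℂ)) u) := by
  rw [ev_of_isPlot _ hz]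
  rfl

theorem maurerCartan_ev_mul (hz : IsPlot z) (hw : IsPlot w) :
    maurerCartan.ev (fun v => z v * w v) = maurerCartan.ev z + maurerCartan.ev w := by
  funext u
  have hz' : ContDiff ℝ ∞ fun v => (z v : ℂ) := hz
  have hw' : ContDiff ℝ ∞ fun v => (w v : ℂ) := hw
  have hd : fderiv ℝ (fun v => ((z v * w v : ℂˣ) : ℂ)) u =
      (z u : ℂ) • fderiv ℝ (fun v => (w v : ℂ)) u + (w u : ℂ) • fderiv ℝ (fun v => (z v : ℂ)) u := by
    simp only [Units.val_mul]
    exact fderiv_fun_mul (hz'.contDiffAt.differentiableAt (by simp))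
      (hw'.contDiffAt.differentiableAt (by simp))
  rw [Pi.add_apply, maurerCartan_ev (isPlot_units_mul hz hw), maurerCartan_ev hz,
    maurerCartan_ev hw, hd]
  have h1 := (z u).ne_zero
  have h2 := (w u).ne_zero
  ext v
  simp
  field_simp
  ring

theorem maurerCartan_ev_mul_at {u : Euc n} (hz : IsPlotAt z u) (hw : IsPlotAt w u) :
    maurerCartan.ev (fun v => z v * w v) u = maurerCartan.ev z u + maurerCartan.ev w u := by
  obtain ⟨h, hh, hzh⟩ := hz
  obtain ⟨h', hh', hwh⟩ := hw.localize hh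
  have hl := hh.comp hh'
  rw [← maurerCartan.ev_localize hl, ← maurerCartan.ev_localize (p := z) hl,
    ← maurerCartan.ev_localize (p := w) hl]
  exact congrFun (maurerCartan_ev_mul (isPlot_reparam hzh hh'.contDiff) hwh) u

/-- Near `u` the form is `d log (z(u)⁻¹ z)`. Dividing by the constant `z(u)` moves the values near
`1`, inside the slit plane, without changing the logarithmic derivative. -/
theorem d_maurerCartan : maurerCartan.d = 0 := by
  refine ext_ev fun n z hz => funext fun u => ?_
  have hz' : ContDiff ℝ ∞ fun v => (z v : ℂ) := hz
  have hd : Differentiable ℝ fun v => (z v : ℂ) := hz'.differentiable (by simp)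
  have hc : ContDiff ℝ ∞ fun v => (z u : ℂ)⁻¹ * z v := contDiff_const.mul hz'
  have hslit : ∀ᶠ v in 𝓝 u, (z u : ℂ)⁻¹ * z v ∈ Complex.slitPlane := by
    refine hc.continuous.continuousAt.eventually (Complex.isOpen_slitPlane.mem_nhds ?_)
    simp only [inv_mul_cancel₀ (z u).ne_zero]
    exact Complex.one_mem_slitPlane
  have hlog : maurerCartan.ev z =ᶠ[𝓝 u] extDeriv fun v =>
      ContinuousAlternatingMap.constOfIsEmpty ℝ (Euc n) (Fin 0)
        (Complex.log ((z u : ℂ)⁻¹ * z v)) := by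
    filter_upwards [hslit] with v hv
    have h1 : HasFDerivAt (fun v => (z u : ℂ)⁻¹ * z v)
        ((z u : ℂ)⁻¹ • fderiv ℝ (fun v => (z v : ℂ)) v) v :=
      (hd v).hasFDerivAt.const_mul _
    have h2 := (Complex.hasStrictDerivAt_log hv).hasDerivAt.comp_hasFDerivAt v h1
    rw [extDeriv_constOfIsEmpty, maurerCartan_ev hz]
    congr 1
    refine (Eq.trans ?_ h2.fderiv.symm)
    have h3 := (z u).ne_zero
    have h4 := (z v).ne_zero
    ext w
    simp
    field_simp
  rw [ev_d _ hz, hlog.extDeriv_eq, ev_zero]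
  refine extDeriv_extDeriv_apply (r := ∞) ?_
    (by rw [minSmoothness_of_isRCLikeNormedField]; exact ENat.LEInfty.out)
  exact (ContinuousAlternatingMap.constOfIsEmptyLIE ℝ (Euc n) ℂ (Fin 0)).contDiff.contDiffAt.comp u
    (ContDiffAt.comp (g := Complex.log) u
      ((Complex.contDiffAt_log hslit.self_of_nhds).restrict_scalars ℝ) hc.contDiffAt)

end DForm

end Units

/-! ## Principal bundles -/

namespace PrincipalBundle

variable {B P : Type*} [TopologicalSpace B] [DiffeologicalSpace B] [DiffeologicalSpace P]
  [MulAction ℂˣ P] (𝓟 : PrincipalBundle B P)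

theorem isSubduction (hB : HasContinuousPlots B) : IsSubduction 𝓟.proj where
  smooth := 𝓟.proj_smooth
  exists_lift n p hp u := by
    obtain ⟨U, hU, hu, s, -, hs, -, hπs, -⟩ := 𝓟.locally_trivial (p u)
    obtain ⟨h, hh, hhU⟩ := exists_isLocalizer
      ((hB n p hp).continuousAt.eventually (hU.mem_nhds hu))
    exact ⟨h, hh, fun v => s ⟨p (h v), hhU v⟩, hs n (fun v => ⟨p (h v), hhU v⟩)
      (isPlot_reparam hp hh.contDiff), funext fun v => hπs _⟩

theorem isPlot_smul (𝓟 : PrincipalBundle B P) {n : ℕ} {z : Euc n → ℂˣ} {q : Euc n → P} (hz : IsPlot z) (hq : IsPlot q) :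
    IsPlot fun v => z v • q v :=
  𝓟.smul_smooth n (fun v => (z v, q v)) ⟨hz, hq⟩

/-- Two lifts of a plot of the base differ locally by a plot of `ℂˣ`. -/
theorem exists_smul_eq (hB : HasContinuousPlots B) {n : ℕ} {q q' : Euc n → P} (hq : IsPlot q)
    (hq' : IsPlot q') (h : ∀ v, 𝓟.proj (q v) = 𝓟.proj (q' v)) (u : Euc n) :
    ∃ k, IsLocalizer k u ∧ ∃ z : Euc n → ℂˣ, IsPlot z ∧ ∀ v, q' (k v) = z v • q (k v) := by
  obtain ⟨U, hU, hu, s, t, hs, ht, hπs, hts, -⟩ := 𝓟.locally_trivial (𝓟.proj (q u))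
  obtain ⟨k, hk, hkU⟩ := exists_isLocalizer
    ((hB n _ (𝓟.proj_smooth n q hq)).continuousAt.eventually (hU.mem_nhds hu))
  have hkU' : ∀ v, 𝓟.proj (q' (k v)) ∈ U := fun v => h (k v) ▸ hkU v
  have h1 : IsPlot fun v => t ⟨q (k v), hkU v⟩ :=
    ht n (fun v => ⟨q (k v), hkU v⟩) (isPlot_reparam hq hk.contDiff)
  have h2 : IsPlot fun v => t ⟨q' (k v), hkU' v⟩ :=
    ht n (fun v => ⟨q' (k v), hkU' v⟩) (isPlot_reparam hq' hk.contDiff)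
  -- The factor is the quotient of the two fibre coordinates in a common trivialization.
  refine ⟨k, hk, _, isPlot_units_mul h2 (isPlot_units_inv h1), fun v => ?_⟩
  have e1 := hts ⟨q (k v), hkU v⟩
  have e2 := hts ⟨q' (k v), hkU' v⟩
  have e3 : (⟨𝓟.proj (q' (k v)), hkU' v⟩ : {c // c ∈ U}) = ⟨𝓟.proj (q (k v)), hkU v⟩ :=
    Subtype.ext (h (k v)).symm
  rw [e3] at e2
  have e4 : s ⟨𝓟.proj (q (k v)), hkU v⟩ = (t ⟨q (k v), hkU v⟩)⁻¹ • q (k v) :=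
    eq_inv_smul_iff.2 e1
  rw [mul_smul, ← e4, e2]

/-- The connection is `∑ ρ_b t_b^*(z⁻¹ dz)`. Each fibre coordinate satisfies `t_b(z • u) = z
t_b(u)`, so each summand is the flat connection of a trivialization; the weights come from the base
and sum to one, so the defining equation survives averaging. -/
theorem exists_connection (hB : HasContinuousPlots B) (hpu : SupportsPartitionsOfUnity B) :
    ∃ A : DForm P 1, A.pullback (fun w : ℂˣ × P => w.1 • w.2) 𝓟.smul_smooth =
      DForm.maurerCartan.pullback Prod.fst dSmooth_fst + A.pullback Prod.snd dSmooth_snd := by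
  choose U hU hmem s t hs ht hπs hts hst using 𝓟.locally_trivial
  classical
  let T : B → P → ℂˣ := fun b u => if h : 𝓟.proj u ∈ U b then t b ⟨u, h⟩ else 1
  have hT : ∀ b (u : {u : P // 𝓟.proj u ∈ U b}), T b u.1 = t b u := fun b u => dif_pos u.2
  have hTsmul : ∀ b (z : ℂˣ) (u : P), 𝓟.proj u ∈ U b → T b (z • u) = z * T b u := by
    intro b z u hu
    have hu' : 𝓟.proj (z • u) ∈ U b := by rwa [𝓟.proj_smul]
    have e1 := hts b ⟨u, hu⟩
    have e2 := hT b ⟨u, hu⟩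
    rw [hT b ⟨z • u, hu'⟩, e2]
    have e3 : z • u = (z * t b ⟨u, hu⟩) • s b ⟨𝓟.proj u, hu⟩ := by rw [mul_smul, e1]
    have e4 := hst b ⟨𝓟.proj u, hu⟩ (z * t b ⟨u, hu⟩) (by rw [← e3]; exact hu')
    rw [← e4]
    congr 1
    exact Subtype.ext e3
  obtain ⟨ρ, hρ, hρU⟩ := exists_isAveraging hB hpu 𝓟.proj_smooth hU hmem ht hT
  refine ⟨hρ.avg DForm.maurerCartan, DForm.ext_ev fun n p hp => funext fun u => ?_⟩
  obtain ⟨S, hS⟩ := hρ.exists_finset (p u).2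
  have hz : IsPlot fun v => (p v).1 := hp.1
  have hq : IsPlot fun v => (p v).2 := hp.2
  have hzq := 𝓟.isPlot_smul hz hq
  rw [DForm.ev_add, DForm.ev_pullback _ _ hp, DForm.ev_pullback _ _ hp, DForm.ev_pullback _ _ hp,
    Pi.add_apply]
  have e1 : Prod.snd ∘ p = fun v => (p v).2 := rfl
  have e2 : (fun w : ℂˣ × P => w.1 • w.2) ∘ p = fun v => (p v).1 • (p v).2 := rfl
  have e3 : Prod.fst ∘ p = fun v => (p v).1 := rfl
  rw [e1, e2, e3, hρ.avg_ev _ hzq u (s := S) (by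
    intro i hi
    simpa only [Function.comp_apply, 𝓟.proj_smul] using hS i hi), hρ.avg_ev _ hq u hS]
  have h1 : DForm.maurerCartan.ev (fun v => (p v).1) u =
      ∑ i ∈ S, (ρ i ∘ 𝓟.proj) (p u).2 • DForm.maurerCartan.ev (fun v => (p v).1) u := by
    rw [← Finset.sum_smul, hρ.sum_eq hS, one_smul]
  rw [h1, ← Finset.sum_add_distrib]
  refine Finset.sum_congr rfl fun i _ => ?_
  simp only [Function.comp_apply, 𝓟.proj_smul]
  by_cases hi : ρ i (𝓟.proj (p u).2) = 0
  · simp only [hi, IsAveraging.zero_smul_alternating, add_zero]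
  · refine Eq.trans ?_ (smul_add _ _ _)
    congr 1
    rw [← DForm.maurerCartan_ev_mul_at (hz.isPlotAt u) (hρ.isPlotAt_of_ne_zero hq hi)]
    -- Equivariance of `T i` is only known over `U i`; this suffices because a nonzero weight puts
    -- the point in that open set and `ev` depends only on the germ.
    refine DForm.ev_congr _ ?_
    filter_upwards [(hB n _ (𝓟.proj_smooth n _ hq)).continuousAt.eventually
      ((hU i).mem_nhds (hρU i _ hi))] with v hv
    exact hTsmul i _ _ hv

end PrincipalBundle

/-! ## Bundle gerbes -/

theorem FiberPower.ext_two {X M : Type*} {π : X → M} {x y : FiberPower π 2}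
    (h0 : x.1 0 = y.1 0) (h1 : x.1 1 = y.1 1) : x = y :=
  Subtype.ext (funext (Fin.forall_fin_two.2 ⟨h0, h1⟩))

theorem FiberPower.ext_three {X M : Type*} {π : X → M} {x y : FiberPower π 3}
    (h0 : x.1 0 = y.1 0) (h1 : x.1 1 = y.1 1) (h2 : x.1 2 = y.1 2) : x = y :=
  Subtype.ext (funext fun i => by fin_cases i <;> assumption)

namespace BundleGerbe

variable {B Y Q : Type*} [TopologicalSpace B] [DiffeologicalSpace B]
  [TopologicalSpace Y] [DiffeologicalSpace Y] [DiffeologicalSpace Q] [MulAction ℂˣ Q]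
  (G : BundleGerbe B Y Q) {n : ℕ} {A : DForm Q 1}

theorem proj_eq {u v : Q} (hs : G.src u = G.src v) (ht : G.tgt u = G.tgt v) :
    G.bundle.proj u = G.bundle.proj v :=
  FiberPower.ext_two hs ht

theorem src_smul (z : ℂˣ) (u : Q) : G.src (z • u) = G.src u := by
  simp only [PreBundleGerbe.src, G.bundle.proj_smul]

theorem tgt_smul (z : ℂˣ) (u : Q) : G.tgt (z • u) = G.tgt u := by
  simp only [PreBundleGerbe.tgt, G.bundle.proj_smul]

theorem base_src (u : Q) : G.base.toFun (G.src u) = G.base.toFun (G.tgt u) :=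
  (G.bundle.proj u).2 0 1

theorem isPlot_src {q : Euc n → Q} (hq : IsPlot q) : IsPlot fun v => G.src (q v) :=
  G.bundle.proj_smooth n q hq 0

theorem isPlot_tgt {q : Euc n → Q} (hq : IsPlot q) : IsPlot fun v => G.tgt (q v) :=
  G.bundle.proj_smooth n q hq 1

theorem isPlot_mul {p q : Euc n → Q} (hp : IsPlot p) (hq : IsPlot q)
    (h : ∀ v, G.src (p v) = G.tgt (q v)) : IsPlot fun v => G.mul (p v) (q v) :=
  G.mul_smooth n (fun v => ⟨(p v, q v), h v⟩) ⟨hp, hq⟩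

/-- Families of pairs of plots of `Y` over the same plots of `B` lift to `Q`. -/
theorem exists_lifts (hY : HasContinuousPlots Y) {r : ℕ} {y y' : Fin r → Euc n → Y}
    (hy : ∀ i, IsPlot (y i)) (hy' : ∀ i, IsPlot (y' i))
    (h : ∀ i v, G.base.toFun (y i v) = G.base.toFun (y' i v)) (u : Euc n) :
    ∃ k, IsLocalizer k u ∧ ∃ q : Fin r → Euc n → Q, (∀ i, IsPlot (q i)) ∧
      (∀ i v, G.src (q i v) = y i (k v)) ∧ ∀ i v, G.tgt (q i v) = y' i (k v) := by
  let p : Fin r → Euc n → FiberPower G.base.toFun 2 := fun i v => ⟨![y i v, y' i v], by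
    intro j l
    fin_cases j <;> fin_cases l <;> simp [h]⟩
  have hp : ∀ i, IsPlot (p i) := fun i j => by
    fin_cases j
    · exact hy i
    · exact hy' i
  obtain ⟨k, hk, q, hq, hqp⟩ :=
    (G.bundle.isSubduction (hY.fiberPower _ 2)).exists_lifts hp u
  refine ⟨k, hk, q, hq, fun i v => ?_, fun i v => ?_⟩
  · rw [PreBundleGerbe.src, hqp]; rfl
  · rw [PreBundleGerbe.tgt, hqp]; rfl

/-- The projection of composable pairs to `Y^[3]`. -/
def tripleProj (w : {w : Q × Q // G.src w.1 = G.tgt w.2}) : FiberPower G.base.toFun 3 :=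
  ⟨![G.src w.1.2, G.tgt w.1.2, G.tgt w.1.1], by
    have h1 := G.base_src w.1.2
    have h2 := G.base_src w.1.1
    rw [w.2] at h2
    intro i j
    fin_cases i <;> fin_cases j <;> simp [h1, h2]⟩

theorem face_tripleProj_zero (w : {w : Q × Q // G.src w.1 = G.tgt w.2}) :
    FiberPower.face _ 2 0 (G.tripleProj w) = G.bundle.proj w.1.1 :=
  FiberPower.ext_two w.2.symm rfl

theorem face_tripleProj_one (w : {w : Q × Q // G.src w.1 = G.tgt w.2}) :
    FiberPower.face _ 2 1 (G.tripleProj w) = G.bundle.proj (G.mul w.1.1 w.1.2) :=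
  FiberPower.ext_two (G.src_mul _ _ w.2).symm (G.tgt_mul _ _ w.2).symm

theorem face_tripleProj_two (w : {w : Q × Q // G.src w.1 = G.tgt w.2}) :
    FiberPower.face _ 2 2 (G.tripleProj w) = G.bundle.proj w.1.2 :=
  FiberPower.ext_two rfl rfl

theorem isSubduction_tripleProj (hY : HasContinuousPlots Y) : IsSubduction G.tripleProj where
  smooth n p hp i := by
    fin_cases i
    · exact G.isPlot_src hp.2
    · exact G.isPlot_tgt hp.2
    · exact G.isPlot_tgt hp.1
  exists_lift n p hp u := by
    obtain ⟨k, hk, q, hq, hs, ht⟩ := G.exists_lifts hY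
      (y := ![fun v => (p v).1 0, fun v => (p v).1 1])
      (y' := ![fun v => (p v).1 1, fun v => (p v).1 2])
      (Fin.forall_fin_two.2 ⟨hp 0, hp 1⟩) (Fin.forall_fin_two.2 ⟨hp 1, hp 2⟩)
      (Fin.forall_fin_two.2 ⟨fun v => (p v).2 0 1, fun v => (p v).2 1 2⟩) u
    have hc : ∀ v, G.src (q 1 v) = G.tgt (q 0 v) := fun v => (hs 1 v).trans (ht 0 v).symm
    exact ⟨k, hk, fun v => ⟨(q 1 v, q 0 v), hc v⟩, ⟨hq 1, hq 0⟩,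
      funext fun v => FiberPower.ext_three (hs 0 v) (ht 0 v) (ht 1 v)⟩

/-! ### Connections and curvings evaluated on plots -/

section Connection

variable {G}

theorem IsConnection.ev_smul (hA : G.IsConnection A) {z : Euc n → ℂˣ} {q : Euc n → Q}
    (hz : IsPlot z) (hq : IsPlot q) :
    A.ev (fun v => z v • q v) = DForm.maurerCartan.ev z + A.ev q := by
  have hp : IsPlot fun v => (z v, q v) := ⟨hz, hq⟩
  have h := congrArg (fun η => DForm.ev η fun v => (z v, q v)) hA
  simp only [DForm.ev_add] at h
  rwa [DForm.ev_pullback _ _ hp, DForm.ev_pullback _ _ hp, DForm.ev_pullback _ _ hp] at h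

/-- The extra term `z⁻¹ dz` is closed. Hence `d A` does not see the choice of lift, which is why the
curvature descends. -/
theorem IsConnection.ev_d_smul (hA : G.IsConnection A) {z : Euc n → ℂˣ} {q : Euc n → Q}
    (hz : IsPlot z) (hq : IsPlot q) : A.d.ev (fun v => z v • q v) = A.d.ev q := by
  have hp : IsPlot fun v => (z v, q v) := ⟨hz, hq⟩
  have h := congrArg (fun η => DForm.ev (DForm.d η) fun v => (z v, q v)) hA
  simp only [DForm.d_add, DForm.d_pullback, DForm.d_maurerCartan, DForm.ev_add] at h
  rwa [DForm.ev_pullback _ _ hp, DForm.ev_pullback _ _ hp, DForm.ev_pullback _ _ hp,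
    DForm.ev_zero, zero_add] at h

theorem IsGerbeConnection.ev_mul (hA : G.IsGerbeConnection A) {p q : Euc n → Q} (hp : IsPlot p)
    (hq : IsPlot q) (h : ∀ v, G.src (p v) = G.tgt (q v)) :
    A.ev (fun v => G.mul (p v) (q v)) = A.ev p + A.ev q := by
  let w : Euc n → {w : Q × Q // G.src w.1 = G.tgt w.2} := fun v => ⟨(p v, q v), h v⟩
  have hw : IsPlot w := ⟨hp, hq⟩
  have h := congrArg (fun η => DForm.ev η w) hA.2
  simp only [DForm.ev_add] at h
  rwa [DForm.ev_pullback _ _ hw, DForm.ev_pullback _ _ hw, DForm.ev_pullback _ _ hw] at h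

theorem IsGerbeConnection.ev_d_mul (hA : G.IsGerbeConnection A) {p q : Euc n → Q} (hp : IsPlot p)
    (hq : IsPlot q) (h : ∀ v, G.src (p v) = G.tgt (q v)) :
    A.d.ev (fun v => G.mul (p v) (q v)) = A.d.ev p + A.d.ev q := by
  let w : Euc n → {w : Q × Q // G.src w.1 = G.tgt w.2} := fun v => ⟨(p v, q v), h v⟩
  have hw : IsPlot w := ⟨hp, hq⟩
  have h := congrArg (fun η => DForm.ev (DForm.d η) w) hA.2
  simp only [DForm.d_add, DForm.d_pullback, DForm.ev_add] at h
  rwa [DForm.ev_pullback _ _ hw, DForm.ev_pullback _ _ hw, DForm.ev_pullback _ _ hw] at h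

theorem IsCurving.ev_d {f : DForm Y 2} (hf : G.IsCurving A f) {q : Euc n → Q} (hq : IsPlot q) :
    A.d.ev q = f.ev (fun v => G.src (q v)) - f.ev (fun v => G.tgt (q v)) := by
  have h := congrArg (fun η => DForm.ev η q) hf
  rw [DForm.ev_pullback _ _ hq, FiberPower.deltaOne_ev _ _ (G.bundle.proj_smooth n q hq)] at h
  exact h.symm

end Connection

/-- Start from any connection and let `Θ` be its failure to respect the product. `Θ` descends to a
one-form `Ψ` on `Y^[3]`, associativity gives `δΨ = 0`, and subtracting a primitive `ζ` of `Ψ`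
repairs the connection. -/
theorem exists_isGerbeConnection (hB : HasContinuousPlots B) (hY : HasContinuousPlots Y)
    (hpB : SupportsPartitionsOfUnity B)
    (hpY : SupportsPartitionsOfUnity (FiberPower G.base.toFun 2)) :
    ∃ A : DForm Q 1, G.IsGerbeConnection A := by
  have hY2 := hY.fiberPower G.base.toFun 2
  obtain ⟨A, hA⟩ : ∃ A : DForm Q 1, G.IsConnection A := G.bundle.exists_connection hY2 hpY
  let T := {w : Q × Q // G.src w.1 = G.tgt w.2}
  have hfst : DSmooth fun w : T => w.1.1 := dSmooth_fst.comp (dSmooth_val _)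
  have hsnd : DSmooth fun w : T => w.1.2 := dSmooth_snd.comp (dSmooth_val _)
  let Θ : DForm T 1 := A.pullback _ G.mul_smooth - A.pullback _ hfst - A.pullback _ hsnd
  have hΘ : ∀ {n : ℕ} {w : Euc n → T}, IsPlot w → Θ.ev w =
      A.ev (fun v => G.mul (w v).1.1 (w v).1.2) - A.ev (fun v => (w v).1.1)
        - A.ev (fun v => (w v).1.2) := by
    intro n w hw
    rw [DForm.ev_sub, DForm.ev_sub, DForm.ev_pullback _ _ hw, DForm.ev_pullback _ _ hw,
      DForm.ev_pullback _ _ hw]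
    rfl
  have hsub := G.isSubduction_tripleProj hY
  -- Scaling the two factors by `z` and `z'` scales the product by `z z'`, so the contributions of
  -- the invariant form cancel in `Θ`.
  obtain ⟨Ψ, hΨ⟩ := hsub.exists_pullback_eq Θ fun n w w' hw hw' he => by
    refine DForm.ev_eq_ev_of_local _ _ fun u => ?_
    have e0 : ∀ v, G.bundle.proj (w v).1.1 = G.bundle.proj (w' v).1.1 := fun v => by
      rw [← face_tripleProj_zero, ← face_tripleProj_zero]
      exact congrArg _ (congrFun he v)
    have e2 : ∀ v, G.bundle.proj (w v).1.2 = G.bundle.proj (w' v).1.2 := fun v => by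
      rw [← face_tripleProj_two, ← face_tripleProj_two]
      exact congrArg _ (congrFun he v)
    obtain ⟨h, hh, z, hz, hzw⟩ := G.bundle.exists_smul_eq hY2 hw.1 hw'.1 e0 u
    obtain ⟨h', hh', z', hz', hzw'⟩ := G.bundle.exists_smul_eq hY2
      (isPlot_reparam hw.2 hh.contDiff) (isPlot_reparam hw'.2 hh.contDiff) (fun v => e2 (h v)) u
    have hk := hh.comp hh'
    refine ⟨h ∘ h', hk, ?_⟩
    have hwk := isPlot_reparam hw hk.contDiff
    rw [hΘ hwk, hΘ (isPlot_reparam hw' hk.contDiff)]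
    have hz1 := isPlot_reparam hz hh'.contDiff
    have r1 : (fun v => ((w' ∘ h ∘ h') v).1.1) = fun v => (z ∘ h') v • ((w ∘ h ∘ h') v).1.1 :=
      funext fun v => hzw (h' v)
    have r2 : (fun v => ((w' ∘ h ∘ h') v).1.2) = fun v => z' v • ((w ∘ h ∘ h') v).1.2 :=
      funext fun v => hzw' v
    have r3 : (fun v => G.mul ((w' ∘ h ∘ h') v).1.1 ((w' ∘ h ∘ h') v).1.2) =
        fun v => (z ∘ h') v • z' v • G.mul ((w ∘ h ∘ h') v).1.1 ((w ∘ h ∘ h') v).1.2 := by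
      funext v
      have := ((w ∘ h ∘ h') v).2
      rw [congrFun r1 v, congrFun r2 v, G.smul_mul, G.mul_smul _ _ _ this]
      rw [this, G.tgt_smul]
    have hm := G.isPlot_mul hwk.1 hwk.2 fun v => ((w ∘ h ∘ h') v).2
    rw [r1, r2, r3, hA.ev_smul hz1 hwk.1, hA.ev_smul hz' hwk.2,
      hA.ev_smul hz1 (G.bundle.isPlot_smul hz' hm), hA.ev_smul hz' hm]
    abel
  have hΨ' : ∀ {n : ℕ} {p q : Euc n → Q} (hp : IsPlot p) (hq : IsPlot q)
      (h : ∀ v, G.src (p v) = G.tgt (q v)), Ψ.ev (fun v => G.tripleProj ⟨(p v, q v), h v⟩) =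
        A.ev (fun v => G.mul (p v) (q v)) - A.ev p - A.ev q := by
    intro n p q hp hq h
    have hw : IsPlot fun v => (⟨(p v, q v), h v⟩ : T) := ⟨hp, hq⟩
    rw [← hΘ hw, ← hΨ, DForm.ev_pullback _ _ hw]
    rfl
  obtain ⟨ρ, s, hρ, hs⟩ := G.base.exists_isAveraging hB hpB
  -- Over a point of `Y^[4]`, choose elements of `Q` over consecutive pairs. The four faces are then
  -- four composable pairs, and `δΨ` reduces to the difference of `A` on the two bracketings of the
  -- triple product.
  obtain ⟨ζ, hζ⟩ := FiberPower.exists_delta_eq G.base.smooth hρ hs Ψ (by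
    refine DForm.ext_ev fun n p hp => DForm.ev_eq_ev_of_local _ _ fun u => ?_
    obtain ⟨k, hk, q, hq, hsq, htq⟩ := G.exists_lifts hY
      (y := fun i : Fin 3 => fun v => (p v).1 i.castSucc)
      (y' := fun i : Fin 3 => fun v => (p v).1 i.succ)
      (fun i => hp i.castSucc) (fun i => hp i.succ) (fun i v => (p v).2 _ _) u
    have c10 : ∀ v, G.src (q 1 v) = G.tgt (q 0 v) := fun v => (hsq 1 v).trans (htq 0 v).symm
    have c21 : ∀ v, G.src (q 2 v) = G.tgt (q 1 v) := fun v => (hsq 2 v).trans (htq 1 v).symm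
    have hm10 := G.isPlot_mul (hq 1) (hq 0) c10
    have hm21 := G.isPlot_mul (hq 2) (hq 1) c21
    have c210 : ∀ v, G.src (q 2 v) = G.tgt (G.mul (q 1 v) (q 0 v)) := fun v => by
      rw [c21, G.tgt_mul _ _ (c10 v)]
    have c210' : ∀ v, G.src (G.mul (q 2 v) (q 1 v)) = G.tgt (q 0 v) := fun v => by
      rw [← c10, G.src_mul _ _ (c21 v)]
    refine ⟨k, hk, ?_⟩
    rw [DForm.ev_zero, FiberPower.delta_ev_four _ _ (isPlot_reparam hp hk.contDiff)]
    have f0 : FiberPower.face _ 3 0 ∘ p ∘ k = fun v => G.tripleProj ⟨(q 2 v, q 1 v), c21 v⟩ :=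
      funext fun v => FiberPower.ext_three (hsq 1 v).symm (htq 1 v).symm (htq 2 v).symm
    have f1 : FiberPower.face _ 3 1 ∘ p ∘ k =
        fun v => G.tripleProj ⟨(q 2 v, G.mul (q 1 v) (q 0 v)), c210 v⟩ :=
      funext fun v => FiberPower.ext_three ((G.src_mul _ _ (c10 v)).trans (hsq 0 v)).symm
        ((G.tgt_mul _ _ (c10 v)).trans (htq 1 v)).symm (htq 2 v).symm
    have f2 : FiberPower.face _ 3 2 ∘ p ∘ k =
        fun v => G.tripleProj ⟨(G.mul (q 2 v) (q 1 v), q 0 v), c210' v⟩ :=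
      funext fun v => FiberPower.ext_three (hsq 0 v).symm (htq 0 v).symm
        ((G.tgt_mul _ _ (c21 v)).trans (htq 2 v)).symm
    have f3 : FiberPower.face _ 3 3 ∘ p ∘ k = fun v => G.tripleProj ⟨(q 1 v, q 0 v), c10 v⟩ :=
      funext fun v => FiberPower.ext_three (hsq 0 v).symm (htq 0 v).symm (htq 1 v).symm
    have ha : (fun v => G.mul (G.mul (q 2 v) (q 1 v)) (q 0 v)) =
        fun v => G.mul (q 2 v) (G.mul (q 1 v) (q 0 v)) :=
      funext fun v => G.mul_assoc _ _ _ (c21 v) (c10 v)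
    rw [f0, f1, f2, f3, hΨ' (hq 2) (hq 1) c21, hΨ' (hq 2) hm10 c210, hΨ' hm21 (hq 0) c210',
      hΨ' (hq 1) (hq 0) c10, ha]
    abel)
  -- A form pulled back from the base is unchanged by the action of `ℂˣ`, so the correction leaves a
  -- connection.
  refine ⟨A - ζ.pullback _ G.bundle.proj_smooth, ?_, ?_⟩
  · refine DForm.ext_ev fun n p hp => ?_
    have hzq : IsPlot fun v => (p v).1 • (p v).2 := G.bundle.smul_smooth n p hp
    have h1 := hA.ev_smul hp.1 hp.2
    have e1 : Prod.snd ∘ p = fun v => (p v).2 := rfl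
    have e2 : (fun w : ℂˣ × Q => w.1 • w.2) ∘ p = fun v => (p v).1 • (p v).2 := rfl
    have e3 : Prod.fst ∘ p = fun v => (p v).1 := rfl
    have e4 : G.bundle.proj ∘ (fun v => (p v).1 • (p v).2) = G.bundle.proj ∘ fun v => (p v).2 :=
      funext fun v => G.bundle.proj_smul _ _
    rw [DForm.ev_add, DForm.ev_pullback _ _ hp, DForm.ev_pullback _ _ hp,
      DForm.ev_pullback _ _ hp, e1, e2, e3, DForm.ev_sub, DForm.ev_sub,
      DForm.ev_pullback _ _ hp.2, DForm.ev_pullback _ _ hzq, h1, e4]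
    abel
  · refine DForm.ext_ev fun n w hw => ?_
    have hm : IsPlot fun v => G.mul (w v).1.1 (w v).1.2 := G.mul_smooth n w hw
    have hw1 : IsPlot fun v => (w v).1.1 := hw.1
    have hw2 : IsPlot fun v => (w v).1.2 := hw.2
    have h1 := hΨ' hw1 hw2 fun v => (w v).2
    have hw3 : IsPlot fun v => G.tripleProj (w v) := hsub.smooth n w hw
    have h2 := FiberPower.delta_ev_three _ ζ hw3
    have f0 : FiberPower.face _ 2 0 ∘ (fun v => G.tripleProj (w v)) =
      G.bundle.proj ∘ fun v => (w v).1.1 := funext fun v => G.face_tripleProj_zero (w v)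
    have f1 : FiberPower.face _ 2 1 ∘ (fun v => G.tripleProj (w v)) =
      G.bundle.proj ∘ fun v => G.mul (w v).1.1 (w v).1.2 :=
        funext fun v => G.face_tripleProj_one (w v)
    have f2 : FiberPower.face _ 2 2 ∘ (fun v => G.tripleProj (w v)) =
      G.bundle.proj ∘ fun v => (w v).1.2 := funext fun v => G.face_tripleProj_two (w v)
    rw [hζ, f0, f1, f2] at h2
    have e1 : (fun w : T => w.1.1) ∘ w = fun v => (w v).1.1 := rfl
    have e2 : (fun w : T => w.1.2) ∘ w = fun v => (w v).1.2 := rfl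
    have e3 : (fun w : T => G.mul w.1.1 w.1.2) ∘ w = fun v => G.mul (w v).1.1 (w v).1.2 := rfl
    have h3 := h2.symm.trans h1
    rw [DForm.ev_add, DForm.ev_pullback _ _ hw, DForm.ev_pullback _ _ hw,
      DForm.ev_pullback _ _ hw, e1, e2, e3, DForm.ev_sub, DForm.ev_sub, DForm.ev_sub,
      DForm.ev_pullback _ _ hw1, DForm.ev_pullback _ _ hw2, DForm.ev_pullback _ _ hm]
    generalize A.ev (fun v => G.mul (w v).1.1 (w v).1.2) = a at *
    rw [eq_sub_iff_add_eq, eq_sub_iff_add_eq] at h3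
    rw [← h3]
    abel

variable {G}

/-- The form `d A` descends to the curvature on `Y^[2]`. Compatibility of `A` with the product says
exactly that the curvature is `δ`-closed, and a primitive of it is a curving. -/
theorem IsGerbeConnection.exists_isCurving (hA : G.IsGerbeConnection A)
    (hB : HasContinuousPlots B) (hY : HasContinuousPlots Y) (hpB : SupportsPartitionsOfUnity B) :
    ∃ f : DForm Y 2, G.IsCurving A f := by
  have hY2 := hY.fiberPower G.base.toFun 2
  have hsub := G.bundle.isSubduction hY2
  obtain ⟨F, hF⟩ := hsub.exists_pullback_eq A.d fun n q q' hq hq' he => by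
    refine DForm.ev_eq_ev_of_local _ _ fun u => ?_
    obtain ⟨h, hh, z, hz, hzq⟩ := G.bundle.exists_smul_eq hY2 hq hq' (congrFun he) u
    refine ⟨h, hh, ?_⟩
    have e : q' ∘ h = fun v => z v • (q ∘ h) v := funext hzq
    rw [e, hA.1.ev_d_smul hz (isPlot_reparam hq hh.contDiff)]
  obtain ⟨ρ, s, hρ, hs⟩ := G.base.exists_isAveraging hB hpB
  obtain ⟨f, hf⟩ := FiberPower.exists_deltaOne_eq G.base.smooth hρ hs F (by
    refine (G.isSubduction_tripleProj hY).ext fun n w hw => ?_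
    have f0 : FiberPower.face _ 2 0 ∘ G.tripleProj ∘ w =
      G.bundle.proj ∘ fun v => (w v).1.1 := funext fun v => G.face_tripleProj_zero (w v)
    have f1 : FiberPower.face _ 2 1 ∘ G.tripleProj ∘ w =
      G.bundle.proj ∘ fun v => G.mul (w v).1.1 (w v).1.2 :=
        funext fun v => G.face_tripleProj_one (w v)
    have f2 : FiberPower.face _ 2 2 ∘ G.tripleProj ∘ w =
      G.bundle.proj ∘ fun v => (w v).1.2 := funext fun v => G.face_tripleProj_two (w v)
    have hm : IsPlot fun v => G.mul (w v).1.1 (w v).1.2 := G.mul_smooth n w hw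
    rw [FiberPower.delta_ev_three _ _ ((G.isSubduction_tripleProj hY).smooth n w hw), f0, f1, f2,
      ← DForm.ev_pullback G.bundle.proj_smooth _ hw.1,
      ← DForm.ev_pullback G.bundle.proj_smooth _ hw.2,
      ← DForm.ev_pullback G.bundle.proj_smooth _ hm, hF,
      hA.ev_d_mul hw.1 hw.2 fun v => (w v).2, DForm.ev_zero]
    abel)
  exact ⟨f, by rw [IsCurving, hf]; exact hF⟩

/-- Two lifts of a plot of `B` to `Y` are joined locally by a plot of `Q`. Pulled back to `Q`,
`δ(df) = d(δf)` becomes `ddA = 0`, so `df` agrees on the two lifts. -/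
theorem IsCurving.exists_isThreeCurvature {f : DForm Y 2} (hf : G.IsCurving A f)
    (hB : HasContinuousPlots B) (hY : HasContinuousPlots Y) :
    ∃ w : DForm B 3, G.IsThreeCurvature f w := by
  refine (G.base.isSubduction hB).exists_pullback_eq f.d fun n y y' hy hy' he => ?_
  refine DForm.ev_eq_ev_of_local _ _ fun u => ?_
  obtain ⟨k, hk, q, hq, hs, ht⟩ := G.exists_lifts hY (y := fun _ : Fin 1 => y)
    (y' := fun _ => y') (fun _ => hy) (fun _ => hy') (fun _ => congrFun he) u
  refine ⟨k, hk, ?_⟩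
  have h1 : (FiberPower.deltaOne G.base.toFun f.d).ev (G.bundle.proj ∘ q 0) = 0 := by
    have e1 : FiberPower.deltaOne G.base.toFun f.d = (FiberPower.deltaOne G.base.toFun f).d := by
      rw [FiberPower.deltaOne, FiberPower.deltaOne, FiberPower.d_delta, DForm.d_pullback]
    rw [e1, ← DForm.ev_pullback G.bundle.proj_smooth _ (hq 0), ← DForm.d_pullback, hf,
      DForm.d_d, DForm.ev_zero]
  rw [FiberPower.deltaOne_ev _ _ (G.bundle.proj_smooth n _ (hq 0)), sub_eq_zero] at h1
  have e1 : (fun v => ((G.bundle.proj ∘ q 0) v).1 0) = y ∘ k := funext (hs 0)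
  have e2 : (fun v => ((G.bundle.proj ∘ q 0) v).1 1) = y' ∘ k := funext (ht 0)
  rwa [e1, e2] at h1

/-- The identity section is smooth and flat. -/
theorem IsGerbeConnection.exists_isIdentity (hA : G.IsGerbeConnection A)
    (hY : HasContinuousPlots Y) {y : Euc n → Y} (hy : IsPlot y) (u : Euc n) :
    ∃ k, IsLocalizer k u ∧ ∃ e : Euc n → Q, IsPlot e ∧ (∀ v, G.IsIdentity (e v) (y (k v))) ∧
      A.ev e = 0 := by
  obtain ⟨k, hk, q', hq', hs', ht'⟩ := G.exists_lifts hY (y := fun _ : Fin 1 => y)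
    (y' := fun _ => y) (fun _ => hy) (fun _ => hy) (fun _ _ => rfl) u
  obtain ⟨q, rfl⟩ : ∃ q : Euc n → Q, q' = fun _ => q := ⟨q' 0, funext fun i => by
    rw [Subsingleton.elim i 0]⟩
  have hq := hq' 0
  have hs := hs' 0
  have ht := ht' 0
  have hc : ∀ v, G.src (q v) = G.tgt (q v) := fun v => (hs v).trans (ht v).symm
  -- For any `q` over `(y, y)` the square `q q` lies in the same fibre, so `q q = z • q`, and `z⁻¹ •
  -- q` is idempotent.
  obtain ⟨l, hl, z, hz, hzq⟩ := G.bundle.exists_smul_eq (hY.fiberPower _ 2) hq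
    (G.isPlot_mul hq hq hc) (fun v => G.proj_eq (G.src_mul _ _ (hc v)).symm
      (G.tgt_mul _ _ (hc v)).symm) u
  have hql : IsPlot fun v => q (l v) := isPlot_reparam hq hl.contDiff
  have he := G.bundle.isPlot_smul (isPlot_units_inv hz) hql
  have hid : ∀ v, G.IsIdentity ((z v)⁻¹ • q (l v)) (y (k (l v))) := fun v => by
    refine ⟨by rw [G.src_smul, hs], by rw [G.tgt_smul, ht], ?_⟩
    rw [G.smul_mul _ _ _ (by rw [G.tgt_smul, hc]), G.mul_smul _ _ _ (hc _), hzq, inv_smul_smul]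
  refine ⟨k ∘ l, hk.comp hl, _, he, hid, ?_⟩
  -- Idempotency gives `A(e) = A(e) + A(e)`, hence flatness.
  have h1 := hA.ev_mul he he fun v => (hid v).1.trans (hid v).2.1.symm
  have h2 : (fun v => G.mul ((z v)⁻¹ • q (l v)) ((z v)⁻¹ • q (l v))) =
    fun v => (z v)⁻¹ • q (l v) := funext fun v => (hid v).2.2
  rw [h2] at h1
  exact left_eq_add.1 h1

end BundleGerbe

/-! ## Bundle 2-gerbes -/

namespace PreBundleTwoGerbe

variable {M X Y Q : Type*} [TopologicalSpace M] [DiffeologicalSpace M]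
  [TopologicalSpace X] [DiffeologicalSpace X] [TopologicalSpace Y] [DiffeologicalSpace Y]
  [DiffeologicalSpace Q] [MulAction ℂˣ Q] (G : PreBundleTwoGerbe M X Y Q) {n : ℕ}

/-- The space `Y ∘ Y`. -/
abbrev CompPair : Type _ := {w : Y × Y // G.Comp w.1 w.2}

/-- The space `Q ∘ Q`. -/
abbrev HCompPair : Type _ := {w : Q × Q // G.HComp w.1 w.2}

/-- The space `Y ∘ Y ∘ Y`. -/
abbrev CompTriple : Type _ := {w : Y × Y × Y // G.Comp w.1 w.2.1 ∧ G.Comp w.2.1 w.2.2}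

/-- A map to `Y ∘ Y` with given components. -/
def mkPair {S : Type*} (y y' : S → Y) (h : ∀ v, G.Comp (y v) (y' v)) (v : S) : G.CompPair :=
  ⟨(y v, y' v), h v⟩

/-- A map to `Y ∘ Y ∘ Y` with given components. -/
def mkTriple {S : Type*} (y y' y'' : S → Y) (h : ∀ v, G.Comp (y v) (y' v))
    (h' : ∀ v, G.Comp (y' v) (y'' v)) (v : S) : G.CompTriple :=
  ⟨(y v, y' v, y'' v), h v, h' v⟩

variable {G}

theorem left_eq_of_base_eq {y y' : Y} (h : G.gerbe.base.toFun y = G.gerbe.base.toFun y') :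
    G.left y = G.left y' := by
  rw [left, h, left]

theorem right_eq_of_base_eq {y y' : Y} (h : G.gerbe.base.toFun y = G.gerbe.base.toFun y') :
    G.right y = G.right y' := by
  rw [right, h, right]

theorem base_eq {y y' : Y} (hl : G.left y = G.left y') (hr : G.right y = G.right y') :
    G.gerbe.base.toFun y = G.gerbe.base.toFun y' :=
  FiberPower.ext_two hl hr

theorem base_left (y : Y) : G.base.toFun (G.left y) = G.base.toFun (G.right y) :=
  (G.gerbe.base.toFun y).2 0 1

theorem left_tgt (u : Q) : G.left (G.gerbe.tgt u) = G.left (G.gerbe.src u) :=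
  left_eq_of_base_eq (G.gerbe.base_src u).symm

theorem right_tgt (u : Q) : G.right (G.gerbe.tgt u) = G.right (G.gerbe.src u) :=
  right_eq_of_base_eq (G.gerbe.base_src u).symm

theorem HComp.comp_tgt {u v : Q} (h : G.HComp u v) :
    G.Comp (G.gerbe.tgt u) (G.gerbe.tgt v) := by
  rw [Comp, left_tgt, right_tgt]
  exact h

variable (G)

theorem isPlot_left {y : Euc n → Y} (hy : IsPlot y) : IsPlot fun v => G.left (y v) :=
  G.gerbe.base.smooth n y hy 0

theorem isPlot_right {y : Euc n → Y} (hy : IsPlot y) : IsPlot fun v => G.right (y v) :=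
  G.gerbe.base.smooth n y hy 1

/-- The projection `Y ∘ Y → X^[3]`. -/
def toThree (w : G.CompPair) : FiberPower G.base.toFun 3 :=
  ⟨![G.left w.1.2, G.left w.1.1, G.right w.1.1], by
    have h1 := base_left (G := G) w.1.1
    have h2 := base_left (G := G) w.1.2
    have h3 : G.left w.1.1 = G.right w.1.2 := w.2
    rw [← h3] at h2
    intro i j
    fin_cases i <;> fin_cases j <;> simp [h1, h2]⟩

/-- The projection `Y ∘ Y ∘ Y → X^[4]`. -/
def toFour (w : G.CompTriple) : FiberPower G.base.toFun 4 :=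
  ⟨![G.left w.1.2.2, G.left w.1.2.1, G.left w.1.1, G.right w.1.1], by
    have h1 := base_left (G := G) w.1.1
    have h2 := base_left (G := G) w.1.2.1
    have h3 := base_left (G := G) w.1.2.2
    have h4 : G.left w.1.1 = G.right w.1.2.1 := w.2.1
    have h5 : G.left w.1.2.1 = G.right w.1.2.2 := w.2.2
    rw [← h4] at h2
    rw [← h5] at h3
    intro i j
    fin_cases i <;> fin_cases j <;> simp [h1, h2, h3]⟩

/-- A plot of `X^[r + 1]` lifts locally to a sequence of `r` composable plots of `Y`. -/
theorem exists_lifts (hX : HasContinuousPlots X) {r : ℕ}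
    {p : Euc n → FiberPower G.base.toFun (r + 1)} (hp : IsPlot p) (u : Euc n) :
    ∃ k, IsLocalizer k u ∧ ∃ y : Fin r → Euc n → Y, (∀ i, IsPlot (y i)) ∧
      (∀ i v, G.left (y i v) = (p (k v)).1 i.castSucc) ∧
      ∀ i v, G.right (y i v) = (p (k v)).1 i.succ := by
  let e : Fin r → Euc n → FiberPower G.base.toFun 2 := fun i v =>
    ⟨![(p v).1 i.castSucc, (p v).1 i.succ], by
      have h := (p v).2 i.castSucc i.succ
      intro j l
      fin_cases j <;> fin_cases l <;> simp [h]⟩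
  have he : ∀ i, IsPlot (e i) := fun i j => by
    fin_cases j
    · exact hp i.castSucc
    · exact hp i.succ
  obtain ⟨k, hk, y, hy, hye⟩ :=
    (G.gerbe.base.isSubduction (hX.fiberPower _ 2)).exists_lifts he u
  refine ⟨k, hk, y, hy, fun i v => ?_, fun i v => ?_⟩
  · rw [left, hye]; rfl
  · rw [right, hye]; rfl

theorem isSubduction_toThree (hX : HasContinuousPlots X) : IsSubduction G.toThree where
  smooth n p hp i := by
    fin_cases i
    · exact G.isPlot_left hp.2
    · exact G.isPlot_left hp.1
    · exact G.isPlot_right hp.1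
  exists_lift n p hp u := by
    obtain ⟨k, hk, y, hy, hl, hr⟩ := G.exists_lifts hX hp u
    exact ⟨k, hk, G.mkPair (y 1) (y 0) fun v => (hl 1 v).trans (hr 0 v).symm, ⟨hy 1, hy 0⟩,
      funext fun v => FiberPower.ext_three (hl 0 v) (hl 1 v) (hr 1 v)⟩

theorem isSubduction_toFour (hX : HasContinuousPlots X) : IsSubduction G.toFour where
  smooth n p hp i := by
    fin_cases i
    · exact G.isPlot_left hp.2.2
    · exact G.isPlot_left hp.2.1
    · exact G.isPlot_left hp.1
    · exact G.isPlot_right hp.1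
  exists_lift n p hp u := by
    obtain ⟨k, hk, y, hy, hl, hr⟩ := G.exists_lifts hX hp u
    refine ⟨k, hk, G.mkTriple (y 2) (y 1) (y 0) (fun v => (hl 2 v).trans (hr 1 v).symm)
      fun v => (hl 1 v).trans (hr 0 v).symm, ⟨hy 2, hy 1, hy 0⟩,
      funext fun v => Subtype.ext (funext fun i => ?_)⟩
    fin_cases i
    · exact hl 0 v
    · exact hl 1 v
    · exact hl 2 v
    · exact hr 2 v

end PreBundleTwoGerbe

/-! ### The horizontal product preserves the connection up to a one-form -/

namespace MultBundleGerbe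

open PreBundleTwoGerbe

variable {M X Y Q : Type*} [TopologicalSpace M] [DiffeologicalSpace M]
  [TopologicalSpace X] [DiffeologicalSpace X] [TopologicalSpace Y] [DiffeologicalSpace Y]
  [DiffeologicalSpace Q] [MulAction ℂˣ Q] (G : MultBundleGerbe M X Y Q) {n : ℕ} {A : DForm Q 1}

theorem isPlot_m {y y' : Euc n → Y} (hy : IsPlot y) (hy' : IsPlot y')
    (h : ∀ v, G.Comp (y v) (y' v)) : IsPlot fun v => G.m (y v) (y' v) :=
  G.m_smooth n (G.mkPair y y' h) ⟨hy, hy'⟩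

theorem isPlot_hm {p q : Euc n → Q} (hp : IsPlot p) (hq : IsPlot q)
    (h : ∀ v, G.HComp (p v) (q v)) : IsPlot fun v => G.hm (p v) (q v) :=
  G.hm_smooth n (fun v => ⟨(p v, q v), h v⟩) ⟨hp, hq⟩

theorem dSmooth_src_src :
    DSmooth fun w : G.HCompPair => (⟨(G.gerbe.src w.1.1, G.gerbe.src w.1.2), w.2⟩ : G.CompPair) :=
  fun _ _ hp => ⟨G.gerbe.isPlot_src hp.1, G.gerbe.isPlot_src hp.2⟩

theorem dSmooth_tgt_tgt :
    DSmooth fun w : G.HCompPair =>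
      (⟨(G.gerbe.tgt w.1.1, G.gerbe.tgt w.1.2), HComp.comp_tgt w.2⟩ : G.CompPair) :=
  fun _ _ hp => ⟨G.gerbe.isPlot_tgt hp.1, G.gerbe.isPlot_tgt hp.2⟩

theorem dSmooth_fst_hCompPair : DSmooth fun w : G.HCompPair => w.1.1 :=
  dSmooth_fst.comp (dSmooth_val _)

theorem dSmooth_snd_hCompPair : DSmooth fun w : G.HCompPair => w.1.2 :=
  dSmooth_snd.comp (dSmooth_val _)

/-- `hm` preserves the connection `A` up to the one-form `α` on `Y ∘ Y`. -/
def IsMultiplicative (A : DForm Q 1) (α : DForm G.CompPair 1) : Prop :=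
  A.pullback _ G.hm_smooth =
    A.pullback _ G.dSmooth_fst_hCompPair + A.pullback _ G.dSmooth_snd_hCompPair +
      (α.pullback _ G.dSmooth_src_src - α.pullback _ G.dSmooth_tgt_tgt)

section

variable {G} {α : DForm G.CompPair 1}

/-- The four endpoints are separate variables so that products such as `m y y'` can be supplied
where the source or target equals them only through a structure axiom. -/
theorem IsMultiplicative.ev_hm (hα : G.IsMultiplicative A α) {p q : Euc n → Q}
    {y y' z z' : Euc n → Y} (hp : IsPlot p) (hq : IsPlot q) (hyp : ∀ v, G.gerbe.src (p v) = y v)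
    (hyq : ∀ v, G.gerbe.src (q v) = y' v) (hzp : ∀ v, G.gerbe.tgt (p v) = z v)
    (hzq : ∀ v, G.gerbe.tgt (q v) = z' v) (h : ∀ v, G.Comp (y v) (y' v))
    (h' : ∀ v, G.Comp (z v) (z' v)) :
    A.ev (fun v => G.hm (p v) (q v)) =
      A.ev p + A.ev q + (α.ev (G.mkPair y y' h) - α.ev (G.mkPair z z' h')) := by
  obtain rfl : (fun v => G.gerbe.src (p v)) = y := funext hyp
  obtain rfl : (fun v => G.gerbe.src (q v)) = y' := funext hyq
  obtain rfl : (fun v => G.gerbe.tgt (p v)) = z := funext hzp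
  obtain rfl : (fun v => G.gerbe.tgt (q v)) = z' := funext hzq
  have hw : IsPlot fun v => (⟨(p v, q v), h v⟩ : G.HCompPair) := ⟨hp, hq⟩
  have h1 := congrArg (fun η => DForm.ev η fun v => (⟨(p v, q v), h v⟩ : G.HCompPair)) hα
  simp only [DForm.ev_add, DForm.ev_sub] at h1
  rwa [DForm.ev_pullback _ _ hw, DForm.ev_pullback _ _ hw, DForm.ev_pullback _ _ hw,
    DForm.ev_pullback _ _ hw, DForm.ev_pullback _ _ hw] at h1

theorem IsMultiplicative.ev_d_hm (hα : G.IsMultiplicative A α) {p q : Euc n → Q}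
    (hp : IsPlot p) (hq : IsPlot q) (h : ∀ v, G.HComp (p v) (q v)) :
    A.d.ev (fun v => G.hm (p v) (q v)) = A.d.ev p + A.d.ev q +
      (α.d.ev (G.mkPair (fun v => G.gerbe.src (p v)) (fun v => G.gerbe.src (q v)) h) -
        α.d.ev (G.mkPair (fun v => G.gerbe.tgt (p v)) (fun v => G.gerbe.tgt (q v))
          fun v => (h v).comp_tgt)) := by
  have hw : IsPlot fun v => (⟨(p v, q v), h v⟩ : G.HCompPair) := ⟨hp, hq⟩
  have h1 := congrArg (fun η => DForm.ev (DForm.d η)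
    fun v => (⟨(p v, q v), h v⟩ : G.HCompPair)) hα
  simp only [DForm.d_add, DForm.d_sub, DForm.d_pullback, DForm.ev_add, DForm.ev_sub] at h1
  rwa [DForm.ev_pullback _ _ hw, DForm.ev_pullback _ _ hw, DForm.ev_pullback _ _ hw,
    DForm.ev_pullback _ _ hw, DForm.ev_pullback _ _ hw] at h1

end

/-- The base of `Y ∘ Y`, the space of composable pairs in `X^[2]`. -/
abbrev CompBase : Type _ :=
  {w : FiberPower G.base.toFun 2 × FiberPower G.base.toFun 2 // w.1.1 0 = w.2.1 1}

/-- The projection of `Y ∘ Y` to composable pairs in `X^[2]`. -/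
def toCompBase (w : G.CompPair) : G.CompBase :=
  ⟨(G.gerbe.base.toFun w.1.1, G.gerbe.base.toFun w.1.2), w.2⟩

theorem dSmooth_toCompBase : DSmooth G.toCompBase := fun n _ hp =>
  ⟨G.gerbe.base.smooth n _ hp.1, G.gerbe.base.smooth n _ hp.2⟩

/-- The projection `Q ∘ Q → (Y ∘ Y)^[2]`. -/
def hProj (w : G.HCompPair) : FiberPower G.toCompBase 2 :=
  ⟨![⟨(G.gerbe.src w.1.1, G.gerbe.src w.1.2), w.2⟩,
    ⟨(G.gerbe.tgt w.1.1, G.gerbe.tgt w.1.2), HComp.comp_tgt w.2⟩], by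
    have h1 := G.gerbe.base_src w.1.1
    have h2 := G.gerbe.base_src w.1.2
    intro i j
    fin_cases i <;> fin_cases j <;> simp [h1, h2, toCompBase]⟩

theorem base_eq_of_toCompBase_eq {w w' : G.CompPair} (h : G.toCompBase w = G.toCompBase w') :
    G.gerbe.base.toFun w.1.1 = G.gerbe.base.toFun w'.1.1 ∧
      G.gerbe.base.toFun w.1.2 = G.gerbe.base.toFun w'.1.2 :=
  Prod.ext_iff.1 (congrArg Subtype.val h)

theorem isSubduction_hProj (hY : HasContinuousPlots Y) : IsSubduction G.hProj where
  smooth n p hp i := by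
    fin_cases i
    · exact G.dSmooth_src_src n p hp
    · exact G.dSmooth_tgt_tgt n p hp
  exists_lift n p hp u := by
    have hb := fun v => G.base_eq_of_toCompBase_eq ((p v).2 0 1)
    obtain ⟨k, hk, q, hq, hs, ht⟩ := G.gerbe.exists_lifts hY
      (y := ![fun v => ((p v).1 0).1.1, fun v => ((p v).1 0).1.2])
      (y' := ![fun v => ((p v).1 1).1.1, fun v => ((p v).1 1).1.2])
      (Fin.forall_fin_two.2 ⟨(hp 0).1, (hp 0).2⟩) (Fin.forall_fin_two.2 ⟨(hp 1).1, (hp 1).2⟩)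
      (Fin.forall_fin_two.2 ⟨fun v => (hb v).1, fun v => (hb v).2⟩) u
    have hc : ∀ v, G.HComp (q 0 v) (q 1 v) := fun v => by
      rw [HComp, hs, hs]
      exact ((p (k v)).1 0).2
    exact ⟨k, hk, fun v => ⟨(q 0 v, q 1 v), hc v⟩, ⟨hq 0, hq 1⟩, funext fun v =>
      FiberPower.ext_two (Subtype.ext (Prod.ext (hs 0 v) (hs 1 v)))
        (Subtype.ext (Prod.ext (ht 0 v) (ht 1 v)))⟩

variable {G}

/-- The failure of `hm` to preserve `A` descends to a one-form on `(Y ∘ Y)^[2]`, because `hm` is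
equivariant in both arguments. The interchange law `hm_mul` makes it closed on `(Y ∘ Y)^[3]`, and
exactness for the projection to composable pairs yields `α`. -/
theorem exists_isMultiplicative (hA : G.gerbe.IsGerbeConnection A) (hX : HasContinuousPlots X)
    (hY : HasContinuousPlots Y) (hpX : SupportsPartitionsOfUnity (FiberPower G.base.toFun 2)) :
    ∃ α, G.IsMultiplicative A α := by
  have hY2 := hY.fiberPower G.gerbe.base.toFun 2
  let Θ : DForm G.HCompPair 1 := A.pullback _ G.hm_smooth -
    A.pullback _ G.dSmooth_fst_hCompPair - A.pullback _ G.dSmooth_snd_hCompPair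
  have hΘ : ∀ {n : ℕ} {w : Euc n → G.HCompPair}, IsPlot w → Θ.ev w =
      A.ev (fun v => G.hm (w v).1.1 (w v).1.2) - A.ev (fun v => (w v).1.1)
        - A.ev (fun v => (w v).1.2) := by
    intro n w hw
    rw [DForm.ev_sub, DForm.ev_sub, DForm.ev_pullback _ _ hw, DForm.ev_pullback _ _ hw,
      DForm.ev_pullback _ _ hw]
    rfl
  have hsub := G.isSubduction_hProj hY
  obtain ⟨Ψ, hΨ⟩ := hsub.exists_pullback_eq Θ fun n w w' hw hw' he => by
    refine DForm.ev_eq_ev_of_local _ _ fun u => ?_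
    have es : ∀ v, G.gerbe.src (w v).1.1 = G.gerbe.src (w' v).1.1 ∧
        G.gerbe.src (w v).1.2 = G.gerbe.src (w' v).1.2 := fun v =>
      Prod.ext_iff.1 (congrArg (fun x : FiberPower G.toCompBase 2 => (x.1 0).1) (congrFun he v))
    have et : ∀ v, G.gerbe.tgt (w v).1.1 = G.gerbe.tgt (w' v).1.1 ∧
        G.gerbe.tgt (w v).1.2 = G.gerbe.tgt (w' v).1.2 := fun v =>
      Prod.ext_iff.1 (congrArg (fun x : FiberPower G.toCompBase 2 => (x.1 1).1) (congrFun he v))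
    obtain ⟨h, hh, z, hz, hzw⟩ := G.gerbe.bundle.exists_smul_eq hY2 hw.1 hw'.1
      (fun v => G.gerbe.proj_eq (es v).1 (et v).1) u
    obtain ⟨h', hh', z', hz', hzw'⟩ := G.gerbe.bundle.exists_smul_eq hY2
      (isPlot_reparam hw.2 hh.contDiff) (isPlot_reparam hw'.2 hh.contDiff)
      (fun v => G.gerbe.proj_eq (es (h v)).2 (et (h v)).2) u
    have hk := hh.comp hh'
    refine ⟨h ∘ h', hk, ?_⟩
    have hwk := isPlot_reparam hw hk.contDiff
    rw [hΘ hwk, hΘ (isPlot_reparam hw' hk.contDiff)]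
    have hz1 := isPlot_reparam hz hh'.contDiff
    have r1 : (fun v => ((w' ∘ h ∘ h') v).1.1) = fun v => (z ∘ h') v • ((w ∘ h ∘ h') v).1.1 :=
      funext fun v => hzw (h' v)
    have r2 : (fun v => ((w' ∘ h ∘ h') v).1.2) = fun v => z' v • ((w ∘ h ∘ h') v).1.2 :=
      funext fun v => hzw' v
    have r3 : (fun v => G.hm ((w' ∘ h ∘ h') v).1.1 ((w' ∘ h ∘ h') v).1.2) =
        fun v => (z ∘ h') v • z' v • G.hm ((w ∘ h ∘ h') v).1.1 ((w ∘ h ∘ h') v).1.2 := by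
      funext v
      have := ((w ∘ h ∘ h') v).2
      rw [congrFun r1 v, congrFun r2 v, G.smul_hm, G.hm_smul _ _ _ this]
      rw [HComp, G.gerbe.src_smul]
      exact this
    have hm := G.isPlot_hm hwk.1 hwk.2 fun v => ((w ∘ h ∘ h') v).2
    rw [r1, r2, r3, hA.1.ev_smul hz1 hwk.1, hA.1.ev_smul hz' hwk.2,
      hA.1.ev_smul hz1 (G.gerbe.bundle.isPlot_smul hz' hm), hA.1.ev_smul hz' hm]
    abel
  have hΨ' : ∀ {n : ℕ} {p q : Euc n → Q} (hp : IsPlot p) (hq : IsPlot q)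
      (h : ∀ v, G.HComp (p v) (q v)), Ψ.ev (fun v => G.hProj ⟨(p v, q v), h v⟩) =
        A.ev (fun v => G.hm (p v) (q v)) - A.ev p - A.ev q := by
    intro n p q hp hq h
    have hw : IsPlot fun v => (⟨(p v, q v), h v⟩ : G.HCompPair) := ⟨hp, hq⟩
    rw [← hΘ hw, ← hΨ, DForm.ev_pullback _ _ hw]
    rfl
  obtain ⟨ρ, s, hρ, hs⟩ := G.gerbe.base.exists_isAveraging (hX.fiberPower _ 2) hpX
  -- Composability is a condition on base points only, so independently chosen sections of `Y` over
  -- the two entries of a composable pair form a section of `Y ∘ Y`.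
  let S : FiberPower G.base.toFun 2 × FiberPower G.base.toFun 2 → G.CompBase → G.CompPair :=
    fun i b => ⟨(s i.1 b.1.1, s i.2 b.1.2), by
      rw [Comp, left, right, hs, hs]
      exact b.2⟩
  have hS : ∀ i b, G.toCompBase (S i b) = b := fun i b =>
    Subtype.ext (Prod.ext (hs _ _) (hs _ _))
  have hav : IsAveraging (fun i => (fun w => ρ i.1 w.1 * ρ i.2 w.2) ∘ Subtype.val) S :=
    ((hρ.prod hρ).comp (dSmooth_val _)).of_isPlotAt fun i n p hp u h => h
  obtain ⟨α, hα⟩ := FiberPower.exists_deltaOne_eq G.dSmooth_toCompBase hav hS Ψ (by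
    refine DForm.ext_ev fun n p hp => DForm.ev_eq_ev_of_local _ _ fun u => ?_
    have hb := fun (i j : Fin 3) v => G.base_eq_of_toCompBase_eq ((p v).2 i j)
    obtain ⟨k, hk, q, hq, hsq, htq⟩ := G.gerbe.exists_lifts hY
      (y := fun i : Fin 2 => fun v => ((p v).1 i.castSucc).1.1)
      (y' := fun i : Fin 2 => fun v => ((p v).1 i.succ).1.1)
      (fun i => (hp i.castSucc).1) (fun i => (hp i.succ).1) (fun i v => (hb _ _ v).1) u
    have hpk := isPlot_reparam hp hk.contDiff
    obtain ⟨k', hk', q', hq', hsq', htq'⟩ := G.gerbe.exists_lifts hY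
      (y := fun i : Fin 2 => fun v => ((p (k v)).1 i.castSucc).1.2)
      (y' := fun i : Fin 2 => fun v => ((p (k v)).1 i.succ).1.2)
      (fun i => (hpk i.castSucc).2) (fun i => (hpk i.succ).2)
      (fun i v => (hb _ _ (k v)).2) u
    have hkk := hk.comp hk'
    have hr : ∀ i, IsPlot fun v => q i (k' v) := fun i => isPlot_reparam (hq i) hk'.contDiff
    have c : ∀ v, G.gerbe.src (q 1 (k' v)) = G.gerbe.tgt (q 0 (k' v)) := fun v =>
      (hsq 1 _).trans (htq 0 _).symm
    have c' : ∀ v, G.gerbe.src (q' 1 v) = G.gerbe.tgt (q' 0 v) := fun v =>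
      (hsq' 1 _).trans (htq' 0 _).symm
    have hc : ∀ i v, G.HComp (q i (k' v)) (q' i v) := fun i v => by
      rw [HComp, hsq, hsq']
      exact ((p (k (k' v))).1 i.castSucc).2
    have hm := G.gerbe.isPlot_mul (hr 1) (hr 0) c
    have hm' := G.gerbe.isPlot_mul (hq' 1) (hq' 0) c'
    have hcm : ∀ v, G.HComp (G.gerbe.mul (q 1 (k' v)) (q 0 (k' v)))
        (G.gerbe.mul (q' 1 v) (q' 0 v)) := fun v => by
      rw [HComp, G.gerbe.src_mul _ _ (c v), G.gerbe.src_mul _ _ (c' v)]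
      exact hc 0 v
    refine ⟨k ∘ k', hkk, ?_⟩
    rw [DForm.ev_zero, FiberPower.delta_ev_three _ _ (isPlot_reparam hp hkk.contDiff)]
    have f0 : FiberPower.face _ 2 0 ∘ p ∘ k ∘ k' =
        fun v => G.hProj ⟨(q 1 (k' v), q' 1 v), hc 1 v⟩ :=
      funext fun v => FiberPower.ext_two
        (Subtype.ext (Prod.ext (hsq 1 _).symm (hsq' 1 _).symm))
        (Subtype.ext (Prod.ext (htq 1 _).symm (htq' 1 _).symm))
    have f1 : FiberPower.face _ 2 1 ∘ p ∘ k ∘ k' = fun v => G.hProj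
        ⟨(G.gerbe.mul (q 1 (k' v)) (q 0 (k' v)), G.gerbe.mul (q' 1 v) (q' 0 v)), hcm v⟩ :=
      funext fun v => FiberPower.ext_two
        (Subtype.ext (Prod.ext ((G.gerbe.src_mul _ _ (c v)).trans (hsq 0 _)).symm
          ((G.gerbe.src_mul _ _ (c' v)).trans (hsq' 0 _)).symm))
        (Subtype.ext (Prod.ext ((G.gerbe.tgt_mul _ _ (c v)).trans (htq 1 _)).symm
          ((G.gerbe.tgt_mul _ _ (c' v)).trans (htq' 1 _)).symm))
    have f2 : FiberPower.face _ 2 2 ∘ p ∘ k ∘ k' =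
        fun v => G.hProj ⟨(q 0 (k' v), q' 0 v), hc 0 v⟩ :=
      funext fun v => FiberPower.ext_two
        (Subtype.ext (Prod.ext (hsq 0 _).symm (hsq' 0 _).symm))
        (Subtype.ext (Prod.ext (htq 0 _).symm (htq' 0 _).symm))
    have hh : (fun v => G.hm (G.gerbe.mul (q 1 (k' v)) (q 0 (k' v)))
        (G.gerbe.mul (q' 1 v) (q' 0 v))) = fun v => G.gerbe.mul (G.hm (q 1 (k' v)) (q' 1 v))
          (G.hm (q 0 (k' v)) (q' 0 v)) :=
      funext fun v => G.hm_mul _ _ _ _ (c v) (c' v) (hc 0 v)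
    have ch : ∀ v, G.gerbe.src (G.hm (q 1 (k' v)) (q' 1 v)) =
        G.gerbe.tgt (G.hm (q 0 (k' v)) (q' 0 v)) := fun v => by
      rw [G.src_hm _ _ (hc 1 v), G.tgt_hm _ _ (hc 0 v), c, c']
    rw [f0, f1, f2, hΨ' (hr 1) (hq' 1) (hc 1), hΨ' hm hm' hcm, hΨ' (hr 0) (hq' 0) (hc 0), hh,
      hA.ev_mul (G.isPlot_hm (hr 1) (hq' 1) (hc 1)) (G.isPlot_hm (hr 0) (hq' 0) (hc 0)) ch,
      hA.ev_mul (hr 1) (hr 0) c, hA.ev_mul (hq' 1) (hq' 0) c']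
    abel)
  refine ⟨α, ?_⟩
  have h1 : α.pullback _ G.dSmooth_src_src - α.pullback _ G.dSmooth_tgt_tgt = Θ := by
    rw [← hΨ, ← hα]
    refine DForm.ext_ev fun n w hw => ?_
    rw [DForm.ev_sub, DForm.ev_pullback _ _ hw, DForm.ev_pullback _ _ hw,
      DForm.ev_pullback _ _ hw, FiberPower.deltaOne_ev _ _ (hsub.smooth n w hw)]
    rfl
  rw [IsMultiplicative, h1]
  simp only [Θ]
  abel

end MultBundleGerbe

/-! ### The two-form on `X^[3]` -/

namespace MultBundleGerbe

open PreBundleTwoGerbe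

variable {M X Y Q : Type*} [TopologicalSpace M] [DiffeologicalSpace M]
  [TopologicalSpace X] [DiffeologicalSpace X] [TopologicalSpace Y] [DiffeologicalSpace Y]
  [DiffeologicalSpace Q] [MulAction ℂˣ Q] (G : MultBundleGerbe M X Y Q) {n : ℕ} {A : DForm Q 1}

theorem dSmooth_fst_compPair : DSmooth fun w : G.CompPair => w.1.1 :=
  dSmooth_fst.comp (dSmooth_val _)

theorem dSmooth_snd_compPair : DSmooth fun w : G.CompPair => w.1.2 :=
  dSmooth_snd.comp (dSmooth_val _)

/-- The failure of `m` to preserve a curving, up to the exterior derivative of `α`. -/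
def defect (f : DForm Y 2) (α : DForm G.CompPair 1) : DForm G.CompPair 2 :=
  f.pullback _ G.m_smooth - f.pullback _ G.dSmooth_fst_compPair -
    f.pullback _ G.dSmooth_snd_compPair - α.d

variable {G} {α : DForm G.CompPair 1} {f : DForm Y 2}

theorem defect_ev {y y' : Euc n → Y} (hy : IsPlot y) (hy' : IsPlot y')
    (h : ∀ v, G.Comp (y v) (y' v)) : (G.defect f α).ev (G.mkPair y y' h) =
      f.ev (fun v => G.m (y v) (y' v)) - f.ev y - f.ev y' - α.d.ev (G.mkPair y y' h) := by
  have hw : IsPlot (G.mkPair y y' h) := ⟨hy, hy'⟩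
  rw [defect, DForm.ev_sub, DForm.ev_sub, DForm.ev_sub, DForm.ev_pullback _ _ hw,
    DForm.ev_pullback _ _ hw, DForm.ev_pullback _ _ hw]
  rfl

theorem base_eq_of_toThree_eq {w w' : G.CompPair} (h : G.toThree w = G.toThree w') :
    G.gerbe.base.toFun w.1.1 = G.gerbe.base.toFun w'.1.1 ∧
      G.gerbe.base.toFun w.1.2 = G.gerbe.base.toFun w'.1.2 := by
  have h0 : G.left w.1.2 = G.left w'.1.2 :=
    congrArg (fun x : FiberPower G.base.toFun 3 => x.1 0) h
  have h1 : G.left w.1.1 = G.left w'.1.1 :=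
    congrArg (fun x : FiberPower G.base.toFun 3 => x.1 1) h
  have h2 : G.right w.1.1 = G.right w'.1.1 :=
    congrArg (fun x : FiberPower G.base.toFun 3 => x.1 2) h
  have e : G.left w.1.1 = G.right w.1.2 := w.2
  have e' : G.left w'.1.1 = G.right w'.1.2 := w'.2
  exact ⟨base_eq h1 h2, base_eq h0 (by rw [← e, ← e', h1])⟩

/-- Two lifts to `Y ∘ Y` are joined by a pair in `Q ∘ Q`. Differentiating the multiplicativity
relation and writing `dA` as `f` at the source minus `f` at the target gives equality of the defect
at both ends. -/
theorem IsMultiplicative.exists_pullback_toThree (hα : G.IsMultiplicative A α)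
    (hf : G.gerbe.IsCurving A f) (hX : HasContinuousPlots X) (hY : HasContinuousPlots Y) :
    ∃ φ : DForm (FiberPower G.base.toFun 3) 2,
      φ.pullback _ (G.isSubduction_toThree hX).smooth = G.defect f α := by
  refine (G.isSubduction_toThree hX).exists_pullback_eq _ fun n w w' hw hw' he => ?_
  refine DForm.ev_eq_ev_of_local _ _ fun u => ?_
  have hb := fun v => G.base_eq_of_toThree_eq (congrFun he v)
  obtain ⟨k, hk, q, hq, hs, ht⟩ := G.gerbe.exists_lifts hY
    (y := ![fun v => (w v).1.1, fun v => (w v).1.2])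
    (y' := ![fun v => (w' v).1.1, fun v => (w' v).1.2])
    (Fin.forall_fin_two.2 ⟨hw.1, hw.2⟩) (Fin.forall_fin_two.2 ⟨hw'.1, hw'.2⟩)
    (Fin.forall_fin_two.2 ⟨fun v => (hb v).1, fun v => (hb v).2⟩) u
  have hc : ∀ v, G.HComp (q 0 v) (q 1 v) := fun v => by
    rw [HComp, hs, hs]
    exact (w (k v)).2
  have hcs : ∀ v, G.Comp (G.gerbe.src (q 0 v)) (G.gerbe.src (q 1 v)) := hc
  have ew : w ∘ k = G.mkPair (fun v => G.gerbe.src (q 0 v)) (fun v => G.gerbe.src (q 1 v)) hcs :=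
    funext fun v => Subtype.ext (Prod.ext (hs 0 v).symm (hs 1 v).symm)
  have ew' : w' ∘ k = G.mkPair (fun v => G.gerbe.tgt (q 0 v)) (fun v => G.gerbe.tgt (q 1 v))
      fun v => (hc v).comp_tgt :=
    funext fun v => Subtype.ext (Prod.ext (ht 0 v).symm (ht 1 v).symm)
  refine ⟨k, hk, ?_⟩
  have h1 := hα.ev_d_hm (hq 0) (hq 1) hc
  rw [hf.ev_d (G.isPlot_hm (hq 0) (hq 1) hc), hf.ev_d (hq 0), hf.ev_d (hq 1)] at h1
  have e1 : (fun v => G.gerbe.src (G.hm (q 0 v) (q 1 v))) =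
      fun v => G.m (G.gerbe.src (q 0 v)) (G.gerbe.src (q 1 v)) :=
    funext fun v => G.src_hm _ _ (hc v)
  have e2 : (fun v => G.gerbe.tgt (G.hm (q 0 v) (q 1 v))) =
      fun v => G.m (G.gerbe.tgt (q 0 v)) (G.gerbe.tgt (q 1 v)) :=
    funext fun v => G.tgt_hm _ _ (hc v)
  rw [e1, e2] at h1
  rw [ew, ew', defect_ev (G.gerbe.isPlot_src (hq 0)) (G.gerbe.isPlot_src (hq 1)),
    defect_ev (G.gerbe.isPlot_tgt (hq 0)) (G.gerbe.isPlot_tgt (hq 1))]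
  rw [sub_eq_iff_eq_add] at h1
  rw [h1]
  abel

/-- After pulling back to `Y ∘ Y`, the three faces become `y`, `m y y'` and `y'`, where `ω` is `df`.
The alternating sum is `d` of the defect, since `ddα = 0`. -/
theorem delta_threeCurvature {φ : DForm (FiberPower G.base.toFun 3) 2}
    {w : DForm (FiberPower G.base.toFun 2) 3} (hX : HasContinuousPlots X)
    (hφ : φ.pullback _ (G.isSubduction_toThree hX).smooth = G.defect f α)
    (hw : G.gerbe.IsThreeCurvature f w) : FiberPower.delta G.base.toFun w = φ.d := by
  have hsub := G.isSubduction_toThree hX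
  refine hsub.ext fun n p hp => ?_
  have h1 : IsPlot fun v => (p v).1.1 := hp.1
  have h2 : IsPlot fun v => (p v).1.2 := hp.2
  have h3 : IsPlot fun v => G.m (p v).1.1 (p v).1.2 := G.m_smooth n p hp
  have f0 : FiberPower.face _ 2 0 ∘ G.toThree ∘ p = G.gerbe.base.toFun ∘ fun v => (p v).1.1 :=
    funext fun v => FiberPower.ext_two rfl rfl
  have f1 : FiberPower.face _ 2 1 ∘ G.toThree ∘ p =
      G.gerbe.base.toFun ∘ fun v => G.m (p v).1.1 (p v).1.2 :=
    funext fun v => FiberPower.ext_two (G.left_m _ _ (p v).2).symm (G.right_m _ _ (p v).2).symm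
  have f2 : FiberPower.face _ 2 2 ∘ G.toThree ∘ p = G.gerbe.base.toFun ∘ fun v => (p v).1.2 :=
    funext fun v => FiberPower.ext_two rfl (p v).2
  rw [FiberPower.delta_ev_three _ _ (hsub.smooth n p hp), f0, f1, f2,
    ← DForm.ev_pullback G.gerbe.base.smooth _ h1, ← DForm.ev_pullback G.gerbe.base.smooth _ h2,
    ← DForm.ev_pullback G.gerbe.base.smooth _ h3, hw, ← DForm.ev_pullback hsub.smooth _ hp,
    ← DForm.d_pullback, hφ, defect, DForm.d_sub, DForm.d_sub, DForm.d_sub, DForm.d_d,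
    DForm.ev_sub, DForm.ev_sub, DForm.ev_sub, DForm.d_pullback, DForm.d_pullback,
    DForm.d_pullback, DForm.ev_pullback _ _ hp, DForm.ev_pullback _ _ hp,
    DForm.ev_pullback _ _ hp, DForm.ev_zero]
  have e1 : (fun w : G.CompPair => w.1.1) ∘ p = fun v => (p v).1.1 := rfl
  have e2 : (fun w : G.CompPair => w.1.2) ∘ p = fun v => (p v).1.2 := rfl
  have e3 : (fun w : G.CompPair => G.m w.1.1 w.1.2) ∘ p = fun v => G.m (p v).1.1 (p v).1.2 := rfl
  rw [e1, e2, e3]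
  abel

theorem comp_m_left {y₃₄ y₂₃ y₁₂ : Y} (h : G.Comp y₃₄ y₂₃) (h' : G.Comp y₂₃ y₁₂) :
    G.Comp (G.m y₃₄ y₂₃) y₁₂ := by
  rw [Comp, G.left_m _ _ h]
  exact h'

theorem comp_m_right {y₃₄ y₂₃ y₁₂ : Y} (h : G.Comp y₃₄ y₂₃) (h' : G.Comp y₂₃ y₁₂) :
    G.Comp y₃₄ (G.m y₂₃ y₁₂) := by
  rw [Comp, G.right_m _ _ h']
  exact h

end MultBundleGerbe

/-! ### The associator one-form on `X^[4]` and the zigzag -/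

namespace BundleTwoGerbe

open PreBundleTwoGerbe MultBundleGerbe

variable {M X Y Q : Type*} [TopologicalSpace M] [DiffeologicalSpace M]
  [TopologicalSpace X] [DiffeologicalSpace X] [TopologicalSpace Y] [DiffeologicalSpace Y]
  [DiffeologicalSpace Q] [MulAction ℂˣ Q] (G : BundleTwoGerbe M X Y Q) {n : ℕ} {A : DForm Q 1}

theorem isPlot_a {x y z : Euc n → Y} (hx : IsPlot x) (hy : IsPlot y) (hz : IsPlot z)
    (h : ∀ v, G.Comp (x v) (y v)) (h' : ∀ v, G.Comp (y v) (z v)) :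
    IsPlot fun v => G.a (x v) (y v) (z v) :=
  G.a_smooth n (G.mkTriple x y z h h') ⟨hx, hy, hz⟩

theorem dSmooth_fst_snd : DSmooth fun w : G.CompTriple =>
    (⟨(w.1.1, w.1.2.1), w.2.1⟩ : G.CompPair) :=
  fun _ _ hp => ⟨hp.1, hp.2.1⟩

theorem dSmooth_snd_thd : DSmooth fun w : G.CompTriple =>
    (⟨(w.1.2.1, w.1.2.2), w.2.2⟩ : G.CompPair) :=
  fun _ _ hp => ⟨hp.2.1, hp.2.2⟩

theorem dSmooth_fst_m : DSmooth fun w : G.CompTriple =>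
    (⟨(w.1.1, G.m w.1.2.1 w.1.2.2), comp_m_right w.2.1 w.2.2⟩ : G.CompPair) :=
  fun _ p hp => ⟨hp.1, G.isPlot_m hp.2.1 hp.2.2 fun v => (p v).2.2⟩

theorem dSmooth_m_thd : DSmooth fun w : G.CompTriple =>
    (⟨(G.m w.1.1 w.1.2.1, w.1.2.2), comp_m_left w.2.1 w.2.2⟩ : G.CompPair) :=
  fun _ p hp => ⟨G.isPlot_m hp.1 hp.2.1 fun v => (p v).2.1, hp.2.2⟩

/-- The one-form on `Y ∘ Y ∘ Y` measuring the failure of the associator to be flat. -/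
def assocForm (A : DForm Q 1) (α : DForm G.CompPair 1) : DForm G.CompTriple 1 :=
  -A.pullback _ G.a_smooth + α.pullback _ G.dSmooth_fst_snd - α.pullback _ G.dSmooth_fst_m +
    α.pullback _ G.dSmooth_m_thd - α.pullback _ G.dSmooth_snd_thd

variable {G} {α : DForm G.CompPair 1} {f : DForm Y 2}

theorem assocForm_ev {x y z : Euc n → Y} (hx : IsPlot x) (hy : IsPlot y) (hz : IsPlot z)
    (h : ∀ v, G.Comp (x v) (y v)) (h' : ∀ v, G.Comp (y v) (z v)) :
    (G.assocForm A α).ev (G.mkTriple x y z h h') =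
      -A.ev (fun v => G.a (x v) (y v) (z v)) + α.ev (G.mkPair x y h) -
        α.ev (G.mkPair x (fun v => G.m (y v) (z v)) fun v => comp_m_right (h v) (h' v)) +
        α.ev (G.mkPair (fun v => G.m (x v) (y v)) z fun v => comp_m_left (h v) (h' v)) -
        α.ev (G.mkPair y z h') := by
  have hw : IsPlot (G.mkTriple x y z h h') := ⟨hx, hy, hz⟩
  rw [assocForm, DForm.ev_sub, DForm.ev_add, DForm.ev_sub, DForm.ev_add, DForm.ev_neg,
    DForm.ev_pullback _ _ hw, DForm.ev_pullback _ _ hw, DForm.ev_pullback _ _ hw,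
    DForm.ev_pullback _ _ hw, DForm.ev_pullback _ _ hw]
  rfl

theorem d_assocForm_ev (hf : G.gerbe.IsCurving A f) {x y z : Euc n → Y} (hx : IsPlot x)
    (hy : IsPlot y) (hz : IsPlot z) (h : ∀ v, G.Comp (x v) (y v))
    (h' : ∀ v, G.Comp (y v) (z v)) :
    (G.assocForm A α).d.ev (G.mkTriple x y z h h') =
      f.ev (fun v => G.m (x v) (G.m (y v) (z v))) - f.ev (fun v => G.m (G.m (x v) (y v)) (z v)) +
        α.d.ev (G.mkPair x y h) -
        α.d.ev (G.mkPair x (fun v => G.m (y v) (z v)) fun v => comp_m_right (h v) (h' v)) +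
        α.d.ev (G.mkPair (fun v => G.m (x v) (y v)) z fun v => comp_m_left (h v) (h' v)) -
        α.d.ev (G.mkPair y z h') := by
  have hw : IsPlot (G.mkTriple x y z h h') := ⟨hx, hy, hz⟩
  have ha := G.isPlot_a hx hy hz h h'
  have e1 : (fun v => G.gerbe.src (G.a (x v) (y v) (z v))) =
      fun v => G.m (G.m (x v) (y v)) (z v) := funext fun v => G.src_a _ _ _ (h v) (h' v)
  have e2 : (fun v => G.gerbe.tgt (G.a (x v) (y v) (z v))) =
      fun v => G.m (x v) (G.m (y v) (z v)) := funext fun v => G.tgt_a _ _ _ (h v) (h' v)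
  have e3 : f.ev (fun v => G.m (x v) (G.m (y v) (z v))) -
      f.ev (fun v => G.m (G.m (x v) (y v)) (z v)) =
      -A.d.ev (fun v => G.a (x v) (y v) (z v)) := by
    rw [hf.ev_d ha, e1, e2, neg_sub]
  rw [e3, assocForm, DForm.d_sub, DForm.d_add, DForm.d_sub, DForm.d_add, DForm.d_neg,
    DForm.ev_sub, DForm.ev_add, DForm.ev_sub, DForm.ev_add, DForm.ev_neg,
    DForm.d_pullback, DForm.d_pullback, DForm.d_pullback, DForm.d_pullback, DForm.d_pullback,
    DForm.ev_pullback _ _ hw, DForm.ev_pullback _ _ hw, DForm.ev_pullback _ _ hw,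
    DForm.ev_pullback _ _ hw, DForm.ev_pullback _ _ hw]
  rfl

theorem base_eq_of_toFour_eq {w w' : G.CompTriple} (h : G.toFour w = G.toFour w') :
    G.gerbe.base.toFun w.1.1 = G.gerbe.base.toFun w'.1.1 ∧
      G.gerbe.base.toFun w.1.2.1 = G.gerbe.base.toFun w'.1.2.1 ∧
      G.gerbe.base.toFun w.1.2.2 = G.gerbe.base.toFun w'.1.2.2 := by
  have h0 : G.left w.1.2.2 = G.left w'.1.2.2 :=
    congrArg (fun x : FiberPower G.base.toFun 4 => x.1 0) h
  have h1 : G.left w.1.2.1 = G.left w'.1.2.1 :=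
    congrArg (fun x : FiberPower G.base.toFun 4 => x.1 1) h
  have h2 : G.left w.1.1 = G.left w'.1.1 :=
    congrArg (fun x : FiberPower G.base.toFun 4 => x.1 2) h
  have h3 : G.right w.1.1 = G.right w'.1.1 :=
    congrArg (fun x : FiberPower G.base.toFun 4 => x.1 3) h
  have e1 : G.left w.1.1 = G.right w.1.2.1 := w.2.1
  have e1' : G.left w'.1.1 = G.right w'.1.2.1 := w'.2.1
  have e2 : G.left w.1.2.1 = G.right w.1.2.2 := w.2.2
  have e2' : G.left w'.1.2.1 = G.right w'.1.2.2 := w'.2.2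
  exact ⟨base_eq h2 h3, base_eq h1 (by rw [← e1, ← e1', h2]),
    base_eq h0 (by rw [← e2, ← e2', h1])⟩

/-- Two lifts to `Y ∘ Y ∘ Y` are joined by three elements of `Q`, to which naturality of the
associator applies. Evaluating `A` on both sides, the terms from the three elements cancel, leaving
`assocForm` at the sources equal to `assocForm` at the targets. -/
theorem exists_pullback_toFour (hA : G.gerbe.IsGerbeConnection A) (hα : G.IsMultiplicative A α)
    (hX : HasContinuousPlots X) (hY : HasContinuousPlots Y) :
    ∃ l : DForm (FiberPower G.base.toFun 4) 1,
      l.pullback _ (G.isSubduction_toFour hX).smooth = G.assocForm A α := by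
  refine (G.isSubduction_toFour hX).exists_pullback_eq _ fun n w w' hw hw' he => ?_
  refine DForm.ev_eq_ev_of_local _ _ fun u => ?_
  have hb := fun v => base_eq_of_toFour_eq (congrFun he v)
  obtain ⟨k, hk, q, hq, hs, ht⟩ := G.gerbe.exists_lifts hY
    (y := ![fun v => (w v).1.1, fun v => (w v).1.2.1, fun v => (w v).1.2.2])
    (y' := ![fun v => (w' v).1.1, fun v => (w' v).1.2.1, fun v => (w' v).1.2.2])
    (by intro i; fin_cases i; exacts [hw.1, hw.2.1, hw.2.2])
    (by intro i; fin_cases i; exacts [hw'.1, hw'.2.1, hw'.2.2])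
    (by intro i v; fin_cases i; exacts [(hb v).1, (hb v).2.1, (hb v).2.2]) u
  have c01 : ∀ v, G.HComp (q 0 v) (q 1 v) := fun v => by
    rw [HComp, hs, hs]
    exact (w (k v)).2.1
  have c12 : ∀ v, G.HComp (q 1 v) (q 2 v) := fun v => by
    rw [HComp, hs, hs]
    exact (w (k v)).2.2
  have s01 : ∀ v, G.Comp (G.gerbe.src (q 0 v)) (G.gerbe.src (q 1 v)) := c01
  have s12 : ∀ v, G.Comp (G.gerbe.src (q 1 v)) (G.gerbe.src (q 2 v)) := c12
  have d01 := fun v => (c01 v).comp_tgt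
  have d12 := fun v => (c12 v).comp_tgt
  have ew : w ∘ k = G.mkTriple (fun v => G.gerbe.src (q 0 v)) (fun v => G.gerbe.src (q 1 v))
      (fun v => G.gerbe.src (q 2 v)) s01 s12 :=
    funext fun v => Subtype.ext (Prod.ext (hs 0 v).symm (Prod.ext (hs 1 v).symm (hs 2 v).symm))
  have ew' : w' ∘ k = G.mkTriple (fun v => G.gerbe.tgt (q 0 v)) (fun v => G.gerbe.tgt (q 1 v))
      (fun v => G.gerbe.tgt (q 2 v)) d01 d12 :=
    funext fun v => Subtype.ext (Prod.ext (ht 0 v).symm (Prod.ext (ht 1 v).symm (ht 2 v).symm))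
  have s0 := G.gerbe.isPlot_src (hq 0)
  have s1 := G.gerbe.isPlot_src (hq 1)
  have s2 := G.gerbe.isPlot_src (hq 2)
  have t0 := G.gerbe.isPlot_tgt (hq 0)
  have t1 := G.gerbe.isPlot_tgt (hq 1)
  have t2 := G.gerbe.isPlot_tgt (hq 2)
  have c0m : ∀ v, G.HComp (q 0 v) (G.hm (q 1 v) (q 2 v)) := fun v => by
    rw [HComp, G.src_hm _ _ (c12 v)]
    exact comp_m_right (c01 v) (c12 v)
  have cm2 : ∀ v, G.HComp (G.hm (q 0 v) (q 1 v)) (q 2 v) := fun v => by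
    rw [HComp, G.src_hm _ _ (c01 v)]
    exact comp_m_left (c01 v) (c12 v)
  have p01 := G.isPlot_hm (hq 0) (hq 1) c01
  have p12 := G.isPlot_hm (hq 1) (hq 2) c12
  have as := G.isPlot_a s0 s1 s2 c01 c12
  have at' := G.isPlot_a t0 t1 t2 d01 d12
  have hnat := congrArg (fun p => A.ev p) (funext fun v => G.a_natural _ _ _ (c01 v) (c12 v))
  rw [hA.ev_mul (G.isPlot_hm (hq 0) p12 c0m) as fun v => by
      rw [G.src_hm _ _ (c0m v), G.src_hm _ _ (c12 v), G.tgt_a _ _ _ (c01 v) (c12 v)],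
    hA.ev_mul at' (G.isPlot_hm p01 (hq 2) cm2) fun v => by
      rw [G.tgt_hm _ _ (cm2 v), G.tgt_hm _ _ (c01 v), G.src_a _ _ _ (d01 v) (d12 v)],
    hα.ev_hm (hq 0) p12 (fun _ => rfl) (fun v => G.src_hm _ _ (c12 v)) (fun _ => rfl)
      (fun v => G.tgt_hm _ _ (c12 v)) (fun v => comp_m_right (c01 v) (c12 v))
      (fun v => comp_m_right (d01 v) (d12 v)),
    hα.ev_hm (hq 1) (hq 2) (fun _ => rfl) (fun _ => rfl) (fun _ => rfl) (fun _ => rfl) c12 d12,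
    hα.ev_hm p01 (hq 2) (fun v => G.src_hm _ _ (c01 v)) (fun _ => rfl)
      (fun v => G.tgt_hm _ _ (c01 v)) (fun _ => rfl) (fun v => comp_m_left (c01 v) (c12 v))
      (fun v => comp_m_left (d01 v) (d12 v)),
    hα.ev_hm (hq 0) (hq 1) (fun _ => rfl) (fun _ => rfl) (fun _ => rfl) (fun _ => rfl) c01 d01]
    at hnat
  refine ⟨k, hk, ?_⟩
  rw [ew, ew', assocForm_ev s0 s1 s2, assocForm_ev t0 t1 t2]
  rw [← sub_eq_zero] at hnat ⊢
  -- The sign is reversed because `assocForm` contains `-a^*A`.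
  rw [← neg_eq_zero, ← hnat]
  abel

/-- In `δφ` the values of `f` on single factors and on binary products cancel, leaving `f` on the
two bracketings of the triple product. These are the endpoints of the associator, so their
difference is `-dA` there. -/
theorem delta_eq_d (hf : G.gerbe.IsCurving A f) (hX : HasContinuousPlots X)
    {φ : DForm (FiberPower G.base.toFun 3) 2} {l : DForm (FiberPower G.base.toFun 4) 1}
    (hφ : φ.pullback _ (G.isSubduction_toThree hX).smooth = G.defect f α)
    (hl : l.pullback _ (G.isSubduction_toFour hX).smooth = G.assocForm A α) :
    FiberPower.delta G.base.toFun φ = l.d := by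
  have hsub := G.isSubduction_toFour hX
  refine hsub.ext fun n p hp => ?_
  have hx : IsPlot fun v => (p v).1.1 := hp.1
  have hy : IsPlot fun v => (p v).1.2.1 := hp.2.1
  have hz : IsPlot fun v => (p v).1.2.2 := hp.2.2
  have h : ∀ v, G.Comp (p v).1.1 (p v).1.2.1 := fun v => (p v).2.1
  have h' : ∀ v, G.Comp (p v).1.2.1 (p v).1.2.2 := fun v => (p v).2.2
  have hxy := G.isPlot_m hx hy h
  have hyz := G.isPlot_m hy hz h'
  have key : ∀ {y y' : Euc n → Y} (hy : IsPlot y) (hy' : IsPlot y')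
      (c : ∀ v, G.Comp (y v) (y' v)), φ.ev (G.toThree ∘ G.mkPair y y' c) =
        f.ev (fun v => G.m (y v) (y' v)) - f.ev y - f.ev y' - α.d.ev (G.mkPair y y' c) := by
    intro y y' hy hy' c
    have hw : IsPlot (G.mkPair y y' c) := ⟨hy, hy'⟩
    rw [← defect_ev hy hy' c, ← hφ, DForm.ev_pullback _ _ hw]
  have f0 : FiberPower.face _ 3 0 ∘ G.toFour ∘ p = G.toThree ∘ G.mkPair _ _ h :=
    funext fun v => FiberPower.ext_three rfl rfl rfl
  have f1 : FiberPower.face _ 3 1 ∘ G.toFour ∘ p = G.toThree ∘ G.mkPair (fun v => (p v).1.1)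
      (fun v => G.m (p v).1.2.1 (p v).1.2.2) fun v => comp_m_right (h v) (h' v) :=
    funext fun v => FiberPower.ext_three (G.left_m _ _ (h' v)).symm rfl rfl
  have f2 : FiberPower.face _ 3 2 ∘ G.toFour ∘ p =
      G.toThree ∘ G.mkPair (fun v => G.m (p v).1.1 (p v).1.2.1) (fun v => (p v).1.2.2)
        fun v => comp_m_left (h v) (h' v) :=
    funext fun v => FiberPower.ext_three rfl (G.left_m _ _ (h v)).symm (G.right_m _ _ (h v)).symm
  have f3 : FiberPower.face _ 3 3 ∘ G.toFour ∘ p = G.toThree ∘ G.mkPair _ _ h' :=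
    funext fun v => FiberPower.ext_three rfl rfl (h v)
  rw [FiberPower.delta_ev_four _ _ (hsub.smooth n p hp), f0, f1, f2, f3, key hx hy h,
    key hx hyz, key hxy hz, key hy hz h', ← DForm.ev_pullback hsub.smooth _ hp,
    ← DForm.d_pullback, hl]
  have e := d_assocForm_ev (α := α) hf hx hy hz h h'
  have ep : G.mkTriple _ _ _ h h' = p := rfl
  rw [ep] at e
  rw [e]
  abel

/-- Evaluate `A` on the pentagon. Composition becomes addition, and whiskering an associator with an
identity adds only differences of `α`, the identities being flat. Of the `α`-terms in the five
copies of `assocForm`, those not matched by these differences cancel in pairs. -/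
theorem pentagon_assocForm (hA : G.gerbe.IsGerbeConnection A) (hα : G.IsMultiplicative A α)
    {y₄₅ y₃₄ y₂₃ y₁₂ : Euc n → Y} {e₄₅ e₁₂ : Euc n → Q} (h₄₅ : IsPlot y₄₅) (h₃₄ : IsPlot y₃₄)
    (h₂₃ : IsPlot y₂₃) (h₁₂ : IsPlot y₁₂) (he₄₅ : IsPlot e₄₅) (he₁₂ : IsPlot e₁₂)
    (hi₄₅ : ∀ v, G.gerbe.IsIdentity (e₄₅ v) (y₄₅ v))
    (hi₁₂ : ∀ v, G.gerbe.IsIdentity (e₁₂ v) (y₁₂ v)) (hA₄₅ : A.ev e₄₅ = 0) (hA₁₂ : A.ev e₁₂ = 0)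
    (c₄ : ∀ v, G.Comp (y₄₅ v) (y₃₄ v)) (c₃ : ∀ v, G.Comp (y₃₄ v) (y₂₃ v))
    (c₂ : ∀ v, G.Comp (y₂₃ v) (y₁₂ v)) :
    -(G.assocForm A α).ev (G.mkTriple y₄₅ y₃₄ y₂₃ c₄ c₃) +
      (G.assocForm A α).ev (G.mkTriple y₄₅ y₃₄ (fun v => G.m (y₂₃ v) (y₁₂ v)) c₄
        fun v => comp_m_right (c₃ v) (c₂ v)) -
      (G.assocForm A α).ev (G.mkTriple y₄₅ (fun v => G.m (y₃₄ v) (y₂₃ v)) y₁₂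
        (fun v => comp_m_right (c₄ v) (c₃ v)) fun v => comp_m_left (c₃ v) (c₂ v)) +
      (G.assocForm A α).ev (G.mkTriple (fun v => G.m (y₄₅ v) (y₃₄ v)) y₂₃ y₁₂
        (fun v => comp_m_left (c₄ v) (c₃ v)) c₂) -
      (G.assocForm A α).ev (G.mkTriple y₃₄ y₂₃ y₁₂ c₃ c₂) = 0 := by
  have m₄ := G.isPlot_m h₄₅ h₃₄ c₄
  have m₃ := G.isPlot_m h₃₄ h₂₃ c₃
  have m₂ := G.isPlot_m h₂₃ h₁₂ c₂
  have a₄₃₂ := G.isPlot_a h₄₅ h₃₄ h₂₃ c₄ c₃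
  have a₃₂₁ := G.isPlot_a h₃₄ h₂₃ h₁₂ c₃ c₂
  have r₃ := fun v => comp_m_right (c₄ v) (c₃ v)
  have r₂ := fun v => comp_m_right (c₃ v) (c₂ v)
  have l₄ := fun v => comp_m_left (c₄ v) (c₃ v)
  have l₃ := fun v => comp_m_left (c₃ v) (c₂ v)
  have b₁ := G.isPlot_a h₄₅ m₃ h₁₂ r₃ l₃
  have b₂ := G.isPlot_a h₄₅ h₃₄ m₂ c₄ r₂
  have b₃ := G.isPlot_a m₄ h₂₃ h₁₂ l₄ c₂
  have s₃₂₁ := fun v => G.src_a _ _ _ (c₃ v) (c₂ v)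
  have t₃₂₁ := fun v => G.tgt_a _ _ _ (c₃ v) (c₂ v)
  have s₄₃₂ := fun v => G.src_a _ _ _ (c₄ v) (c₃ v)
  have t₄₃₂ := fun v => G.tgt_a _ _ _ (c₄ v) (c₃ v)
  have k₁ : ∀ v, G.HComp (e₄₅ v) (G.a (y₃₄ v) (y₂₃ v) (y₁₂ v)) := fun v => by
    rw [HComp, (hi₄₅ v).1, s₃₂₁]
    exact comp_m_right (r₃ v) (l₃ v)
  have k₂ : ∀ v, G.HComp (G.a (y₄₅ v) (y₃₄ v) (y₂₃ v)) (e₁₂ v) := fun v => by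
    rw [HComp, (hi₁₂ v).1, s₄₃₂]
    exact comp_m_left (l₄ v) (c₂ v)
  have p₁ := G.isPlot_hm he₄₅ a₃₂₁ k₁
  have p₂ := G.isPlot_hm a₄₃₂ he₁₂ k₂
  have j₁ : ∀ v, G.gerbe.src (G.a (y₄₅ v) (G.m (y₃₄ v) (y₂₃ v)) (y₁₂ v)) =
      G.gerbe.tgt (G.hm (G.a (y₄₅ v) (y₃₄ v) (y₂₃ v)) (e₁₂ v)) := fun v => by
    rw [G.src_a _ _ _ (r₃ v) (l₃ v), G.tgt_hm _ _ (k₂ v), t₄₃₂, (hi₁₂ v).2.1]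
  have j₂ : ∀ v, G.gerbe.src (G.hm (e₄₅ v) (G.a (y₃₄ v) (y₂₃ v) (y₁₂ v))) =
      G.gerbe.tgt (G.gerbe.mul (G.a (y₄₅ v) (G.m (y₃₄ v) (y₂₃ v)) (y₁₂ v))
        (G.hm (G.a (y₄₅ v) (y₃₄ v) (y₂₃ v)) (e₁₂ v))) := fun v => by
    rw [G.gerbe.tgt_mul _ _ (j₁ v), G.tgt_a _ _ _ (r₃ v) (l₃ v), G.src_hm _ _ (k₁ v), s₃₂₁,
      (hi₄₅ v).1]
  have j₃ : ∀ v, G.gerbe.src (G.a (y₄₅ v) (y₃₄ v) (G.m (y₂₃ v) (y₁₂ v))) =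
      G.gerbe.tgt (G.a (G.m (y₄₅ v) (y₃₄ v)) (y₂₃ v) (y₁₂ v)) := fun v => by
    rw [G.src_a _ _ _ (c₄ v) (r₂ v), G.tgt_a _ _ _ (l₄ v) (c₂ v)]
  have hpent := congrArg (fun p => A.ev p) (funext fun v =>
    G.pentagon _ _ _ _ _ _ (c₄ v) (c₃ v) (c₂ v) (hi₄₅ v) (hi₁₂ v))
  rw [hA.ev_mul p₁ (G.gerbe.isPlot_mul b₁ p₂ j₁) j₂, hA.ev_mul b₁ p₂ j₁, hA.ev_mul b₂ b₃ j₃,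
    hα.ev_hm he₄₅ a₃₂₁ (fun v => (hi₄₅ v).1) s₃₂₁ (fun v => (hi₄₅ v).2.1) t₃₂₁
      (fun v => comp_m_right (r₃ v) (l₃ v)) (fun v => comp_m_right (c₄ v) (r₂ v)),
    hα.ev_hm a₄₃₂ he₁₂ s₄₃₂ (fun v => (hi₁₂ v).1) t₄₃₂ (fun v => (hi₁₂ v).2.1)
      (fun v => comp_m_left (l₄ v) (c₂ v)) (fun v => comp_m_left (r₃ v) (l₃ v)), hA₄₅, hA₁₂]
    at hpent
  rw [assocForm_ev h₄₅ h₃₄ h₂₃, assocForm_ev h₄₅ h₃₄ m₂, assocForm_ev h₄₅ m₃ h₁₂,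
    assocForm_ev m₄ h₂₃ h₁₂, assocForm_ev h₃₄ h₂₃ h₁₂]
  rw [← sub_eq_zero] at hpent
  rw [← hpent]
  abel

/-- A point of `X^[5]` is lifted to four composable elements of `Y`, and identities are chosen over
the two outer ones, as the pentagon requires. -/
theorem delta_eq_zero (hA : G.gerbe.IsGerbeConnection A) (hα : G.IsMultiplicative A α)
    (hX : HasContinuousPlots X) (hY : HasContinuousPlots Y)
    {l : DForm (FiberPower G.base.toFun 4) 1}
    (hl : l.pullback _ (G.isSubduction_toFour hX).smooth = G.assocForm A α) :
    FiberPower.delta G.base.toFun l = 0 := by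
  refine DForm.ext_ev fun n p hp => DForm.ev_eq_ev_of_local _ _ fun u => ?_
  obtain ⟨k₁, hk₁, x, hx, hxl, hxr⟩ := G.exists_lifts hX hp u
  obtain ⟨k₂, hk₂, e₂, he₂, hi₂, hA₂⟩ := hA.exists_isIdentity hY (hx 3) u
  obtain ⟨k₃, hk₃, e₁, he₁, hi₁, hA₁⟩ :=
    hA.exists_isIdentity hY (isPlot_reparam (hx 0) hk₂.contDiff) u
  have hk := hk₁.comp (hk₂.comp hk₃)
  refine ⟨k₁ ∘ k₂ ∘ k₃, hk, ?_⟩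
  -- With zero-based indices, `y 3, y 2, y 1, y 0` play the roles of `y₄₅, y₃₄, y₂₃, y₁₂`.
  obtain ⟨y, hy⟩ : ∃ y : Fin 4 → Euc n → Y, y = fun i v => x i (k₂ (k₃ v)) := ⟨_, rfl⟩
  have hyp : ∀ i, IsPlot (y i) := fun i => by
    rw [hy]
    exact isPlot_reparam (hx i) (hk₂.comp hk₃).contDiff
  have hyl : ∀ i v, G.left (y i v) = (p (k₁ (k₂ (k₃ v)))).1 i.castSucc := fun i v => by
    rw [hy]
    exact hxl i _
  have hyr : ∀ i v, G.right (y i v) = (p (k₁ (k₂ (k₃ v)))).1 i.succ := fun i v => by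
    rw [hy]
    exact hxr i _
  have c₄ : ∀ v, G.Comp (y 3 v) (y 2 v) := fun v => (hyl 3 v).trans (hyr 2 v).symm
  have c₃ : ∀ v, G.Comp (y 2 v) (y 1 v) := fun v => (hyl 2 v).trans (hyr 1 v).symm
  have c₂ : ∀ v, G.Comp (y 1 v) (y 0 v) := fun v => (hyl 1 v).trans (hyr 0 v).symm
  -- `e₂` was chosen before the last localizer; flatness survives pulling back along `k₃`.
  have hA₂' : A.ev (e₂ ∘ k₃) = 0 := by
    funext v
    rw [DForm.ev_comp _ (he₂.isPlotAt _) hk₃.contDiff, hA₂]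
    ext
    simp
  have hpent := pentagon_assocForm hA hα (hyp 3) (hyp 2) (hyp 1) (hyp 0)
    (isPlot_reparam he₂ hk₃.contDiff) he₁ (fun v => by rw [hy]; exact hi₂ (k₃ v))
    (fun v => by rw [hy]; exact hi₁ v) hA₂' hA₁ c₄ c₃ c₂
  have key : ∀ {x y z : Euc n → Y} (_ : IsPlot x) (_ : IsPlot y) (_ : IsPlot z)
      (c : ∀ v, G.Comp (x v) (y v)) (c' : ∀ v, G.Comp (y v) (z v)),
      (G.assocForm A α).ev (G.mkTriple x y z c c') = l.ev (G.toFour ∘ G.mkTriple x y z c c') := by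
    intro x y z hx hy hz c c'
    have hw : IsPlot (G.mkTriple x y z c c') := ⟨hx, hy, hz⟩
    rw [← hl, DForm.ev_pullback _ _ hw]
  have ext4 : ∀ {x y : FiberPower G.base.toFun 4}, x.1 0 = y.1 0 → x.1 1 = y.1 1 →
      x.1 2 = y.1 2 → x.1 3 = y.1 3 → x = y := fun h0 h1 h2 h3 =>
    Subtype.ext (funext fun i => by fin_cases i <;> assumption)
  have m₄ := G.isPlot_m (hyp 3) (hyp 2) c₄
  have m₃ := G.isPlot_m (hyp 2) (hyp 1) c₃
  have m₂ := G.isPlot_m (hyp 1) (hyp 0) c₂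
  rw [key (hyp 3) (hyp 2) (hyp 1), key (hyp 3) (hyp 2) m₂, key (hyp 3) m₃ (hyp 0),
    key m₄ (hyp 1) (hyp 0), key (hyp 2) (hyp 1) (hyp 0)] at hpent
  rw [FiberPower.delta_ev_five _ _ (isPlot_reparam hp hk.contDiff), DForm.ev_zero, ← hpent]
  -- Each inner face of `X^[5]` composes two adjacent elements of `Y`; the two outer faces drop the
  -- first or the last one.
  congr 1
  · congr 1
    · congr 1
      · congr 1
        · congr 2
          exact funext fun v => ext4 (hyl 1 v).symm (hyl 2 v).symm (hyl 3 v).symm (hyr 3 v).symm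
        · congr 1
          exact funext fun v => ext4 ((G.left_m _ _ (c₂ v)).trans (hyl 0 v)).symm
            (hyl 2 v).symm (hyl 3 v).symm (hyr 3 v).symm
      · congr 1
        exact funext fun v => ext4 (hyl 0 v).symm ((G.left_m _ _ (c₃ v)).trans (hyl 1 v)).symm
          (hyl 3 v).symm (hyr 3 v).symm
    · congr 1
      exact funext fun v => ext4 (hyl 0 v).symm (hyl 1 v).symm
        ((G.left_m _ _ (c₄ v)).trans (hyl 2 v)).symm ((G.right_m _ _ (c₄ v)).trans (hyr 3 v)).symm
  · congr 1
    exact funext fun v => ext4 (hyl 0 v).symm (hyl 1 v).symm (hyl 2 v).symm (hyr 2 v).symm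

/-- The zigzag is solved from the top: `l = δμ`, then `φ - dμ = δb`. The correction of the curving
is `-b`. -/
theorem exists_isTwoGerbeConnection (hA : G.gerbe.IsGerbeConnection A)
    (hf : G.gerbe.IsCurving A f) (hM : HasContinuousPlots M) (hX : HasContinuousPlots X)
    (hY : HasContinuousPlots Y) (hpM : SupportsPartitionsOfUnity M)
    (hpX : SupportsPartitionsOfUnity (FiberPower G.base.toFun 2)) :
    ∃ b : DForm (FiberPower G.base.toFun 2) 2,
      G.IsTwoGerbeConnection A (f + b.pullback G.gerbe.base.toFun G.gerbe.base.smooth) := by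
  obtain ⟨α, hα⟩ := MultBundleGerbe.exists_isMultiplicative hA hX hY hpX
  obtain ⟨φ, hφ⟩ := hα.exists_pullback_toThree hf hX hY
  obtain ⟨l, hl⟩ := exists_pullback_toFour hA hα hX hY
  obtain ⟨w, hw⟩ := hf.exists_isThreeCurvature (hX.fiberPower _ 2) hY
  obtain ⟨ρ, s, hρ, hs⟩ := G.base.exists_isAveraging hM hpM
  obtain ⟨μ, hμ⟩ := FiberPower.exists_delta_eq G.base.smooth hρ hs l
    (delta_eq_zero hA hα hX hY hl)
  obtain ⟨b, hb⟩ := FiberPower.exists_delta_eq G.base.smooth hρ hs (φ - μ.d) (by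
    rw [FiberPower.delta_sub, ← FiberPower.d_delta, hμ, delta_eq_d hf hX hφ hl, sub_self])
  refine ⟨-b, hA, ?_, w + (-b).d, ?_, ?_⟩
  -- A form pulled back from `X^[2]` takes equal values at the two entries of `Y^[2]`, so `δ`
  -- annihilates it and the curving equation is unaffected.
  · have h0 : FiberPower.deltaOne G.gerbe.base.toFun
        ((-b).pullback G.gerbe.base.toFun G.gerbe.base.smooth) = 0 := by
      refine DForm.ext_ev fun n p hp => ?_
      rw [FiberPower.deltaOne_ev _ _ hp, DForm.ev_pullback _ _ (hp 0),
        DForm.ev_pullback _ _ (hp 1), DForm.ev_zero, sub_eq_zero]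
      congr 1
      exact funext fun v => (p v).2 0 1
    have h1 : FiberPower.deltaOne G.gerbe.base.toFun
        (f + (-b).pullback G.gerbe.base.toFun G.gerbe.base.smooth) =
        FiberPower.deltaOne G.gerbe.base.toFun f := by
      rw [FiberPower.deltaOne, DForm.pullback_add, FiberPower.delta_add]
      exact (congrArg _ h0).trans (add_zero _)
    rw [BundleGerbe.IsCurving, h1]
    exact hf
  · rw [BundleGerbe.IsThreeCurvature, DForm.pullback_add, hw, DForm.d_add, DForm.d_pullback]
  · rw [FiberPower.delta_add, delta_threeCurvature hX hφ hw, ← FiberPower.d_delta,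
      FiberPower.delta_neg, hb, DForm.d_neg, DForm.d_sub, DForm.d_d, sub_zero, add_neg_cancel]

end BundleTwoGerbe

end

/-! ### Existence of bundle 2-gerbe connections on manifolds -/

theorem mainTheorem11
    {EM HM M EX HX X EY HY Y EQ HQ Q : Type*}
    [NormedAddCommGroup EM] [NormedSpace ℝ EM] [CompleteSpace EM] [TopologicalSpace HM]
    (IM : ModelWithCorners ℝ EM HM) [TopologicalSpace M] [ChartedSpace HM M]
    [IsManifold IM ∞ M] [BoundarylessManifold IM M]
    [NormedAddCommGroup EX] [NormedSpace ℝ EX] [CompleteSpace EX] [TopologicalSpace HX]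
    (IX : ModelWithCorners ℝ EX HX) [TopologicalSpace X] [ChartedSpace HX X]
    [IsManifold IX ∞ X] [BoundarylessManifold IX X]
    [NormedAddCommGroup EY] [NormedSpace ℝ EY] [CompleteSpace EY] [TopologicalSpace HY]
    (IY : ModelWithCorners ℝ EY HY) [TopologicalSpace Y] [ChartedSpace HY Y]
    [IsManifold IY ∞ Y] [BoundarylessManifold IY Y]
    [NormedAddCommGroup EQ] [NormedSpace ℝ EQ] [CompleteSpace EQ] [TopologicalSpace HQ]
    (IQ : ModelWithCorners ℝ EQ HQ) [TopologicalSpace Q] [ChartedSpace HQ Q]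
    [IsManifold IQ ∞ Q] [BoundarylessManifold IQ Q] [MulAction ℂˣ Q] :
    letI := manifoldDiffeology IM M
    letI := manifoldDiffeology IX X
    letI := manifoldDiffeology IY Y
    letI := manifoldDiffeology IQ Q
    ∀ G : BundleTwoGerbe M X Y Q,
      SupportsPartitionsOfUnity M →
      SupportsPartitionsOfUnity (FiberPower G.base.toFun 2) →
      SupportsPartitionsOfUnity (FiberPower G.gerbe.base.toFun 2) →
      (∃ (A : DForm Q 1) (f₁ : DForm Y 2), G.IsTwoGerbeConnection A f₁) ∧
      ∀ (A : DForm Q 1) (f : DForm Y 2), G.gerbe.IsGerbeConnection A → G.gerbe.IsCurving A f →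
        ∃ b : DForm (FiberPower G.base.toFun 2) 2,
          G.IsTwoGerbeConnection A (f + b.pullback G.gerbe.base.toFun G.gerbe.base.smooth) := by
  intro G hpM hpX hpY
  let _ := manifoldDiffeology IM M
  let _ := manifoldDiffeology IX X
  let _ := manifoldDiffeology IY Y
  let _ := manifoldDiffeology IQ Q
  have hM : HasContinuousPlots M := hasContinuousPlots_manifold IM
  have hX : HasContinuousPlots X := hasContinuousPlots_manifold IX
  have hY : HasContinuousPlots Y := hasContinuousPlots_manifold IY
  have key : ∀ (A : DForm Q 1) (f : DForm Y 2), G.gerbe.IsGerbeConnection A →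
      G.gerbe.IsCurving A f → ∃ b : DForm (FiberPower G.base.toFun 2) 2,
        G.IsTwoGerbeConnection A (f + b.pullback G.gerbe.base.toFun G.gerbe.base.smooth) :=
    fun A f hA hf => BundleTwoGerbe.exists_isTwoGerbeConnection hA hf hM hX hY hpM hpX
  obtain ⟨A, hA⟩ := G.gerbe.exists_isGerbeConnection (hX.fiberPower _ 2) hY hpX hpY
  obtain ⟨f, hf⟩ := hA.exists_isCurving (hX.fiberPower _ 2) hY hpX
  obtain ⟨b, hb⟩ := key A f hA hf
  exact ⟨⟨A, _, hb⟩, key⟩
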